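/- A \emph{plane graph} is a connected simple graph with at least one edge, given with a plane embedding, that is, with the counterclockwise circular order of the edges at each vertex (realizable by a planar drawing) and the choice of the outer face. The degree of a face is the length of its boundary walk. A \emph{unit-length grid drawing} maps the vertices to distinct points of $\mathbb{Z}^2$ and the edges to (horizontal or vertical) straight-line segments of length $1$. A unit-length grid drawing of a connected plane graph is \emph{embedding-preserving} if it has the prescribed counterclockwise order of the edges at each vertex and its unbounded face is the chosen outer face. The following problem is solvable in $O(n)$ time, where $n$ is the number of vertices of $G$. Given a biconnected plane graph $G$ (i.e. $G$ is connected and has no cut vertex) all of whose internal faces have degree at most $6$, and a unit-length grid drawing $\Gamma_o$ of the boundary of the outer face of $G$, decide whether $G$ has an embedding-preserving unit-length grid drawing in which every vertex incident to the outer face has the position that it has in $\Gamma_o$. More precisely, there are a random access machine program (with addition, subtraction, comparison and indirect addressing at unit cost) and a constant $c$ such that on each such instance, given as the list of the tails, the reverses and the counterclockwise successors of the directed edges, one directed edge with the outer face to its left, and the coordinates of $\Gamma_o$, the program halts after at most $c\,n$ steps with the correct answer, and uses only words of absolute value at most $W^c$ (that is, of $O(\log W)$ bits) whenever $W$ is at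 least the number of input words and the absolute value of each of them. -/

import Mathlib

namespace UnitGrid

/-! ### Random access machine

The machine has integer registers and one integer memory, both initially zero apart from the input,
and only addition and subtraction as arithmetic. Programs are structured (sequencing, branching,
loops); each elementary instruction and each evaluation of a test costs one step. The semantics
carries a word bound `B`: no word whose absolute value exceeds `B` is ever produced. -/

/-- Tests comparing the contents of two registers. -/
inductive Test where
  | lt (a b : ℕ)
  | eq (a b : ℕ)

/-- Programs; the natural numbers are names of registers. -/
inductive Prog where
  | skip
  /-- `r := z` -/
  | const (r : ℕ) (z : ℤ)
  /-- `r := a + b` -/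
  | add (r a b : ℕ)
  /-- `r := a - b` -/
  | sub (r a b : ℕ)
  /-- `r := mem[a]` -/
  | load (r a : ℕ)
  /-- `mem[a] := b` -/
  | store (a b : ℕ)
  | seq (p q : Prog)
  | ite (b : Test) (p q : Prog)
  | while (b : Test) (p : Prog)

/-- The contents of the registers and of the memory. -/
structure State where
  reg : ℕ → ℤ
  mem : ℤ → ℤ

/-- Overwrite one register. -/
def State.setReg (s : State) (r : ℕ) (z : ℤ) : State :=
  { s with reg := Function.update s.reg r z }

/-- Overwrite one memory cell. -/
def State.setMem (s : State) (a z : ℤ) : State :=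
  { s with mem := Function.update s.mem a z }

/-- The outcome of a test. -/
def Test.Holds (s : State) : Test → Prop
  | .lt a b => s.reg a < s.reg b
  | .eq a b => s.reg a = s.reg b

/-- `Runs B p s t s'`: started in state `s`, the program `p` halts in state `s'` after exactly `t`
steps, and no word of absolute value larger than `B` is produced on the way. -/
inductive Runs (B : ℕ) : Prog → State → ℕ → State → Prop where
  | skip (s : State) : Runs B .skip s 1 s
  | const (s : State) (r : ℕ) (z : ℤ) (h : |z| ≤ B) :
      Runs B (.const r z) s 1 (s.setReg r z)
  | add (s : State) (r a b : ℕ) (h : |s.reg a + s.reg b| ≤ B) :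
      Runs B (.add r a b) s 1 (s.setReg r (s.reg a + s.reg b))
  | sub (s : State) (r a b : ℕ) (h : |s.reg a - s.reg b| ≤ B) :
      Runs B (.sub r a b) s 1 (s.setReg r (s.reg a - s.reg b))
  | load (s : State) (r a : ℕ) (h : |s.mem (s.reg a)| ≤ B) :
      Runs B (.load r a) s 1 (s.setReg r (s.mem (s.reg a)))
  | store (s : State) (a b : ℕ) :
      Runs B (.store a b) s 1 (s.setMem (s.reg a) (s.reg b))
  | seq {p q : Prog} {s s' s'' : State} {t t' : ℕ}
      (hp : Runs B p s t s') (hq : Runs B q s' t' s'') :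
      Runs B (.seq p q) s (t + t') s''
  | ite_true {b : Test} {p q : Prog} {s s' : State} {t : ℕ}
      (hb : b.Holds s) (hp : Runs B p s t s') : Runs B (.ite b p q) s (t + 1) s'
  | ite_false {b : Test} {p q : Prog} {s s' : State} {t : ℕ}
      (hb : ¬ b.Holds s) (hq : Runs B q s t s') : Runs B (.ite b p q) s (t + 1) s'
  | while_true {b : Test} {p : Prog} {s s' s'' : State} {t t' : ℕ}
      (hb : b.Holds s) (hp : Runs B p s t s') (hw : Runs B (.while b p) s' t' s'') :
      Runs B (.while b p) s (t + t' + 1) s''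
  | while_false {b : Test} {p : Prog} {s : State}
      (hb : ¬ b.Holds s) : Runs B (.while b p) s 1 s

/-- The initial state: the input words lie in the memory cells `0, 1, 2, …`; all the other cells
and all the registers are zero. -/
def State.init (input : List ℤ) : State where
  reg _ := 0
  mem a := if 0 ≤ a then input.getD a.toNat 0 else 0

/-- `W` is at least the number of input words and the absolute value of each of them, so that
`O(log W)` bits suffice for an input word and for an address of one. -/
def FitsIn (input : List ℤ) (W : ℕ) : Prop :=
  input.length ≤ W ∧ ∀ z ∈ input, |z| ≤ W

/-! ### Plane graphs -/

section PlaneGraphs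

variable {n : ℕ}

/-- If `rot` sends each dart to the counterclockwise next dart with the same tail, this sends a
dart `d` to the next dart on the boundary walk of the face to the left of `d`. -/
def faceNext (G : SimpleGraph (Fin n)) (rot : Equiv.Perm G.Dart) : Equiv.Perm G.Dart :=
  (Function.Involutive.toPerm SimpleGraph.Dart.symm SimpleGraph.Dart.symm_involutive).trans rot.symm

/-- The number of faces of a rotation system. -/
noncomputable def faceCount (G : SimpleGraph (Fin n)) (rot : Equiv.Perm G.Dart) : ℕ :=
  Nat.card (Quotient (Equiv.Perm.SameCycle.setoid (faceNext G rot)))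

/-- A connected plane graph with at least one edge and vertex set `Fin n`: a connected simple graph
with, for each vertex, a counterclockwise cyclic order of the edges at this vertex, such that these
orders define an embedding in the sphere (Euler's formula), and with a choice of the outer face. -/
structure PlaneGraph (n : ℕ) where
  /-- the underlying graph -/
  graph : SimpleGraph (Fin n)
  connected : graph.Connected
  /-- the counterclockwise next dart with the same tail -/
  rot : Equiv.Perm graph.Dart
  rot_sameCycle : ∀ d e : graph.Dart, rot.SameCycle d e ↔ d.fst = e.fst
  euler : n + faceCount graph rot = graph.edgeSet.ncard + 2
  /-- a dart that has the outer face to its left -/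
  outer : graph.Dart

namespace PlaneGraph

variable (G : PlaneGraph n)

/-- The face to the left of the dart `d` is the face to the left of the dart `e`. -/
def SameFace (d e : G.graph.Dart) : Prop :=
  (faceNext G.graph G.rot).SameCycle d e

/-- The dart `d` has the outer face to its left. -/
def OnOuter (d : G.graph.Dart) : Prop := G.SameFace G.outer d

/-- The vertices incident to the outer face. -/
def outerVertices : Set (Fin n) := {v | ∃ d, G.OnOuter d ∧ d.fst = v}

/-- The degree of the face to the left of `d`: the length of its boundary walk. -/
noncomputable def faceDegree (d : G.graph.Dart) : ℕ := {e | G.SameFace d e}.ncard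

/-- The graph is connected and removing a vertex does not disconnect it. -/
def Biconnected : Prop :=
  G.graph.Connected ∧ ∀ v : Fin n, (G.graph.induce {v}ᶜ).Connected

end PlaneGraph

/-! ### Unit-length grid drawings -/

/-- Two grid points have Euclidean distance one. -/
def UnitDist (p q : ℤ × ℤ) : Prop := (p.1 - q.1) ^ 2 + (p.2 - q.2) ^ 2 = 1

/-- A unit-length grid drawing: distinct vertices are at distinct grid points, and the edges are
straight-line segments of length one (hence horizontal or vertical). -/
def IsUnitGridDrawing (G : SimpleGraph (Fin n)) (pos : Fin n → ℤ × ℤ) : Prop :=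
  Function.Injective pos ∧ ∀ u v, G.Adj u v → UnitDist (pos u) (pos v)

/-- A unit-length grid drawing of the boundary of the outer face. -/
structure OuterDrawing (G : PlaneGraph n) where
  pos : G.outerVertices → ℤ × ℤ
  injective : Function.Injective pos
  unit : ∀ u v : G.outerVertices,
    (∃ d, G.OnOuter d ∧ d.fst = u ∧ d.snd = v) → UnitDist (pos u) (pos v)

/-- Counterclockwise rotation by a quarter turn. -/
def quarterTurn (p : ℤ × ℤ) : ℤ × ℤ := (-p.2, p.1)

/-- The vector from the tail to the head of a dart. -/
def dartVec {G : SimpleGraph (Fin n)} (pos : Fin n → ℤ × ℤ) (d : G.Dart) : ℤ × ℤ :=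
  pos d.snd - pos d.fst

/-- The drawing has the prescribed counterclockwise order of the edges at each vertex: turning
counterclockwise from the dart `d`, the first dart with the same tail that one meets is `rot d`
(which is `d` itself, after a full turn, if there is no other one). -/
def PreservesRotation (G : PlaneGraph n) (pos : Fin n → ℤ × ℤ) : Prop :=
  ∀ d : G.graph.Dart, ∃ k : ℕ, 1 ≤ k ∧ k ≤ 4 ∧
    dartVec pos (G.rot d) = quarterTurn^[k] (dartVec pos d) ∧
    ∀ e : G.graph.Dart, e.fst = d.fst → ∀ j : ℕ, 1 ≤ j → j < k →
      dartVec pos e ≠ quarterTurn^[j] (dartVec pos d)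

/-- A grid point as a point of the real plane. -/
def toPlane (p : ℤ × ℤ) : ℝ × ℝ := (p.1, p.2)

/-- The part of the plane covered by the edges of the drawing. -/
def drawnSet (G : SimpleGraph (Fin n)) (pos : Fin n → ℤ × ℤ) : Set (ℝ × ℝ) :=
  ⋃ d : G.Dart, segment ℝ (toPlane (pos d.fst)) (toPlane (pos d.snd))

/-- The centre of the unit square immediately to the left of a dart. In a unit-length grid drawing
no edge enters the interior of this square. -/
noncomputable def leftCentre {G : SimpleGraph (Fin n)} (pos : Fin n → ℤ × ℤ) (d : G.Dart) : ℝ × ℝ :=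
  (1 / 2 : ℝ) • (toPlane (pos d.fst) + toPlane (pos d.snd) +
    toPlane (quarterTurn (dartVec pos d)))

/-- The face of the drawing (connected component of the complement of the drawing) to the left of
a dart. -/
noncomputable def leftFace {G : SimpleGraph (Fin n)} (pos : Fin n → ℤ × ℤ) (d : G.Dart) :
    Set (ℝ × ℝ) :=
  connectedComponentIn (drawnSet G pos)ᶜ (leftCentre pos d)

/-- The drawing is embedding-preserving: the counterclockwise orders of the edges at the vertices
are the prescribed ones, and the darts that have the unbounded face of the drawing to their left are
those that have the chosen outer face to their left. -/
def PreservesEmbedding (G : PlaneGraph n) (pos : Fin n → ℤ × ℤ) : Prop :=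
  PreservesRotation G pos ∧
    ∀ d : G.graph.Dart, ¬ Bornology.IsBounded (leftFace pos d) ↔ G.OnOuter d

/-- The plane graph has an embedding-preserving unit-length grid drawing that extends the prescribed
drawing of the boundary of the outer face. -/
def HasDrawing (G : PlaneGraph n) (Γ : OuterDrawing G) : Prop :=
  ∃ pos : Fin n → ℤ × ℤ, IsUnitGridDrawing G.graph pos ∧ PreservesEmbedding G pos ∧
    ∀ v : G.outerVertices, pos v = Γ.pos v

/-! ### Encoding of the input -/

open Classical in
/-- The prescribed position of a vertex, `(0, 0)` for vertices not incident to the outer face. -/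
noncomputable def OuterDrawing.posD {G : PlaneGraph n} (Γ : OuterDrawing G) (v : Fin n) : ℤ × ℤ :=
  if h : v ∈ G.outerVertices then Γ.pos ⟨v, h⟩ else (0, 0)

/-- The input words, for a numbering `num` of the `k` darts (two for each edge): first `n`, `k` and a
dart with the outer face to its left; then, for all the darts, their tails; for all the darts, their
reverses; for all the darts, their counterclockwise successors around the tail; last, for all the
vertices, the prescribed `x`-coordinates and then the prescribed `y`-coordinates. -/
noncomputable def encode (G : PlaneGraph n) (Γ : OuterDrawing G) {k : ℕ}
    (num : G.graph.Dart ≃ Fin k) : List ℤ :=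
  [(n : ℤ), (k : ℤ), ((num G.outer : ℕ) : ℤ)] ++
  List.ofFn (fun i : Fin k => (((num.symm i).fst : ℕ) : ℤ)) ++
  List.ofFn (fun i : Fin k => ((num (num.symm i).symm : ℕ) : ℤ)) ++
  List.ofFn (fun i : Fin k => ((num (G.rot (num.symm i)) : ℕ) : ℤ)) ++
  List.ofFn (fun v : Fin n => (Γ.posD v).1) ++
  List.ofFn (fun v : Fin n => (Γ.posD v).2)

end PlaneGraphs

end UnitGrid

/-! Geometry. A closed grid walk has even length, and if it has length at most six and never turns
back it goes once around a 1×1 or 1×2 rectangle, always turning to the same side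
(`ClosedWalk.left_or_right`). In a biconnected plane graph a face walk turns back only if the graph
is a single edge, which has no internal face. So in a drawing every internal face of degree at most
six is walked around such a rectangle, and to the left: if all turns went to the right, every vertex
would lie on the walk and the region to its left would be unbounded (`turnsLeft_of_internal`). Hence
internal faces have degree four or six, and two darts half a boundary apart have opposite vectors.
Reversing the opposite dart therefore transports the vector of a dart across the face unchanged.

Uniqueness. The vectors of the darts on the outer face and of their reverses are prescribed. Every
other vector follows by transport: among the unreached darts with a given vector take the one
farthest to the right; its reverse bounds an internal face, and the transported dart on the other
side of this face is unreached and still farther to the right, which is absurd (`mem_of_transport`).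
The vectors determine the positions up to translation. So there is at most one candidate drawing,
found by two graph searches, and it remains to test it.

Test. Accepted are candidates whose vectors are unit vectors, agree with the prescription on the
outer face and with the computed positions, realize the rotation, make only straight and left turns
on internal faces, and give distinct vertices distinct positions. A drawing passes
(`accepts_of_drawing`). Conversely (`hasDrawing_of_accepts`), internal faces without right turns
bound rectangles and are bounded regions, while some dart has the whole drawing on its right and
thus an unbounded left face. That dart must lie on the chosen outer face, which is therefore the
unbounded one.

Machine. A grid vector (x, y) is stored as the single word (4n+1)x + y, which is additive and
injective on the small vectors that occur. Instances with more than 4n darts are rejected at once,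
since a grid point has only four neighbours; otherwise all loops have at most 4n rounds. Equal
positions are detected with a table indexed by these words, which needs no initialization because
memory starts at zero. The program is written in a small language with variables and arrays, whose
compilation is proved correct once (`Cmd.wp_sound`); loops are never nested, so the time is linear.
-/

namespace UnitGrid

/-! ### A small language with variables and arrays -/

/-- The contents of the variables and of the arrays. -/
structure HState where
  var : ℕ → ℤ
  arr : ℕ → ℤ → ℤ

/-- Overwrite one variable. -/
def HState.setVar (σ : HState) (x : ℕ) (z : ℤ) : HState :=
  { σ with var := Function.update σ.var x z }

/-- Overwrite one array entry. -/
def HState.setArr (σ : HState) (a : ℕ) (j z : ℤ) : HState :=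
  { σ with arr := Function.update σ.arr a (Function.update (σ.arr a) j z) }

/-- Expressions: `rd a e` reads the entry `e` of the array `a`, `inp e` the input word `e`. -/
inductive Expr where
  | var (x : ℕ)
  | lit (z : ℤ)
  | add (e f : Expr)
  | sub (e f : Expr)
  | rd (a : ℕ) (e : Expr)
  | inp (e : Expr)

namespace Expr

/-- The value of an expression. -/
def eval (I : ℤ → ℤ) (σ : HState) : Expr → ℤ
  | var x => σ.var x
  | lit z => z
  | add e f => e.eval I σ + f.eval I σ
  | sub e f => e.eval I σ - f.eval I σ
  | rd a e => σ.arr a (e.eval I σ)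
  | inp e => I (e.eval I σ)

/-- All the indices in an expression are nonnegative. -/
def Ok (I : ℤ → ℤ) (σ : HState) : Expr → Prop
  | var _ => True
  | lit _ => True
  | add e f => e.Ok I σ ∧ f.Ok I σ
  | sub e f => e.Ok I σ ∧ f.Ok I σ
  | rd _ e => e.Ok I σ ∧ 0 ≤ e.eval I σ
  | inp e => e.Ok I σ ∧ 0 ≤ e.eval I σ

/-- Variables are below `64`, arrays below `32`. -/
def WF : Expr → Bool
  | var x => x < 64
  | lit _ => true
  | add e f => e.WF && f.WF
  | sub e f => e.WF && f.WF
  | rd a e => decide (a < 32) && e.WF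
  | inp e => e.WF

/-- The growth factor of the evaluation of an expression. -/
def growth : Expr → ℕ
  | var _ => 1
  | lit z => z.natAbs
  | add e f => e.growth + f.growth
  | sub e f => e.growth + f.growth
  | rd _ e => 32 * e.growth + 33
  | inp e => e.growth + 1

/-- The number of instructions used for the evaluation of an expression. -/
def cost : Expr → ℕ
  | var _ => 2
  | lit _ => 1
  | add e f => e.cost + (f.cost + 1)
  | sub e f => e.cost + (f.cost + 1)
  | rd _ e => e.cost + (5 + 1 + 1 + 1)
  | inp e => e.cost + 1

end Expr

/-! ### Compilation of expressions: input in nonnegative cells, arrays interleaved in negative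
cells. -/

/-- The memory cell of an array entry. -/
def addr (a : ℕ) (j : ℤ) : ℤ := -((a : ℤ) + 1) - 32 * j

/-- Replace the index in register `d` by the memory cell of the corresponding entry of the
array `a`. -/
def addrCode (a d : ℕ) : Prog :=
  .seq (.add d d d) (.seq (.add d d d) (.seq (.add d d d) (.seq (.add d d d) (.seq (.add d d d)
    (.seq (.const (d + 1) (-((a : ℤ) + 1))) (.sub d (d + 1) d))))))

/-- Evaluate an expression into register `d`, using the registers from `d` on. -/
def Expr.code : Expr → ℕ → Prog
  | .var x, d => .seq (.const d 0) (.add d d x)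
  | .lit z, d => .const d z
  | .add e f, d => .seq (e.code d) (.seq (f.code (d + 1)) (.add d d (d + 1)))
  | .sub e f, d => .seq (e.code d) (.seq (f.code (d + 1)) (.sub d d (d + 1)))
  | .rd a e, d => .seq (e.code d) (.seq (addrCode a d) (.load d d))
  | .inp e, d => .seq (e.code d) (.load d d)

/-- The machine state `s` represents the state `σ` with input `I`. -/
structure Rep (I : ℤ → ℤ) (σ : HState) (s : State) : Prop where
  var : ∀ x < 64, s.reg x = σ.var x
  inp : ∀ j, 0 ≤ j → s.mem j = I j
  arr : ∀ a < 32, ∀ j, 0 ≤ j → s.mem (addr a j) = σ.arr a j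

/-- All the words are bounded by `N`. -/
structure Bdd (N : ℕ) (σ : HState) : Prop where
  var : ∀ x, |σ.var x| ≤ N
  arr : ∀ a j, |σ.arr a j| ≤ N

/-- Input words and array entries are bounded by `N` whatever the index is. The factors that
`growth` gives to `rd` and `inp` leave room for the index, and for `rd` also for the address
computed from it. -/
theorem Expr.abs_eval_le {I : ℤ → ℤ} {N : ℕ} (hI : ∀ j, |I j| ≤ N) {σ : HState} (hσ : Bdd N σ)
    (e : Expr) : |e.eval I σ| ≤ (e.growth * (N + 1) : ℕ) := by
  induction e with
  | var x => have := hσ.var x; simp only [eval, growth]; push_cast; linarith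
  | lit z =>
    simp only [eval, growth]; push_cast
    nlinarith [abs_nonneg z]
  | add e f he hf =>
    simp only [eval, growth]; push_cast at *
    have := abs_add_le (e.eval I σ) (f.eval I σ); nlinarith
  | sub e f he hf =>
    simp only [eval, growth]; push_cast at *
    have := abs_sub (e.eval I σ) (f.eval I σ); nlinarith
  | rd a e he =>
    simp only [eval, growth]; have := hσ.arr a (e.eval I σ)
    have h1 : (N : ℤ) ≤ (((32 * e.growth + 33) * (N + 1) : ℕ) : ℤ) := by
      norm_cast; nlinarith [Nat.zero_le (e.growth * (N + 1))]
    linarith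
  | inp e he =>
    simp only [eval, growth]; have := hI (e.eval I σ)
    have h1 : (N : ℤ) ≤ (((e.growth + 1) * (N + 1) : ℕ) : ℤ) := by
      norm_cast; nlinarith [Nat.zero_le (e.growth * (N + 1))]
    linarith

/-- Five doublings give 32 times the index, since the machine cannot multiply. The hypothesis bounds
the final address, and all intermediate words are no larger. Register `d + 1` serves as scratch, so
registers below `d` survive. -/
theorem addrCode_runs {B a d : ℕ} (s : State) (h : 32 * |s.reg d| + a + 1 ≤ B) :
    ∃ s', Runs B (addrCode a d) s 7 s' ∧ s'.reg d = addr a (s.reg d) ∧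
      (∀ r < d, s'.reg r = s.reg r) ∧ s'.mem = s.mem := by
  have h0 : 0 ≤ |s.reg d| := abs_nonneg _
  have key : ∀ (s : State) (m : ℤ), |m * 2| ≤ B → s.reg d = m →
      Runs B (.add d d d) s 1 (s.setReg d (m * 2)) := by
    intro s m hm hs
    have := Runs.add (B := B) s d d d (by rw [hs, ← mul_two]; exact hm)
    rwa [hs, ← mul_two] at this
  set z := s.reg d with hz
  have hb : ∀ c : ℤ, 0 ≤ c → c ≤ 32 → |z * c| ≤ B := by
    intro c hc hc'
    rw [abs_mul, abs_of_nonneg hc]; nlinarith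
  refine ⟨_, Runs.seq (t := 1) (t' := 6) (key s z (hb 2 (by norm_num) (by norm_num)) rfl)
    (Runs.seq (t := 1) (t' := 5) (key _ (z * 2) (by
        rw [mul_assoc]; exact hb _ (by norm_num) (by norm_num)) (by simp [State.setReg]))
    (Runs.seq (t := 1) (t' := 4) (key _ (z * 2 * 2) (by
        rw [mul_assoc, mul_assoc]; exact hb _ (by norm_num) (by norm_num)) (by simp [State.setReg]))
    (Runs.seq (t := 1) (t' := 3) (key _ (z * 2 * 2 * 2) (by
        rw [mul_assoc, mul_assoc, mul_assoc]; exact hb _ (by norm_num) (by norm_num))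
        (by simp [State.setReg]))
    (Runs.seq (t := 1) (t' := 2) (key _ (z * 2 * 2 * 2 * 2) (by
        rw [mul_assoc, mul_assoc, mul_assoc, mul_assoc]; exact hb _ (by norm_num) (by norm_num))
        (by simp [State.setReg]))
    (Runs.seq (t := 1) (t' := 1) (Runs.const _ (d + 1) _ ?_) (Runs.sub _ d (d + 1) d ?_)))))),
    ?_, ?_, ?_⟩
  · rw [abs_neg, abs_of_nonneg (by positivity)]; linarith
  · simp only [State.setReg, Function.update_self]
    rw [Function.update_of_ne (by omega), Function.update_self]
    have := neg_abs_le z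
    have := le_abs_self z
    rw [abs_le]; constructor <;> linarith
  · simp only [State.setReg, Function.update_self]
    rw [Function.update_of_ne (by omega), Function.update_self, addr]
    ring
  · intro r hr
    simp only [State.setReg]
    rw [Function.update_of_ne (by omega), Function.update_of_ne (by omega),
      Function.update_of_ne (by omega), Function.update_of_ne (by omega),
      Function.update_of_ne (by omega), Function.update_of_ne (by omega),
      Function.update_of_ne (by omega)]
  · rfl

theorem Rep.congr {I : ℤ → ℤ} {σ : HState} {s s' : State} (h : Rep I σ s)
    (hr : ∀ r < 64, s'.reg r = s.reg r) (hm : s'.mem = s.mem) : Rep I σ s' :=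
  ⟨fun x hx => (hr x hx).trans (h.var x hx), fun j hj => by rw [hm]; exact h.inp j hj,
    fun a ha j hj => by rw [hm]; exact h.arr a ha j hj⟩

/-- The registers from `d` on are an evaluation stack: the second operand is evaluated from `d + 1`
on and leaves the first one intact. As `64 ≤ d`, no variable is touched. -/
theorem Expr.code_runs {I : ℤ → ℤ} {N B : ℕ} (hI : ∀ j, |I j| ≤ N) {σ : HState} (hσ : Bdd N σ)
    (e : Expr) (hwf : e.WF = true) (hok : e.Ok I σ) (hB : e.growth * (N + 1) ≤ B)
    (d : ℕ) (hd : 64 ≤ d) (s : State) (hs : Rep I σ s) :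
    ∃ s', Runs B (e.code d) s e.cost s' ∧ s'.reg d = e.eval I σ ∧
      (∀ r < d, s'.reg r = s.reg r) ∧ s'.mem = s.mem := by
  have hBe : ∀ z : ℤ, |z| ≤ (e.growth * (N + 1) : ℕ) → |z| ≤ B :=
    fun z hz => hz.trans (by exact_mod_cast hB)
  have hev := hBe _ (e.abs_eval_le hI hσ)
  induction e generalizing d s with
  | var x =>
    simp only [WF, decide_eq_true_eq] at hwf
    refine ⟨_, Runs.seq (Runs.const _ _ _ (by simp)) (Runs.add _ _ _ _ ?_), ?_, ?_, rfl⟩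
    · simp only [State.setReg, Function.update_self]
      rw [Function.update_of_ne (by omega), hs.var x hwf, zero_add]; exact hev
    · simp only [State.setReg, Function.update_self]
      rw [Function.update_of_ne (by omega), hs.var x hwf, zero_add]; rfl
    · intro r hr
      simp only [State.setReg]
      rw [Function.update_of_ne (by omega), Function.update_of_ne (by omega)]
  | lit z =>
    refine ⟨_, Runs.const _ _ _ hev, ?_, ?_, rfl⟩
    · simp [State.setReg, eval]
    · intro r hr
      simp only [State.setReg]
      rw [Function.update_of_ne (by omega)]
  | add e f he hf =>
    simp only [WF, Bool.and_eq_true] at hwf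
    simp only [growth, add_mul] at hB
    have hBe1 : ∀ z : ℤ, |z| ≤ (e.growth * (N + 1) : ℕ) → |z| ≤ B :=
      fun z hz => hz.trans (by exact_mod_cast (by omega))
    have hBf1 : ∀ z : ℤ, |z| ≤ (f.growth * (N + 1) : ℕ) → |z| ≤ B :=
      fun z hz => hz.trans (by exact_mod_cast (by omega))
    obtain ⟨s1, r1, v1, k1, m1⟩ := he hwf.1 hok.1 (by omega) d hd s hs hBe1
      (hBe1 _ (e.abs_eval_le hI hσ))
    obtain ⟨s2, r2, v2, k2, m2⟩ := hf hwf.2 hok.2 (by omega) (d + 1) (by omega) s1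
      (hs.congr (fun r hr => k1 r (by omega)) m1) hBf1 (hBf1 _ (f.abs_eval_le hI hσ))
    refine ⟨_, Runs.seq r1 (Runs.seq r2 (Runs.add _ _ _ _ ?_)), ?_, ?_, ?_⟩
    · rw [v2, k2 d (by omega), v1]; exact hev
    · simp only [State.setReg, Function.update_self]
      rw [v2, k2 d (by omega), v1]; rfl
    · intro r hr
      simp only [State.setReg]
      rw [Function.update_of_ne (by omega), k2 r (by omega), k1 r hr]
    · simp only [State.setReg]; rw [m2, m1]
  | sub e f he hf =>
    simp only [WF, Bool.and_eq_true] at hwf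
    simp only [growth, add_mul] at hB
    have hBe1 : ∀ z : ℤ, |z| ≤ (e.growth * (N + 1) : ℕ) → |z| ≤ B :=
      fun z hz => hz.trans (by exact_mod_cast (by omega))
    have hBf1 : ∀ z : ℤ, |z| ≤ (f.growth * (N + 1) : ℕ) → |z| ≤ B :=
      fun z hz => hz.trans (by exact_mod_cast (by omega))
    obtain ⟨s1, r1, v1, k1, m1⟩ := he hwf.1 hok.1 (by omega) d hd s hs hBe1
      (hBe1 _ (e.abs_eval_le hI hσ))
    obtain ⟨s2, r2, v2, k2, m2⟩ := hf hwf.2 hok.2 (by omega) (d + 1) (by omega) s1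
      (hs.congr (fun r hr => k1 r (by omega)) m1) hBf1 (hBf1 _ (f.abs_eval_le hI hσ))
    refine ⟨_, Runs.seq r1 (Runs.seq r2 (Runs.sub _ _ _ _ ?_)), ?_, ?_, ?_⟩
    · rw [v2, k2 d (by omega), v1]; exact hev
    · simp only [State.setReg, Function.update_self]
      rw [v2, k2 d (by omega), v1]; rfl
    · intro r hr
      simp only [State.setReg]
      rw [Function.update_of_ne (by omega), k2 r (by omega), k1 r hr]
    · simp only [State.setReg]; rw [m2, m1]
  | rd a e he =>
    simp only [WF, Bool.and_eq_true, decide_eq_true_eq] at hwf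
    simp only [growth, add_mul, mul_assoc] at hB
    have hBe1 : ∀ z : ℤ, |z| ≤ (e.growth * (N + 1) : ℕ) → |z| ≤ B :=
      fun z hz => hz.trans (by exact_mod_cast (by omega))
    obtain ⟨s1, r1, v1, k1, m1⟩ := he hwf.2 hok.1 (by omega) d hd s hs hBe1
      (hBe1 _ (e.abs_eval_le hI hσ))
    obtain ⟨s2, r2, v2, k2, m2⟩ := addrCode_runs (B := B) (a := a) (d := d) s1 (by
      rw [v1]
      have := e.abs_eval_le hI hσ
      have h3 := hwf.1
      generalize e.growth * (N + 1) = X at *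
      zify at hB h3
      linarith)
    have hv : s2.mem (s2.reg d) = (Expr.rd a e).eval I σ := by
      rw [m2, m1, v2, v1, hs.arr a hwf.1 _ hok.2]; rfl
    refine ⟨_, Runs.seq r1 (Runs.seq r2 (Runs.load _ _ _ ?_)), ?_, ?_, ?_⟩
    · rw [hv]; exact hev
    · simp only [State.setReg, Function.update_self]
      exact hv
    · intro r hr
      simp only [State.setReg]
      rw [Function.update_of_ne (by omega), k2 r (by omega), k1 r hr]
    · simp only [State.setReg]; rw [m2, m1]
  | inp e he =>
    simp only [WF] at hwf
    simp only [growth, add_mul] at hB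
    have hBe1 : ∀ z : ℤ, |z| ≤ (e.growth * (N + 1) : ℕ) → |z| ≤ B :=
      fun z hz => hz.trans (by exact_mod_cast (by omega))
    obtain ⟨s1, r1, v1, k1, m1⟩ := he hwf hok.1 (by omega) d hd s hs hBe1
      (hBe1 _ (e.abs_eval_le hI hσ))
    have hv : s1.mem (s1.reg d) = (Expr.inp e).eval I σ := by
      rw [m1, v1, hs.inp _ hok.2]; rfl
    refine ⟨_, Runs.seq r1 (Runs.load _ _ _ ?_), ?_, ?_, ?_⟩
    · rw [hv]; exact hev
    · simp only [State.setReg, Function.update_self]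
      exact hv
    · intro r hr
      simp only [State.setReg]
      rw [Function.update_of_ne (by omega), k1 r hr]
    · exact m1

/-! ### Commands, their compilation, and weakest preconditions. -/

/-- Tests comparing two expressions. -/
inductive Cond where
  | lt (e f : Expr)
  | eq (e f : Expr)

namespace Cond

/-- The left-hand side. -/
def lhs : Cond → Expr
  | lt e _ => e
  | eq e _ => e

/-- The right-hand side. -/
def rhs : Cond → Expr
  | lt _ f => f
  | eq _ f => f

/-- The outcome of a test. -/
def Holds (I : ℤ → ℤ) (σ : HState) : Cond → Prop
  | lt e f => e.eval I σ < f.eval I σ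
  | eq e f => e.eval I σ = f.eval I σ

/-- The test on the registers `64` and `65`. -/
def test : Cond → Test
  | lt _ _ => .lt 64 65
  | eq _ _ => .eq 64 65

end Cond

/-- Commands. `loop i b p` executes `p` for the values `0, 1, …` of the variable `i` that are
smaller than the variable `b`. -/
inductive Cmd where
  | skip
  | set (x : ℕ) (e : Expr)
  | wr (a : ℕ) (i e : Expr)
  | seq (p q : Cmd)
  | ite (c : Cond) (p q : Cmd)
  | loop (i b : ℕ) (p : Cmd)

namespace Cmd

/-- Translation to the machine. -/
def code : Cmd → Prog
  | skip => .skip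
  | set x e => .seq (e.code 64) (.seq (.const x 0) (.add x x 64))
  | wr a i e => .seq (e.code 64) (.seq (i.code 65) (.seq (addrCode a 65) (.store 65 64)))
  | seq p q => .seq p.code q.code
  | ite c p q => .seq (c.lhs.code 64) (.seq (c.rhs.code 65) (.ite c.test p.code q.code))
  | loop i b p => .seq (.const i 0) (.while (.lt i b)
      (.seq p.code (.seq (.const 64 1) (.add i i 64))))

/-- Variables are below `64`, arrays below `32`. -/
def WF : Cmd → Bool
  | skip => true
  | set x e => decide (x < 64) && e.WF
  | wr a i e => decide (a < 32) && (i.WF && e.WF)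
  | seq p q => p.WF && q.WF
  | ite c p q => (c.lhs.WF && c.rhs.WF) && (p.WF && q.WF)
  | loop i b p => (decide (i < 64) && decide (b < 64)) && p.WF

/-- The growth factor of the words. -/
def growth : Cmd → ℕ
  | skip => 1
  | set _ e => e.growth + 1
  | wr _ i e => 32 * i.growth + 33 + e.growth
  | seq p q => p.growth + q.growth
  | ite c p q => c.lhs.growth + c.rhs.growth + (p.growth + q.growth)
  | loop _ _ p => p.growth + 1

/-- An upper bound for the number of steps if all loops have at most `κ` rounds. -/
def time (κ : ℕ) : Cmd → ℕ
  | skip => 1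
  | set _ e => e.cost + 2
  | wr _ i e => e.cost + (i.cost + 8)
  | seq p q => p.time κ + q.time κ
  | ite c p q => c.lhs.cost + (c.rhs.cost + (p.time κ + q.time κ + 1))
  | loop _ _ p => κ * (p.time κ + 3) + 2

/-- The variables that a command may change. -/
def modVar : Cmd → List ℕ
  | skip => []
  | set x _ => [x]
  | wr _ _ _ => []
  | seq p q => p.modVar ++ q.modVar
  | ite _ p q => p.modVar ++ q.modVar
  | loop i _ p => i :: p.modVar

/-- The arrays that a command may change. -/
def modArr : Cmd → List ℕ
  | skip => []
  | set _ _ => []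
  | wr a _ _ => [a]
  | seq p q => p.modArr ++ q.modArr
  | ite _ p q => p.modArr ++ q.modArr
  | loop _ _ p => p.modArr

/-- The two states agree on the variables and arrays that a command does not change. -/
structure Frame (p : Cmd) (σ σ' : HState) : Prop where
  var : ∀ x ∉ p.modVar, σ'.var x = σ.var x
  arr : ∀ a ∉ p.modArr, σ'.arr a = σ.arr a

/-- Weakest precondition: executed in a state with this property, the command ends, without
producing words larger than `N` except in intermediate results, and with at most `κ` rounds of
each loop, in a state satisfying `Q`. -/
def wp (I : ℤ → ℤ) (N κ : ℕ) : Cmd → (HState → Prop) → HState → Prop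
  | skip, Q, σ => Q σ
  | set x e, Q, σ => e.Ok I σ ∧ |e.eval I σ| ≤ N ∧ Q (σ.setVar x (e.eval I σ))
  | wr a i e, Q, σ => i.Ok I σ ∧ e.Ok I σ ∧ 0 ≤ i.eval I σ ∧ |e.eval I σ| ≤ N ∧
      Q (σ.setArr a (i.eval I σ) (e.eval I σ))
  | seq p q, Q, σ => p.wp I N κ (q.wp I N κ Q) σ
  | ite c p q, Q, σ => c.lhs.Ok I σ ∧ c.rhs.Ok I σ ∧ (c.Holds I σ → p.wp I N κ Q σ) ∧
      (¬ c.Holds I σ → q.wp I N κ Q σ)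
  | loop i b p, Q, σ => ∃ (K : ℕ) (Inv : ℕ → HState → Prop), i ≠ b ∧ σ.var b = K ∧ K ≤ κ ∧ K ≤ N ∧
      Inv 0 (σ.setVar i 0) ∧
      (∀ j < K, ∀ σ', Inv j σ' → σ'.var i = j → σ'.var b = K → p.wp I N κ (fun σ'' =>
        σ''.var i = j ∧ σ''.var b = K ∧ Inv (j + 1) (σ''.setVar i (j + 1 : ℕ))) σ') ∧
      (∀ σ', Inv K σ' → σ'.var i = K → Q σ')

theorem wp_mono {I : ℤ → ℤ} {N κ : ℕ} {p : Cmd} {Q Q' : HState → Prop} {σ : HState}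
    (h : p.wp I N κ Q σ) (hQ : ∀ σ', Q σ' → Q' σ') : p.wp I N κ Q' σ := by
  induction p generalizing Q Q' σ with
  | skip => exact hQ _ h
  | set x e => exact ⟨h.1, h.2.1, hQ _ h.2.2⟩
  | wr a i e => exact ⟨h.1, h.2.1, h.2.2.1, h.2.2.2.1, hQ _ h.2.2.2.2⟩
  | seq p q hp hq => exact hp h fun σ' h' => hq h' hQ
  | ite c p q hp hq => exact ⟨h.1, h.2.1, fun hc => hp (h.2.2.1 hc) hQ, fun hc => hq (h.2.2.2 hc) hQ⟩
  | loop i b p hp =>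
    obtain ⟨K, Inv, h1, h2, h3, h4, h5, h6, h7⟩ := h
    exact ⟨K, Inv, h1, h2, h3, h4, h5, h6, fun σ' h8 h9 => hQ _ (h7 σ' h8 h9)⟩

/-- What a command may change can be read off its syntax. With this, specifications mention only the
new contents; in the loop case the invariant is strengthened by the frame relative to the start of
the loop. -/
theorem wp_frame {I : ℤ → ℤ} {N κ : ℕ} {p : Cmd} {Q : HState → Prop} {σ : HState}
    (h : p.wp I N κ Q σ) : p.wp I N κ (fun σ' => p.Frame σ σ' ∧ Q σ') σ := by
  induction p generalizing Q σ with
  | skip => exact ⟨⟨fun _ _ => rfl, fun _ _ => rfl⟩, h⟩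
  | set x e =>
    refine ⟨h.1, h.2.1, ⟨fun y hy => ?_, fun _ _ => rfl⟩, h.2.2⟩
    simp only [modVar, List.mem_singleton] at hy
    simp [HState.setVar, hy]
  | wr a i e =>
    refine ⟨h.1, h.2.1, h.2.2.1, h.2.2.2.1, ⟨fun y hy => rfl, fun b hb => ?_⟩, h.2.2.2.2⟩
    simp only [modArr, List.mem_singleton] at hb
    simp [HState.setArr, hb]
  | seq p q hp hq =>
    refine wp_mono (p := p) (hp h) fun σ' h' =>
      wp_mono (p := q) (hq h'.2) fun σ'' h'' => ⟨⟨?_, ?_⟩, h''.2⟩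
    · intro x hx
      simp only [modVar, List.mem_append, not_or] at hx
      rw [h''.1.var x hx.2, h'.1.var x hx.1]
    · intro x hx
      simp only [modArr, List.mem_append, not_or] at hx
      rw [h''.1.arr x hx.2, h'.1.arr x hx.1]
  | ite c p q hp hq =>
    refine ⟨h.1, h.2.1, fun hc => wp_mono (hp (h.2.2.1 hc)) ?_,
      fun hc => wp_mono (hq (h.2.2.2 hc)) ?_⟩
    · refine fun σ' h' => ⟨⟨fun x hx => ?_, fun x hx => ?_⟩, h'.2⟩
      · simp only [modVar, List.mem_append, not_or] at hx
        exact h'.1.var x hx.1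
      · simp only [modArr, List.mem_append, not_or] at hx
        exact h'.1.arr x hx.1
    · refine fun σ' h' => ⟨⟨fun x hx => ?_, fun x hx => ?_⟩, h'.2⟩
      · simp only [modVar, List.mem_append, not_or] at hx
        exact h'.1.var x hx.2
      · simp only [modArr, List.mem_append, not_or] at hx
        exact h'.1.arr x hx.2
  | loop i b p hp =>
    obtain ⟨K, Inv, h1, h2, h3, h4, h5, h6, h7⟩ := h
    refine ⟨K, fun j σ' => (loop i b p).Frame σ σ' ∧ Inv j σ', h1, h2, h3, h4, ⟨⟨?_, ?_⟩, h5⟩, ?_, ?_⟩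
    · intro x hx
      simp only [modVar, List.mem_cons, not_or] at hx
      simp [HState.setVar, hx.1]
    · exact fun _ _ => rfl
    · intro j hj σ' hσ' hi hb
      refine wp_mono (hp (h6 j hj σ' hσ'.2 hi hb)) fun σ'' h'' =>
        ⟨h''.2.1, h''.2.2.1, ⟨⟨?_, ?_⟩, h''.2.2.2⟩⟩
      · intro x hx
        have hx' := hx
        simp only [modVar, List.mem_cons, not_or] at hx
        rw [← hσ'.1.var x hx', ← h''.1.var x hx.2]
        simp [HState.setVar, hx.1]
      · intro x hx
        rw [← hσ'.1.arr x hx, ← h''.1.arr x hx]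
        rfl
    · exact fun σ' h8 h9 => ⟨h8.1, h7 σ' h8.2 h9⟩

theorem wp_seq {I : ℤ → ℤ} {N κ : ℕ} {p q : Cmd} {R Q : HState → Prop} {σ : HState}
    (hp : p.wp I N κ R σ) (hq : ∀ σ', p.Frame σ σ' → R σ' → q.wp I N κ Q σ') :
    (seq p q).wp I N κ Q σ :=
  wp_mono (p := p) (wp_frame hp) fun σ' h => hq σ' h.1 h.2

/-- The body need not be shown to preserve counter and bound: this follows from the syntactic side
conditions, which are decidable for concrete programs. The frame relative to the start of the loop
is available in every round. -/
theorem wp_loop {I : ℤ → ℤ} {N κ : ℕ} {i b : ℕ} {p : Cmd} {Q : HState → Prop} {σ : HState}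
    {K : ℕ} (Inv : ℕ → HState → Prop) (hib : i ≠ b) (hi : i ∉ p.modVar) (hb : b ∉ p.modVar)
    (hK : σ.var b = K) (hκ : K ≤ κ) (hN : K ≤ N) (h0 : Inv 0 (σ.setVar i 0))
    (hs : ∀ j < K, ∀ σ', (loop i b p).Frame σ σ' → Inv j σ' → σ'.var i = j → σ'.var b = K →
      p.wp I N κ (fun σ'' => Inv (j + 1) (σ''.setVar i (j + 1 : ℕ))) σ')
    (hQ : ∀ σ', (loop i b p).Frame σ σ' → Inv K σ' → σ'.var i = K → Q σ') :
    (loop i b p).wp I N κ Q σ := by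
  refine ⟨K, fun j σ' => (loop i b p).Frame σ σ' ∧ Inv j σ', hib, hK, hκ, hN, ⟨⟨?_, ?_⟩, h0⟩,
    ?_, fun σ' h8 h9 => hQ σ' h8.1 h8.2 h9⟩
  · intro x hx
    simp only [modVar, List.mem_cons, not_or] at hx
    simp [HState.setVar, hx.1]
  · exact fun _ _ => rfl
  · intro j hj σ' hσ' h1 h2
    refine wp_mono (wp_frame (hs j hj σ' hσ'.1 hσ'.2 h1 h2)) fun σ'' h'' =>
      ⟨(h''.1.var i hi).trans h1, (h''.1.var b hb).trans h2, ⟨?_, ?_⟩, h''.2⟩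
    · intro x hx
      have hx' := hx
      simp only [modVar, List.mem_cons, not_or] at hx
      rw [← hσ'.1.var x hx', ← h''.1.var x hx.2]
      simp [HState.setVar, hx.1]
    · intro x hx
      rw [← hσ'.1.arr x hx, ← h''.1.arr x hx]
      rfl

/-! ### Soundness of the compilation. -/

theorem addr_inj {a b : ℕ} {i j : ℤ} (ha : a < 32) (hb : b < 32) (h : addr a i = addr b j) :
    a = b ∧ i = j := by
  unfold addr at h
  omega

theorem Bdd.setVar {N : ℕ} {σ : HState} (h : Bdd N σ) {x : ℕ} {z : ℤ} (hz : |z| ≤ N) :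
    Bdd N (σ.setVar x z) := by
  refine ⟨fun y => ?_, h.arr⟩
  simp only [HState.setVar, Function.update_apply]
  split_ifs
  · exact hz
  · exact h.var y

theorem Bdd.setArr {N : ℕ} {σ : HState} (h : Bdd N σ) {a : ℕ} {j z : ℤ} (hz : |z| ≤ N) :
    Bdd N (σ.setArr a j z) := by
  refine ⟨h.var, fun b i => ?_⟩
  simp only [HState.setArr, Function.update_apply]
  split_ifs
  · rw [Function.update_apply]
    split_ifs
    · exact hz
    · exact h.arr _ _
  · exact h.arr b i

theorem Rep.setVar {I : ℤ → ℤ} {σ : HState} {s s' : State} (h : Rep I σ s) {x : ℕ} {z : ℤ}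
    (hx : s'.reg x = z) (hr : ∀ r < 64, r ≠ x → s'.reg r = s.reg r) (hm : s'.mem = s.mem) :
    Rep I (σ.setVar x z) s' := by
  refine ⟨fun y hy => ?_, fun j hj => by rw [hm]; exact h.inp j hj,
    fun a ha j hj => by rw [hm]; exact h.arr a ha j hj⟩
  simp only [HState.setVar, Function.update_apply]
  split_ifs with hyx
  · rw [hyx, hx]
  · rw [hr y hy hyx, h.var y hy]

/-- Induction on the command, simulating each construct. Array writes do not disturb the input,
whose cells are nonnegative, or other arrays, whose cells differ modulo 32. -/
theorem wp_sound {I : ℤ → ℤ} {N κ B : ℕ} (hI : ∀ j, |I j| ≤ N) (p : Cmd) (hwf : p.WF = true)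
    (hB : p.growth * (N + 1) ≤ B) {Q : HState → Prop} {σ : HState} (hσ : Bdd N σ)
    (h : p.wp I N κ Q σ) (s : State) (hs : Rep I σ s) :
    ∃ t s' σ', Runs B p.code s t s' ∧ t ≤ p.time κ ∧ Bdd N σ' ∧ Rep I σ' s' ∧ Q σ' := by
  induction p generalizing Q σ s with
  | skip => exact ⟨1, s, σ, Runs.skip s, le_rfl, hσ, hs, h⟩
  | set x e =>
    simp only [WF, Bool.and_eq_true, decide_eq_true_eq] at hwf
    simp only [growth, add_mul] at hB
    obtain ⟨h1, h2, h3⟩ := h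
    obtain ⟨s1, r1, v1, k1, m1⟩ := e.code_runs hI hσ hwf.2 h1 (B := B) (by omega) 64 le_rfl s hs
    refine ⟨_, _, _, Runs.seq r1 (Runs.seq (Runs.const _ _ _ (by simp)) (Runs.add _ _ _ _ ?_)),
      le_rfl, Bdd.setVar hσ h2, Rep.setVar (s := s) hs ?_ ?_ m1, h3⟩
    · simp only [State.setReg, Function.update_self]
      rw [Function.update_of_ne (by omega), v1, zero_add]
      exact h2.trans (by exact_mod_cast (by omega))
    · simp only [State.setReg, Function.update_self]
      rw [Function.update_of_ne (by omega), v1, zero_add]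
    · intro r hr hrx
      simp only [State.setReg]
      rw [Function.update_of_ne hrx, Function.update_of_ne hrx, k1 r hr]
  | wr a i e =>
    simp only [WF, Bool.and_eq_true, decide_eq_true_eq] at hwf
    simp only [growth, add_mul, mul_assoc] at hB
    obtain ⟨h1, h2, h3, h4, h5⟩ := h
    obtain ⟨s1, r1, v1, k1, m1⟩ := e.code_runs hI hσ hwf.2.2 h2 (B := B) (by omega) 64 le_rfl s hs
    obtain ⟨s2, r2, v2, k2, m2⟩ := i.code_runs hI hσ hwf.2.1 h1 (B := B) (by omega) 65 (by omega) s1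
      (hs.congr (fun r hr => k1 r (by omega)) m1)
    obtain ⟨s3, r3, v3, k3, m3⟩ := addrCode_runs (B := B) (a := a) (d := 65) s2 (by
      rw [v2]
      have := i.abs_eval_le hI hσ
      have h3 := hwf.1
      generalize i.growth * (N + 1) = X at *
      generalize e.growth * (N + 1) = Y at *
      have : (32 * X + 33 * (N + 1) : ℤ) ≤ B := by exact_mod_cast (by omega)
      linarith)
    refine ⟨_, _, _, Runs.seq r1 (Runs.seq r2 (Runs.seq r3 (Runs.store _ _ _))),
      by simp only [time]; omega, Bdd.setArr hσ h4, ⟨?_, ?_, ?_⟩, h5⟩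
    · intro x hx
      simp only [State.setMem]
      rw [k3 x (by omega), k2 x (by omega), k1 x hx, hs.var x hx]; rfl
    · intro j hj
      simp only [State.setMem]
      rw [Function.update_of_ne, m3, m2, m1, hs.inp j hj]
      rw [v3, v2]; unfold addr; omega
    · intro b hb j hj
      simp only [State.setMem, HState.setArr]
      rw [v3, v2, k3 64 (by omega), k2 64 (by omega), v1, m3, m2, m1]
      simp only [Function.update_apply]
      split_ifs with c1 c2 c2
      · obtain ⟨rfl, rfl⟩ := addr_inj hb hwf.1 c1
        simp
      · exact absurd (addr_inj hb hwf.1 c1).1 c2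
      · subst c2
        rw [Function.update_of_ne (fun hh => c1 (by rw [hh])), hs.arr b hb j hj]
      · exact hs.arr b hb j hj
  | seq p q hp hq =>
    simp only [WF, Bool.and_eq_true] at hwf
    simp only [growth, add_mul] at hB
    obtain ⟨t1, s1, σ1, r1, c1, b1, e1, h1⟩ := hp hwf.1 (by omega) hσ h s hs
    obtain ⟨t2, s2, σ2, r2, c2, b2, e2, h2⟩ := hq hwf.2 (by omega) b1 h1 s1 e1
    exact ⟨_, s2, σ2, Runs.seq r1 r2, by simp only [time]; omega, b2, e2, h2⟩
  | ite c p q hp hq =>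
    simp only [WF, Bool.and_eq_true] at hwf
    simp only [growth, add_mul] at hB
    obtain ⟨h1, h2, h3, h4⟩ := h
    obtain ⟨s1, r1, v1, k1, m1⟩ := c.lhs.code_runs hI hσ hwf.1.1 h1 (B := B) (by omega) 64 le_rfl s hs
    have hs1 := hs.congr (fun r hr => k1 r (by omega)) m1
    obtain ⟨s2, r2, v2, k2, m2⟩ := c.rhs.code_runs hI hσ hwf.1.2 h2 (B := B) (by omega) 65 (by omega)
      s1 hs1
    have hs2 := hs1.congr (fun r hr => k2 r (by omega)) m2
    have hc : c.test.Holds s2 ↔ c.Holds I σ := by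
      rw [← k2 64 (by omega)] at v1
      cases c with
      | lt e f => simp only [Cond.test, Test.Holds, Cond.Holds]; rw [v1, v2]; rfl
      | eq e f => simp only [Cond.test, Test.Holds, Cond.Holds]; rw [v1, v2]; rfl
    by_cases hh : c.Holds I σ
    · obtain ⟨t1, s3, σ1, r3, c1, b1, e1, h1⟩ := hp hwf.2.1 (by omega) hσ (h3 hh) s2 hs2
      exact ⟨_, s3, σ1, Runs.seq r1 (Runs.seq r2 (Runs.ite_true (hc.2 hh) r3)),
        by simp only [time]; omega, b1, e1, h1⟩
    · obtain ⟨t1, s3, σ1, r3, c1, b1, e1, h1⟩ := hq hwf.2.2 (by omega) hσ (h4 hh) s2 hs2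
      exact ⟨_, s3, σ1, Runs.seq r1 (Runs.seq r2 (Runs.ite_false (fun h' => hh (hc.1 h')) r3)),
        by simp only [time]; omega, b1, e1, h1⟩
  | loop i b p hp =>
    simp only [WF, Bool.and_eq_true, decide_eq_true_eq] at hwf
    simp only [growth, add_mul] at hB
    obtain ⟨K, Inv, h1, h2, h3, h4, h5, h6, h7⟩ := h
    have hB1 : N + 1 ≤ B := by omega
    -- Induction on the number `m` of rounds left. A round costs the body plus three steps, one for
    -- the test and two for incrementing the counter; the last, failing test costs one.
    have key : ∀ m j, m + j = K → ∀ σ s, Inv j σ → σ.var i = j → σ.var b = K → Bdd N σ → Rep I σ s →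
        ∃ t s' σ', Runs B (.while (.lt i b) (.seq p.code (.seq (.const 64 1) (.add i i 64)))) s t s' ∧
          t ≤ m * (p.time κ + 3) + 1 ∧ Bdd N σ' ∧ Rep I σ' s' ∧ Q σ' := by
      intro m
      induction m with
      | zero =>
        intro j hj σ s hI' hi hb hbd hr
        have : j = K := by omega
        subst this
        refine ⟨1, s, σ, Runs.while_false ?_, by omega, hbd, hr, h7 σ hI' hi⟩
        simp only [Test.Holds]
        rw [hr.var i hwf.1.1, hr.var b hwf.1.2, hi, hb]; omega
      | succ m ih =>
        intro j hj σ s hI' hi hb hbd hr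
        obtain ⟨t1, s1, σ1, r1, c1, b1, e1, g1, g2, g3⟩ :=
          hp hwf.2 (by omega) hbd (h6 j (by omega) σ hI' hi hb) s hr
        have hreg : s1.reg i = j := by rw [e1.var i hwf.1.1, g1]
        have hz : |((j + 1 : ℕ) : ℤ)| ≤ N := by
          rw [Nat.abs_cast]; exact_mod_cast (by omega)
        have r2 : Runs B (.seq (.const 64 1) (.add i i 64)) s1 (1 + 1)
            ((s1.setReg 64 1).setReg i ((j + 1 : ℕ) : ℤ)) := by
          have h64 : (s1.setReg 64 1).reg i = j := by
            simp only [State.setReg]; rw [Function.update_of_ne (by omega), hreg]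
          have h65 : (s1.setReg 64 1).reg 64 = 1 := by simp [State.setReg]
          have := Runs.add (B := B) (s1.setReg 64 1) i i 64 (by
            rw [h64, h65]
            have h2 : (N : ℤ) ≤ B := by exact_mod_cast (by omega)
            exact le_trans (by exact_mod_cast hz) h2)
          rw [h64, h65] at this
          refine Runs.seq (Runs.const _ _ _ (by simp; omega)) ?_
          push_cast; exact this
        obtain ⟨t3, s3, σ3, r3, c3, b3, e3, q3⟩ := ih (j + 1) (by omega)
          (σ1.setVar i ((j + 1 : ℕ) : ℤ)) ((s1.setReg 64 1).setReg i ((j + 1 : ℕ) : ℤ)) g3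
          (by simp [HState.setVar])
          (by simp only [HState.setVar]; rw [Function.update_of_ne (Ne.symm h1), g2])
          (Bdd.setVar b1 hz)
          (Rep.setVar e1 (by simp [State.setReg])
            (fun r hr hri => by
              simp only [State.setReg]
              rw [Function.update_of_ne hri, Function.update_of_ne (by omega)]) rfl)
        refine ⟨_, s3, σ3, Runs.while_true ?_ (Runs.seq r1 r2) r3, ?_, b3, e3, q3⟩
        · simp only [Test.Holds]
          rw [hr.var i hwf.1.1, hr.var b hwf.1.2, hi, hb]; exact_mod_cast (by omega)
        · rw [Nat.succ_mul]; omega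
    obtain ⟨t, s', σ', r, c, b', e, q⟩ := key K 0 rfl (σ.setVar i 0) (s.setReg i 0) h5
      (by simp [HState.setVar])
      (by simp only [HState.setVar]; rw [Function.update_of_ne (Ne.symm h1), h2])
      (Bdd.setVar hσ (by simp))
      (Rep.setVar hs (by simp [State.setReg])
        (fun r hr hri => by simp only [State.setReg]; rw [Function.update_of_ne hri]) rfl)
    refine ⟨_, s', σ', Runs.seq (Runs.const _ _ _ (by simp)) r, ?_, b', e, q⟩
    have := Nat.mul_le_mul_right (p.time κ + 3) h3
    simp only [time]; omega

/-! ### Linear running time of programs without nested loops. -/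

/-- There are no loops. -/
def loopFree : Cmd → Bool
  | seq p q => p.loopFree && q.loopFree
  | ite _ p q => p.loopFree && q.loopFree
  | loop _ _ _ => false
  | _ => true

/-- There are no nested loops. -/
def flat : Cmd → Bool
  | seq p q => p.flat && q.flat
  | ite _ p q => p.flat && q.flat
  | loop _ _ p => p.loopFree
  | _ => true

theorem time_of_loopFree {p : Cmd} (h : p.loopFree = true) (κ κ' : ℕ) : p.time κ = p.time κ' := by
  induction p with
  | skip => rfl
  | set x e => rfl
  | wr a i e => rfl
  | seq p q hp hq =>
    simp only [loopFree, Bool.and_eq_true] at h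
    simp only [time, hp h.1, hq h.2]
  | ite c p q hp hq =>
    simp only [loopFree, Bool.and_eq_true] at h
    simp only [time, hp h.1, hq h.2]
  | loop i b p hp => simp [loopFree] at h

/-- A loop body without loops has a time bound independent of `κ`, so the bound for the whole
command is affine in `κ`. -/
theorem time_le {p : Cmd} (h : p.flat = true) (κ : ℕ) : p.time κ ≤ p.time 1 * (κ + 1) := by
  induction p with
  | skip => simp [time]
  | set x e => simp only [time]; exact Nat.le_mul_of_pos_right _ (by omega)
  | wr a i e => simp only [time]; exact Nat.le_mul_of_pos_right _ (by omega)
  | seq p q hp hq =>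
    simp only [flat, Bool.and_eq_true] at h
    have := hp h.1
    have := hq h.2
    simp only [time]; rw [add_mul]; omega
  | ite c p q hp hq =>
    simp only [flat, Bool.and_eq_true] at h
    have h1 := hp h.1
    have h2 := hq h.2
    simp only [time]
    simp only [add_mul]
    nlinarith [Nat.zero_le (c.lhs.cost * κ), Nat.zero_le (c.rhs.cost * κ)]
  | loop i b p hp =>
    simp only [flat] at h
    simp only [time]
    rw [time_of_loopFree h κ 1]
    nlinarith [Nat.zero_le ((p.time 1) * κ)]

end Cmd

/-! ### The program -/

/-- The data of an instance, with the darts numbered by `num`. -/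
structure Table (D : Type) (n k : ℕ) where
  num : D ≃ Fin k
  rev : D → D
  rot : Equiv.Perm D
  tail : D → Fin n
  out : D
  px : Fin n → ℤ
  py : Fin n → ℤ

namespace Table

variable {D : Type} {n k : ℕ} (T : Table D n k)

/-- The number of a dart as a word. -/
def ix (d : D) : ℤ := ((T.num d : ℕ) : ℤ)

@[simp] theorem ix_inj {d e : D} : T.ix d = T.ix e ↔ d = e := by
  simp [ix, Fin.val_inj]

@[simp] theorem ix_nonneg (d : D) : 0 ≤ T.ix d := by simp [ix]

theorem ix_lt (d : D) : T.ix d < k := by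
  have := (T.num d).isLt
  simp only [ix]; exact_mod_cast this

/-- The input words describe the instance. -/
structure Reads (I : ℤ → ℤ) : Prop where
  zero : I 0 = n
  one : I 1 = k
  two : I 2 = T.ix T.out
  tail : ∀ d, I (3 + T.ix d) = T.tail d
  rev : ∀ d, I (3 + k + T.ix d) = T.ix (T.rev d)
  rot : ∀ d, I (3 + k + k + T.ix d) = T.ix (T.rot d)
  px : ∀ v : Fin n, I (3 + k + k + k + v) = T.px v
  py : ∀ v : Fin n, I (3 + k + k + k + n + v) = T.py v

/-- The next dart on the boundary of the face to the left. -/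
def next (d : D) : D := T.rot.symm (T.rev d)

/-- The dart has the outer face to its left. -/
def Outer (d : D) : Prop := ∃ i < k, T.next^[i] T.out = d

open Classical in
/-- For a dart on the boundary of an internal face of degree four or six, the reverse of the
opposite dart. -/
noncomputable def transport (d : D) : D :=
  if T.Outer d then d
  else if T.next (T.next (T.next (T.next d))) = d then T.rev (T.next (T.next d))
  else T.rev (T.next (T.next (T.next d)))

/-- The word that represents the horizontal unit vector. -/
def base (_ : Table D n k) : ℤ := n + n + n + n + 1

/-- The word that represents the prescribed vector of a dart. -/
def given (d : D) : ℤ :=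
  if T.px (T.tail (T.rev d)) - T.px (T.tail d) = 1 then T.base
  else if T.px (T.tail (T.rev d)) - T.px (T.tail d) = -1 then -T.base
  else T.py (T.tail (T.rev d)) - T.py (T.tail d)

end Table

/-! ### Program text. Variables: `0` answer, `1` n, `2` k, `4` loop counter, `6` base, `7` radius,
`8` and `11` queue lengths. -/

namespace Prg

open UnitGrid.Expr UnitGrid.Cmd

/-- The tail of a dart. -/
def tailE (e : Expr) : Expr := .inp (.add (.lit 3) e)
/-- The reverse of a dart. -/
def revE (e : Expr) : Expr := .inp (.add (.add (.lit 3) (.var 2)) e)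
/-- The counterclockwise successor of a dart. -/
def rotE (e : Expr) : Expr := .inp (.add (.add (.add (.lit 3) (.var 2)) (.var 2)) e)
/-- The prescribed abscissa of a vertex. -/
def pxE (e : Expr) : Expr :=
  .inp (.add (.add (.add (.add (.lit 3) (.var 2)) (.var 2)) (.var 2)) e)
/-- The prescribed ordinate of a vertex. -/
def pyE (e : Expr) : Expr :=
  .inp (.add (.add (.add (.add (.add (.lit 3) (.var 2)) (.var 2)) (.var 2)) (.var 1)) e)

/-- Array `0`: the clockwise successors. -/
def rotSymmLoop : Cmd := .loop 4 2 (.wr 0 (rotE (.var 4)) (.var 4))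

/-- Array `1`: the face successors. -/
def nextLoop : Cmd := .loop 4 2 (.wr 1 (.var 4) (.rd 0 (revE (.var 4))))

/-- Array `2`: the marks of the darts on the outer face. -/
def outerLoop : Cmd :=
  .seq (.set 5 (.inp (.lit 2)))
    (.loop 4 2 (.seq (.wr 2 (.var 5) (.lit 1)) (.set 5 (.rd 1 (.var 5)))))

/-- Array `3`: `Table.transport`. -/
def transportLoop : Cmd :=
  .loop 4 2 (.ite (.eq (.rd 2 (.var 4)) (.lit 1)) (.wr 3 (.var 4) (.var 4))
    (.ite (.eq (.rd 1 (.rd 1 (.rd 1 (.rd 1 (.var 4))))) (.var 4))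
      (.wr 3 (.var 4) (revE (.rd 1 (.rd 1 (.var 4)))))
      (.wr 3 (.var 4) (revE (.rd 1 (.rd 1 (.rd 1 (.var 4))))))))

/-- Variable `x`: the vector prescribed for the dart in variable `4`. -/
def givenCmd (x : ℕ) : Cmd :=
  .ite (.eq (.sub (pxE (tailE (revE (.var 4)))) (pxE (tailE (.var 4)))) (.lit 1))
    (.set x (.var 6))
    (.ite (.eq (.sub (pxE (tailE (revE (.var 4)))) (pxE (tailE (.var 4)))) (.lit (-1)))
      (.set x (.sub (.lit 0) (.var 6)))
      (.set x (.sub (pyE (tailE (revE (.var 4)))) (pyE (tailE (.var 4))))))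

/-- If the dart in variable `9` is not marked in the array `V`, mark it, give it the value in
variable `10` in the array `A`, and append it to the queue in the array `Q` of length `q`. -/
def visit (V A Q q : ℕ) : Cmd :=
  .ite (.eq (.rd V (.var 9)) (.lit 0))
    (.seq (.wr V (.var 9) (.lit 1)) (.seq (.wr A (.var 9) (.var 10))
      (.seq (.wr Q (.var q) (.var 9)) (.set q (.add (.var q) (.lit 1))))))
    .skip

/-- The darts on the outer face and their reverses get their prescribed vectors. -/
def seedLoop : Cmd :=
  .loop 4 2 (.ite (.eq (.rd 2 (.var 4)) (.lit 1))
    (.seq (givenCmd 10) (.seq (.set 9 (.var 4)) (.seq (visit 4 5 6 8)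
      (.seq (givenCmd 10) (.seq (.set 10 (.sub (.lit 0) (.var 10)))
        (.seq (.set 9 (revE (.var 4))) (visit 4 5 6 8))))))) .skip)

/-- Arrays `4`, `5`, `6`: propagation of the vectors along `Table.transport`. -/
def vecLoop : Cmd :=
  .loop 4 2 (.ite (.lt (.var 4) (.var 8))
    (.seq (.set 5 (.rd 6 (.var 4))) (.seq (.set 9 (.rd 3 (.var 5)))
      (.seq (.set 10 (.rd 5 (.var 5))) (visit 4 5 6 8)))) .skip)

/-- Arrays `7`, `8`, `9`: propagation of the positions. -/
def codeLoop : Cmd :=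
  .seq (.set 9 (.inp (.lit 2))) (.seq (.set 10 (.lit 0)) (.seq (visit 7 8 9 11)
    (.loop 4 2 (.ite (.lt (.var 4) (.var 11))
      (.seq (.set 5 (.rd 9 (.var 4)))
        (.seq (.set 9 (revE (.var 5))) (.seq (.set 10 (.add (.rd 8 (.var 5)) (.rd 5 (.var 5))))
          (.seq (visit 7 8 9 11)
        (.seq (.set 9 (rotE (.var 5))) (.seq (.set 10 (.rd 8 (.var 5))) (visit 7 8 9 11)))))))
      .skip))))

/-- Variable `7`: an upper bound for the absolute values of the codes of the positions. -/
def radiusLoop : Cmd :=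
  .seq (.set 7 (.var 6)) (.loop 4 2 (.set 7 (.add (.var 7) (.var 6))))

/-- Eight times an expression. -/
def eight (e : Expr) : Expr :=
  .add (.add (.add e e) (.add e e)) (.add (.add e e) (.add e e))

/-- Record that the dart in variable `4` has the direction `c`. -/
def record (c : ℤ) : Cmd :=
  .seq (.wr 10 (.var 4) (.lit c))
    (.seq (.wr 11 (.add (eight (tailE (.var 4))) (.lit c)) (.lit 1))
      (.wr 11 (.add (eight (tailE (.var 4))) (.lit (c + 4))) (.lit 1)))

/-- Array `10`: the directions; array `11`: the directions that occur at the vertices. -/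
def dirLoop : Cmd :=
  .loop 4 2 (.ite (.eq (.rd 5 (.var 4)) (.var 6)) (record 0)
    (.ite (.eq (.rd 5 (.var 4)) (.lit 1)) (record 1)
    (.ite (.eq (.rd 5 (.var 4)) (.sub (.lit 0) (.var 6))) (record 2)
    (.ite (.eq (.rd 5 (.var 4)) (.lit (-1))) (record 3) (.set 0 (.lit 0))))))

/-- Unless the test succeeds, the answer is no. -/
def check (c : Cond) : Cmd := .ite c .skip (.set 0 (.lit 0))

/-- The positions are consistent with the vectors and the rotation. -/
def consistLoop : Cmd :=
  .loop 4 2 (.seq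
    (check (.eq (.rd 8 (revE (.var 4))) (.add (.rd 8 (.var 4)) (.rd 5 (.var 4)))))
    (check (.eq (.rd 8 (rotE (.var 4))) (.rd 8 (.var 4)))))

/-- The vectors on the outer face are the prescribed ones; on the internal faces all turns are
straight or to the left. -/
def faceLoop : Cmd :=
  .loop 4 2 (.ite (.eq (.rd 2 (.var 4)) (.lit 1))
    (.seq (givenCmd 10) (check (.eq (.rd 5 (.var 4)) (.var 10))))
    (.seq (.set 9 (.sub (.rd 10 (.rd 1 (.var 4))) (.rd 10 (.var 4))))
      (.ite (.eq (.var 9) (.lit 0)) .skip (.ite (.eq (.var 9) (.lit 1)) .skip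
        (check (.eq (.var 9) (.lit (-3))))))))

/-- The direction `j` quarter turns from the dart in variable `4` does not occur if variable `9`
is larger than `j`. -/
def gap (j : ℤ) : Cmd :=
  .ite (.lt (.lit j) (.var 9))
    (check (.eq (.rd 11 (.add (.add (eight (tailE (.var 4))) (.rd 10 (.var 4))) (.lit j))) (.lit 0)))
    .skip

/-- The drawing has the prescribed rotation. -/
def rotLoop : Cmd :=
  .loop 4 2 (.seq (.set 9 (.sub (.rd 10 (rotE (.var 4))) (.rd 10 (.var 4))))
    (.seq (.ite (.lt (.lit 0) (.var 9)) .skip (.set 9 (.add (.var 9) (.lit 4))))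
      (.seq (gap 1) (.seq (gap 2) (gap 3)))))

/-- Distinct vertices have distinct positions. -/
def injLoop : Cmd :=
  .loop 4 2 (.seq (.set 9 (.rd 12 (.add (.rd 8 (.var 4)) (.var 7))))
    (.ite (.eq (.var 9) (.lit 0))
      (.wr 12 (.add (.rd 8 (.var 4)) (.var 7)) (.add (tailE (.var 4)) (.lit 1)))
      (check (.eq (.var 9) (.add (tailE (.var 4)) (.lit 1))))))

/-- The part of the program that is executed if there are at most four times as many darts as
vertices. -/
def main : Cmd :=
  .seq rotSymmLoop (.seq nextLoop (.seq outerLoop (.seq transportLoop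
    (.seq (.set 6 (.add (.add (.add (.add (.var 1) (.var 1)) (.var 1)) (.var 1)) (.lit 1)))
    (.seq seedLoop (.seq vecLoop (.seq codeLoop (.seq radiusLoop (.seq (.set 0 (.lit 1))
    (.seq dirLoop (.seq consistLoop (.seq faceLoop (.seq rotLoop injLoop)))))))))))))

/-- The whole program. -/
def program : Cmd :=
  .seq (.set 1 (.inp (.lit 0))) (.seq (.set 2 (.inp (.lit 1)))
    (.ite (.lt (.add (.add (.add (.var 1) (.var 1)) (.var 1)) (.var 1)) (.var 2)) .skip main))

theorem program_WF : program.WF = true := by decide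

theorem program_flat : program.flat = true := by decide

end Prg

/-! ### Loops over the darts and the tables derived from the input. -/

namespace Table

open UnitGrid.Prg UnitGrid.Cmd

variable {D : Type} {n k : ℕ} {T : Table D n k} {I : ℤ → ℤ} {N κ : ℕ}

theorem lt_succ_num {d e : D} : (T.num e : ℕ) < T.num d + 1 ↔ e = d ∨ (T.num e : ℕ) < T.num d := by
  rw [Nat.lt_succ_iff_lt_or_eq, or_comm]
  simp [Fin.val_inj]

/-- The rule for loops over the darts. -/
theorem wp_dartLoop (T : Table D n k) {p : Cmd} {Q : HState → Prop} {σ : HState}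
    (hk : σ.var 2 = k) (hκ : k ≤ κ) (hN : k ≤ N) (h4 : 4 ∉ p.modVar) (h2 : 2 ∉ p.modVar)
    (Inv : ℕ → HState → Prop) (h0 : Inv 0 (σ.setVar 4 0))
    (hs : ∀ d σ', (loop 4 2 p).Frame σ σ' → Inv (T.num d) σ' → σ'.var 4 = T.ix d → σ'.var 2 = k →
      p.wp I N κ (fun σ'' => Inv (T.num d + 1) (σ''.setVar 4 ((T.num d + 1 : ℕ) : ℤ))) σ')
    (hQ : ∀ σ', (loop 4 2 p).Frame σ σ' → Inv k σ' → Q σ') :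
    (loop 4 2 p).wp I N κ Q σ := by
  refine wp_loop Inv (by decide) h4 h2 hk hκ hN h0 ?_ fun σ' h h' _ => hQ σ' h h'
  intro j hj σ' hF hI h4 h2
  obtain ⟨d, hd⟩ := T.num.surjective ⟨j, hj⟩
  have hd' : ((T.num d : Fin k) : ℕ) = j := by rw [hd]
  subst hd'
  exact hs d σ' hF hI h4 h2

/-- Standing assumptions: the input describes the instance, and `N` and `κ` are large enough. -/
structure Setup (T : Table D n k) (I : ℤ → ℤ) (N κ : ℕ) : Prop extends T.Reads I where
  loops : k ≤ κ
  size : (k + 1) * (n + n + n + n + 1) ≤ N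
  unit : ∀ d, T.Outer d → T.given d = T.base ∨ T.given d = -T.base ∨ T.given d = 1 ∨ T.given d = -1

theorem num_nonneg₁ (d : D) : 0 ≤ 3 + T.ix d := by have := T.ix_nonneg d; omega

theorem num_nonneg₂ (d : D) : 0 ≤ 3 + (k : ℤ) + T.ix d := by have := T.ix_nonneg d; omega

theorem num_nonneg₃ (d : D) : 0 ≤ 3 + (k : ℤ) + k + T.ix d := by have := T.ix_nonneg d; omega

namespace Setup

variable (H : T.Setup I N κ)
include H

theorem k_le : k ≤ N := by
  have := H.size
  nlinarith [Nat.zero_le (k * n), Nat.zero_le n]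

theorem n_lt : n + 1 ≤ N := by
  have := H.size
  have h : 0 < k := lt_of_le_of_lt (Nat.zero_le _) (T.num T.out).isLt
  nlinarith [Nat.zero_le (k * n), Nat.zero_le n]

theorem abs_ix_le (d : D) : |T.ix d| ≤ N := by
  rw [abs_of_nonneg (T.ix_nonneg d)]
  have := T.ix_lt d
  have : (k : ℤ) ≤ N := by exact_mod_cast H.k_le
  omega

/-- The field `size` of `Setup` is made for this: a position code found in the search is at most the
number of its place in the queue, counted from one, times the base, and queues have at most k
entries. -/
theorem base_mul_le {j : ℕ} (hj : j ≤ k + 1) : (j : ℤ) * T.base ≤ N := by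
  have := H.size
  have h : j * (n + n + n + n + 1) ≤ N := le_trans (Nat.mul_le_mul_right _ hj) this
  unfold base
  exact_mod_cast h

theorem base_le : T.base ≤ N := by
  have := H.base_mul_le (j := 1) (by omega)
  simpa using this

omit H in
theorem one_le_base : 1 ≤ T.base := by unfold base; omega

theorem abs_given_le {d : D} (hd : T.Outer d) : |T.given d| ≤ T.base := by
  have := Setup.one_le_base (T := T)
  rcases H.unit d hd with h | h | h | h <;> rw [h, abs_le] <;> constructor <;> linarith

/-- A permutation is inverted by writing `d` into the cell of its image; different darts write into
different cells. -/
theorem rotSymmLoop_wp {σ : HState} (hk : σ.var 2 = k) :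
    rotSymmLoop.wp I N κ (fun σ' => ∀ d, σ'.arr 0 (T.ix d) = T.ix (T.rot.symm d)) σ := by
  refine wp_dartLoop T hk H.loops H.k_le (by decide) (by decide)
    (fun j σ' => ∀ d, (T.num d : ℕ) < j → σ'.arr 0 (T.ix (T.rot d)) = T.ix d) ?_ ?_ ?_
  · intro d hd; omega
  · intro d σ' hF hInv h4 h2
    simp only [Cmd.wp, rotE, Expr.eval, Expr.Ok, h2, h4, H.rot]
    refine ⟨by simp [num_nonneg₃], trivial, by simp, H.abs_ix_le d, ?_⟩
    intro e he
    simp only [HState.setVar, HState.setArr, Function.update_self]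
    rcases lt_succ_num.1 he with rfl | he
    · simp
    · rw [Function.update_apply]
      split_ifs with h
      · simp at h; rw [h]
      · exact hInv e he
  · intro σ' hF hInv d
    have := hInv (T.rot.symm d) (T.num _).isLt
    simpa using this

theorem nextLoop_wp {σ : HState} (hk : σ.var 2 = k)
    (h0 : ∀ d, σ.arr 0 (T.ix d) = T.ix (T.rot.symm d)) :
    nextLoop.wp I N κ (fun σ' => ∀ d, σ'.arr 1 (T.ix d) = T.ix (T.next d)) σ := by
  refine wp_dartLoop T hk H.loops H.k_le (by decide) (by decide)
    (fun j σ' => ∀ d, (T.num d : ℕ) < j → σ'.arr 1 (T.ix d) = T.ix (T.next d)) ?_ ?_ ?_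
  · intro d hd; omega
  · intro d σ' hF hInv h4 h2
    have hA := hF.arr 0 (by decide)
    simp only [Cmd.wp, revE, Expr.eval, Expr.Ok, h2, h4, H.rev, hA, h0]
    refine ⟨trivial, by simp [num_nonneg₂], by simp, H.abs_ix_le _, ?_⟩
    intro e he
    simp only [HState.setVar, HState.setArr, Function.update_self]
    rcases lt_succ_num.1 he with rfl | he
    · simp [next]
    · rw [Function.update_apply]
      split_ifs with h
      · simp at h; rw [h]; rfl
      · exact hInv e he
  · intro σ' hF hInv d
    exact hInv d (T.num _).isLt

/-- The walk takes k steps whatever the degree of the outer face is, possibly going round several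
times, so no stopping test is needed. -/
theorem outerLoop_wp {σ : HState} (hk : σ.var 2 = k)
    (h1 : ∀ d, σ.arr 1 (T.ix d) = T.ix (T.next d)) (h2 : ∀ j, σ.arr 2 j = 0) :
    outerLoop.wp I N κ (fun σ' => ∀ d, σ'.arr 2 (T.ix d) = 1 ↔ T.Outer d) σ := by
  refine ⟨by simp [Expr.Ok, Expr.eval], ?_, ?_⟩
  · simp only [Expr.eval, H.two]; exact H.abs_ix_le _
  simp only [Expr.eval, H.two]
  refine wp_loop (K := k)
    (fun j σ' => σ'.var 5 = T.ix (T.next^[j] T.out) ∧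
      ∀ d, σ'.arr 2 (T.ix d) = 1 ↔ ∃ i < j, T.next^[i] T.out = d)
    (by decide) (by decide) (by decide) (by simpa [HState.setVar] using hk) H.loops H.k_le ?_ ?_ ?_
  · constructor
    · simp [HState.setVar]
    · simp [HState.setVar, h2]
  · intro j hj σ' hF ⟨h5, hm⟩ hi4 hb
    have hA : ∀ d, σ'.arr 1 (T.ix d) = T.ix (T.next d) := by
      intro d
      rw [hF.arr 1 (by decide)]
      exact h1 d
    simp only [Cmd.wp, Expr.eval, Expr.Ok]
    have hN1 : (1 : ℤ) ≤ N := by exact_mod_cast (by have := H.n_lt; omega)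
    refine ⟨trivial, trivial, by rw [h5]; simp, by simpa using hN1,
      ⟨trivial, by simp [HState.setArr, h5]⟩, ?_, ?_, ?_⟩
    · simp [HState.setArr, h5, hA]; exact H.abs_ix_le _
    · simp [HState.setArr, HState.setVar, h5, hA, Function.iterate_succ_apply']
    · intro d
      simp only [HState.setArr, HState.setVar, h5, Function.update_self, Function.update_apply,
        ix_inj]
      constructor
      · intro h
        split_ifs at h with hd
        · exact ⟨j, by omega, (T.ix_inj.1 hd).symm⟩
        · obtain ⟨i, hi, hid⟩ := (hm d).1 h
          exact ⟨i, by omega, hid⟩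
      · rintro ⟨i, hi, hid⟩
        split_ifs with hd
        · rfl
        · refine (hm d).2 ⟨i, ?_, hid⟩
          rcases Nat.lt_succ_iff_lt_or_eq.1 hi with h | rfl
          · exact h
          · exact absurd (T.ix_inj.2 hid.symm) hd
  · intro σ' hF ⟨_, hm⟩ _
    exact hm

theorem transportLoop_wp {σ : HState} (hk : σ.var 2 = k)
    (h1 : ∀ d, σ.arr 1 (T.ix d) = T.ix (T.next d)) (h2 : ∀ d, σ.arr 2 (T.ix d) = 1 ↔ T.Outer d) :
    transportLoop.wp I N κ (fun σ' => ∀ d, σ'.arr 3 (T.ix d) = T.ix (T.transport d)) σ := by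
  refine wp_dartLoop T hk H.loops H.k_le (by decide) (by decide)
    (fun j σ' => ∀ d, (T.num d : ℕ) < j → σ'.arr 3 (T.ix d) = T.ix (T.transport d)) ?_ ?_ ?_
  · intro d hd; omega
  · intro d σ' hF hInv hv4 hv2
    have hA1 : ∀ d, σ'.arr 1 (T.ix d) = T.ix (T.next d) := by
      rw [hF.arr 1 (by decide)]; exact h1
    have hA2 : ∀ d, σ'.arr 2 (T.ix d) = 1 ↔ T.Outer d := by
      rw [hF.arr 2 (by decide)]; exact h2
    have key : ∀ z, z = T.ix (T.transport d) → ∀ e, (T.num e : ℕ) < T.num d + 1 →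
        ((σ'.setArr 3 (T.ix d) z).setVar 4 ((T.num d + 1 : ℕ) : ℤ)).arr 3 (T.ix e) =
          T.ix (T.transport e) := by
      intro z hz e he
      simp only [HState.setVar, HState.setArr, Function.update_self]
      rcases lt_succ_num.1 he with rfl | he
      · simp [hz]
      · rw [Function.update_apply]
        split_ifs with h
        · simp at h; rw [h, hz]
        · exact hInv e he
    simp only [Cmd.wp, revE, Expr.eval, Expr.Ok, hv2, hv4, H.rev, hA1, hA2, Cond.lhs, Cond.rhs,
      Cond.Holds, ix_inj, ix_nonneg, and_true, true_and, num_nonneg₂, H.abs_ix_le]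
    refine ⟨fun ho => ?_, fun ho => ⟨fun h4 => ?_, fun h4 => ?_⟩⟩
    · exact key _ (by rw [transport, if_pos ho])
    · exact key _ (by rw [transport, if_neg ho, if_pos h4])
    · exact key _ (by rw [transport, if_neg ho, if_neg h4])
  · intro σ' hF hInv d
    exact hInv d (T.num _).isLt

/-- Only for darts on the outer face is the prescribed vector known to be a unit vector, which
bounds the word written. -/
theorem givenCmd_wp {σ : HState} {Q : HState → Prop} {x : ℕ} {d : D} (hn : σ.var 1 = n)
    (hk : σ.var 2 = k) (h4 : σ.var 4 = T.ix d) (h6 : σ.var 6 = T.base) (hd : T.Outer d)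
    (hQ : Q (σ.setVar x (T.given d))) : (givenCmd x).wp I N κ Q σ := by
  have hb := (H.abs_given_le hd).trans H.base_le
  have p1 : ∀ v : Fin n, (0 : ℤ) ≤ 3 + k + k + k + (v : ℕ) := fun v => by positivity
  have p2 : ∀ v : Fin n, (0 : ℤ) ≤ 3 + k + k + k + n + (v : ℕ) := fun v => by positivity
  simp only [givenCmd, Cmd.wp, revE, tailE, pxE, pyE, Expr.eval, Expr.Ok, hn, hk, h4, h6, H.rev,
    H.tail, H.px, H.py, Cond.lhs, Cond.rhs, Cond.Holds, num_nonneg₁, num_nonneg₂, p1, p2, and_true,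
    true_and]
  refine ⟨fun h => ?_, fun h => ⟨fun h' => ?_, fun h' => ?_⟩⟩
  · have : T.given d = T.base := by rw [given, if_pos h]
    rw [← this]; exact ⟨hb, hQ⟩
  · have : T.given d = 0 - T.base := by rw [given, if_neg h, if_pos h', zero_sub]
    rw [← this]; exact ⟨hb, hQ⟩
  · have : T.given d = T.py (T.tail (T.rev d)) - T.py (T.tail d) := by
      rw [given, if_neg h, if_neg h']
    rw [← this]; exact ⟨hb, hQ⟩

end Setup

/-! ### Search queues. -/

/-- The queue `Q` of length `q` contains the darts in the list `l`; these are the darts marked in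
`V`, their values are stored in `A`, and the value of the `j`-th dart in the queue satisfies
`P j`. -/
structure Queue (T : Table D n k) (V A Q q : ℕ) (P : ℕ → D → ℤ → Prop) (l : List D)
    (σ : HState) : Prop where
  nodup : l.Nodup
  len : σ.var q = l.length
  get : ∀ j (h : j < l.length), σ.arr Q j = T.ix l[j]
  mem : ∀ d ∈ l, σ.arr V (T.ix d) ≠ 0
  notMem : ∀ d ∉ l, σ.arr V (T.ix d) = 0 ∧ σ.arr A (T.ix d) = 0
  val : ∀ j (h : j < l.length), P j l[j] (σ.arr A (T.ix l[j]))

/-- A dart enters a queue at most once; this is why k rounds empty the queue. -/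
theorem length_le_of_nodup {l : List D} (T : Table D n k) (h : l.Nodup) : l.length ≤ k := by
  have := (h.map T.num.injective).length_le_card
  simpa using this

theorem Queue.congr {V A Q q : ℕ} {P : ℕ → D → ℤ → Prop} {l : List D} {σ σ' : HState}
    (h : T.Queue V A Q q P l σ) (hV : σ'.arr V = σ.arr V) (hA : σ'.arr A = σ.arr A)
    (hQ : σ'.arr Q = σ.arr Q) (hq : σ'.var q = σ.var q) : T.Queue V A Q q P l σ' := by
  refine ⟨h.nodup, hq.trans h.len, ?_, ?_, ?_, ?_⟩
  · rw [hQ]; exact h.get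
  · rw [hV]; exact h.mem
  · rw [hV, hA]; exact h.notMem
  · rw [hA]; exact h.val

theorem Queue.setVar {V A Q q : ℕ} {P : ℕ → D → ℤ → Prop} {l : List D} {σ : HState} {x : ℕ} {z : ℤ}
    (h : T.Queue V A Q q P l σ) (hx : q ≠ x) : T.Queue V A Q q P l (σ.setVar x z) :=
  h.congr rfl rfl rfl (by simp [HState.setVar, hx])

theorem Queue.nil {V A Q q : ℕ} {P : ℕ → D → ℤ → Prop} {σ : HState} (hq : σ.var q = 0)
    (hV : ∀ j, σ.arr V j = 0) (hA : ∀ j, σ.arr A j = 0) : T.Queue V A Q q P [] σ :=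
  ⟨List.nodup_nil, by simpa using hq, fun j h => by simp at h, fun d h => by simp at h,
    fun d _ => ⟨hV _, hA _⟩, fun j h => by simp at h⟩

theorem Queue.val_of_mem {V A Q q : ℕ} {P : ℕ → D → ℤ → Prop} {l : List D} {σ : HState}
    (h : T.Queue V A Q q P l σ) {d : D} (hd : d ∈ l) :
    ∃ j < l.length, P j d (σ.arr A (T.ix d)) := by
  obtain ⟨j, hj, rfl⟩ := List.getElem_of_mem hd
  exact ⟨j, hj, h.val j hj⟩

/-- Only a newly reached dart has to satisfy `P`, at the index where it is appended. The old queue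
is a prefix of the new one, so places already processed keep their meaning. If the dart was reached
before, its first value stays. -/
theorem Setup.visit_wp (H : T.Setup I N κ) {V A Q q : ℕ} {P : ℕ → D → ℤ → Prop} {l : List D}
    {σ : HState} {d : D} {v : ℤ} (hVA : V ≠ A) (hVQ : V ≠ Q) (hAQ : A ≠ Q) (h : T.Queue V A Q q P l σ)
    (h9 : σ.var 9 = T.ix d) (h10 : σ.var 10 = v) (hP : d ∉ l → P l.length d v) (hv : |v| ≤ N) :
    (visit V A Q q).wp I N κ (fun σ' => ∃ l', l <+: l' ∧ d ∈ l' ∧ T.Queue V A Q q P l' σ') σ := by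
  simp only [visit, Cmd.wp, Expr.eval, Expr.Ok, Cond.lhs, Cond.rhs, Cond.Holds, h9, ix_nonneg,
    and_true, true_and]
  refine ⟨fun h0 => ?_, fun h0 => ⟨l, List.prefix_rfl, ?_, h⟩⟩
  · have hd : d ∉ l := fun hd => h.mem d hd h0
    have hnd : (l ++ [d]).Nodup := by
      rw [List.nodup_append]
      exact ⟨h.nodup, List.nodup_singleton d, by
        intro a ha b hb; simp at hb; subst hb; rintro rfl; exact hd ha⟩
    have hlen : l.length + 1 ≤ k := by simpa using T.length_le_of_nodup hnd
    have hN1 : (1 : ℤ) ≤ N := by exact_mod_cast (by have := H.n_lt; omega)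
    have hlN : ((l.length + 1 : ℕ) : ℤ) ≤ N := by exact_mod_cast hlen.trans H.k_le
    push_cast at hlN
    simp only [HState.setArr, HState.setVar, h.len, h9, h10, ix_nonneg, true_and]
    refine ⟨by simpa using hN1, hv, by positivity, H.abs_ix_le d, ?_, l ++ [d],
      List.prefix_append _ _, by simp, hnd, by simp, ?_, ?_, ?_, ?_⟩
    · rw [abs_of_nonneg (by positivity)]; exact hlN
    · intro j hj
      simp only [Function.update_self, Function.update_apply]
      rw [if_neg (Ne.symm hAQ), if_neg (Ne.symm hVQ)]
      simp only [List.length_append, List.length_singleton] at hj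
      split_ifs with hjl
      · have : j = l.length := by exact_mod_cast hjl
        subst this; simp
      · have : j < l.length := by
          have : j ≠ l.length := fun hh => hjl (by rw [hh])
          omega
        rw [List.getElem_append_left this]; exact h.get j this
    · intro e he
      simp only [Function.update_apply]
      simp only [if_neg hVQ, if_neg hVA, if_true]
      rw [Function.update_apply]
      split_ifs with hc
      · norm_num
      · simp only [List.mem_append, List.mem_singleton] at he
        rcases he with he | rfl
        · exact h.mem e he
        · exact absurd rfl hc
    · intro e he
      simp only [List.mem_append, List.mem_singleton, not_or] at he
      simp only [Function.update_apply]
      simp only [if_neg hVQ, if_neg hVA, if_neg hAQ, if_neg (Ne.symm hVA), if_true]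
      rw [Function.update_of_ne (by simpa using he.2), Function.update_of_ne (by simpa using he.2)]
      exact h.notMem e he.1
    · intro j hj
      simp only [Function.update_apply]
      simp only [if_neg hAQ, if_true, if_neg (Ne.symm hVA)]
      have hj' := hj
      simp only [List.length_append, List.length_singleton] at hj'
      by_cases hjl : j < l.length
      · rw [List.getElem_append_left hjl, Function.update_of_ne]
        · exact h.val j hjl
        · rw [Ne, ix_inj]; rintro rfl; exact hd (List.getElem_mem hjl)
      · have : j = l.length := by omega
        subst this
        simpa using hP hd
  · by_contra hd
    exact h0 (h.notMem d hd).1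

end Table

/-! ### Propagation of vectors and positions, and the rule for loops of checks. -/

namespace Table

open UnitGrid.Prg UnitGrid.Cmd

variable {D : Type} {n k : ℕ} {T : Table D n k} {I : ℤ → ℤ} {N κ : ℕ}

/-- The vectors obtained by propagation from the outer face. -/
inductive VecDer (T : Table D n k) : D → ℤ → Prop
  | out (d : D) (h : T.Outer d) : VecDer T d (T.given d)
  | rev (d : D) (h : T.Outer d) : VecDer T (T.rev d) (-T.given d)
  | step (d : D) (v : ℤ) (h : VecDer T d v) : VecDer T (T.transport d) v

/-- The codes of positions obtained by propagation. -/
inductive CodeDer (T : Table D n k) (vec : D → ℤ) : D → ℤ → Prop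
  | out : CodeDer T vec T.out 0
  | rev (d : D) (v : ℤ) (h : CodeDer T vec d v) : CodeDer T vec (T.rev d) (v + vec d)
  | rot (d : D) (v : ℤ) (h : CodeDer T vec d v) : CodeDer T vec (T.rot d) v

theorem VecDer.abs_le (H : T.Setup I N κ) {d : D} {v : ℤ} (h : T.VecDer d v) : |v| ≤ T.base := by
  induction h with
  | out d h => exact H.abs_given_le h
  | rev d h => rw [abs_neg]; exact H.abs_given_le h
  | step d v h ih => exact ih

namespace Setup

variable (H : T.Setup I N κ)
include H

/-- The stored value is only claimed to be derivable. Whether different derivations agree is not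
asked: if a drawing exists they do, and otherwise the later checks decide. -/
theorem seedLoop_wp {σ : HState} (hn : σ.var 1 = n) (hk : σ.var 2 = k) (h6 : σ.var 6 = T.base)
    (h2 : ∀ d, σ.arr 2 (T.ix d) = 1 ↔ T.Outer d) (hV : ∀ j, σ.arr 4 j = 0)
    (hA : ∀ j, σ.arr 5 j = 0) (hq : σ.var 8 = 0) :
    seedLoop.wp I N κ (fun σ' => ∃ l, T.Queue 4 5 6 8 (fun _ => T.VecDer) l σ' ∧
      ∀ d, T.Outer d → d ∈ l ∧ T.rev d ∈ l) σ := by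
  refine wp_dartLoop T hk H.loops H.k_le (by decide) (by decide)
    (fun j σ' => ∃ l, T.Queue 4 5 6 8 (fun _ => T.VecDer) l σ' ∧
      ∀ d, (T.num d : ℕ) < j → T.Outer d → d ∈ l ∧ T.rev d ∈ l) ?_ ?_ ?_
  · exact ⟨[], Queue.nil (by simpa [HState.setVar] using hq) hV hA, fun d hd => by omega⟩
  · rintro d σ' hF ⟨l, hl, hm⟩ hv4 hv2
    have hA2 : ∀ d, σ'.arr 2 (T.ix d) = 1 ↔ T.Outer d := by
      rw [hF.arr 2 (by decide)]; exact h2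
    have hv1 : σ'.var 1 = n := (hF.var 1 (by decide)).trans hn
    have hv6 : σ'.var 6 = T.base := (hF.var 6 (by decide)).trans h6
    refine ⟨by simp [Cond.lhs, Expr.Ok, Expr.eval, hv4], by simp [Cond.rhs, Expr.Ok], ?_, ?_⟩
    · intro ho
      simp only [Cond.Holds, Expr.eval, hv4, hA2] at ho
      have hb := (H.abs_given_le ho).trans H.base_le
      refine H.givenCmd_wp hv1 hv2 hv4 hv6 ho ⟨trivial, ?_, ?_⟩
      · simpa [Expr.eval, HState.setVar, hv4] using H.abs_ix_le d
      refine wp_seq (H.visit_wp (by decide) (by decide) (by decide)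
        ((hl.setVar (by decide)).setVar (by decide)) (d := d) (v := T.given d) ?_ ?_ ?_ hb) ?_
      · simp [HState.setVar, Expr.eval, hv4]
      · simp [HState.setVar]
      · exact fun _ => VecDer.out d ho
      rintro σ1 hF1 ⟨l1, hp1, hd1, hl1⟩
      have e1 : σ1.var 1 = n := by
        rw [hF1.var 1 (by decide)]; simpa [HState.setVar] using hv1
      have e2 : σ1.var 2 = k := by
        rw [hF1.var 2 (by decide)]; simpa [HState.setVar] using hv2
      have e4 : σ1.var 4 = T.ix d := by
        rw [hF1.var 4 (by decide)]; simpa [HState.setVar] using hv4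
      have e6 : σ1.var 6 = T.base := by
        rw [hF1.var 6 (by decide)]; simpa [HState.setVar] using hv6
      refine H.givenCmd_wp e1 e2 e4 e6 ho ⟨⟨trivial, trivial⟩, ?_, ⟨?_, ?_⟩, ?_, ?_⟩
      · simpa [Expr.eval, HState.setVar] using hb
      · simp [Expr.Ok]
      · simp [Expr.eval, HState.setVar, e4, e2, num_nonneg₂]
      · simpa [Expr.eval, HState.setVar, e4, e2, revE, H.rev] using H.abs_ix_le _
      refine wp_mono (H.visit_wp (by decide) (by decide) (by decide)
        (((hl1.setVar (by decide)).setVar (by decide)).setVar (by decide)) (d := T.rev d)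
        (v := -T.given d) ?_ ?_ ?_ ?_) ?_
      · simp [HState.setVar, Expr.eval, e4, e2, revE, H.rev]
      · simp [HState.setVar, Expr.eval]
      · exact fun _ => VecDer.rev d ho
      · rwa [abs_neg]
      rintro σ2 ⟨l2, hp2, hd2, hl2⟩
      refine ⟨l2, hl2.setVar (by decide), fun e he hoe => ?_⟩
      rcases lt_succ_num.1 he with rfl | he
      · exact ⟨hp2.subset hd1, hd2⟩
      · exact ⟨hp2.subset (hp1.subset (hm e he hoe).1), hp2.subset (hp1.subset (hm e he hoe).2)⟩
    · intro ho
      simp only [Cond.Holds, Expr.eval, hv4, hA2] at ho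
      refine ⟨l, hl.setVar (by decide), fun e he hoe => ?_⟩
      rcases lt_succ_num.1 he with rfl | he
      · exact absurd hoe ho
      · exact hm e he hoe
  · rintro σ' hF ⟨l, hl, hm⟩
    exact ⟨l, hl, fun d => hm d (T.num d).isLt⟩

/-- The usual loop until the queue is empty is replaced by k rounds: round j processes entry j if
there is one. The final queue is closed under transport because it has at most k entries. -/
theorem vecLoop_wp {σ : HState} (hk : σ.var 2 = k)
    (h3 : ∀ d, σ.arr 3 (T.ix d) = T.ix (T.transport d)) {l₀ : List D}
    (hl₀ : T.Queue 4 5 6 8 (fun _ => T.VecDer) l₀ σ) :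
    vecLoop.wp I N κ (fun σ' => ∃ l, T.Queue 4 5 6 8 (fun _ => T.VecDer) l σ' ∧ l₀ <+: l ∧
      ∀ d ∈ l, T.transport d ∈ l) σ := by
  refine wp_loop (K := k)
    (fun j σ' => ∃ l, T.Queue 4 5 6 8 (fun _ => T.VecDer) l σ' ∧ l₀ <+: l ∧
      ∀ i < j, ∀ h : i < l.length, T.transport l[i] ∈ l)
    (by decide) (by decide) (by decide) hk H.loops H.k_le ?_ ?_ ?_
  · exact ⟨l₀, hl₀.setVar (by decide), List.prefix_rfl, fun i hi => by omega⟩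
  · rintro j hj σ' hF ⟨l, hl, hp, hm⟩ hi hb
    have hA3 : ∀ d, σ'.arr 3 (T.ix d) = T.ix (T.transport d) := by
      rw [hF.arr 3 (by decide)]; exact h3
    refine ⟨trivial, trivial, fun hlt => ?_, fun hlt => ?_⟩
    · simp only [Cond.Holds, Expr.eval, hi, hl.len] at hlt
      have hjl : j < l.length := by exact_mod_cast hlt
      have hg := hl.get j hjl
      have hval := hl.val j hjl
      have hvb := (hval.abs_le H).trans H.base_le
      refine ⟨⟨trivial, ?_⟩, ?_, ⟨trivial, ?_⟩, ?_, ⟨trivial, ?_⟩, ?_, ?_⟩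
      · simp [Expr.eval, hi]
      · simpa [Expr.eval, hi, hg] using H.abs_ix_le _
      · simp [Expr.eval, HState.setVar, hi, hg]
      · simpa [Expr.eval, HState.setVar, hi, hg, hA3] using H.abs_ix_le _
      · simp [Expr.eval, HState.setVar, hi, hg]
      · simpa [Expr.eval, HState.setVar, hi, hg] using hvb
      refine wp_mono (H.visit_wp (by decide) (by decide) (by decide)
        (((hl.setVar (by decide)).setVar (by decide)).setVar (by decide)) (d := T.transport l[j])
        (v := σ'.arr 5 (T.ix l[j])) ?_ ?_ ?_ ?_) ?_
      · simp [Expr.eval, HState.setVar, hi, hg, hA3]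
      · simp [Expr.eval, HState.setVar, hi, hg]
      · exact fun _ => VecDer.step _ _ hval
      · exact hvb
      rintro σ1 ⟨l1, hp1, hd1, hl1⟩
      refine ⟨l1, hl1.setVar (by decide), hp.trans hp1, fun i hi h => ?_⟩
      rcases Nat.lt_succ_iff_lt_or_eq.1 hi with hi | rfl
      · have hil : i < l.length := by omega
        have := hm i hi hil
        rw [← hp1.getElem hil]
        exact hp1.subset this
      · rw [← hp1.getElem hjl]; exact hd1
    · simp only [Cond.Holds, Expr.eval, hi, hl.len] at hlt
      refine ⟨l, hl.setVar (by decide), hp, fun i hi h => hm i ?_ h⟩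
      have : l.length ≤ j := by exact_mod_cast not_lt.1 hlt
      omega
  · rintro σ' hF ⟨l, hl, hp, hm⟩ _
    refine ⟨l, hl, hp, fun d hd => ?_⟩
    obtain ⟨i, hi, rfl⟩ := List.getElem_of_mem hd
    exact hm i (hi.trans_le (T.length_le_of_nodup hl.nodup)) hi

/-- Besides being derivable, entry j is bounded by (j+1) times the base: the search starts with 0,
and every new value differs from that of an earlier entry by at most one vector. -/
theorem codeLoop_wp {σ : HState} (hk : σ.var 2 = k) {vec : D → ℤ}
    (h5 : ∀ d, σ.arr 5 (T.ix d) = vec d) (hvec : ∀ d, |vec d| ≤ T.base)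
    (hV : ∀ j, σ.arr 7 j = 0) (hA : ∀ j, σ.arr 8 j = 0) (hq : σ.var 11 = 0) :
    codeLoop.wp I N κ (fun σ' => ∃ l, T.Queue 7 8 9 11
      (fun j d v => T.CodeDer vec d v ∧ |v| ≤ (j + 1 : ℕ) * T.base) l σ' ∧ T.out ∈ l ∧
      ∀ d ∈ l, T.rev d ∈ l ∧ T.rot d ∈ l) σ := by
  have hb1 := one_le_base (T := T)
  refine ⟨by simp [Expr.Ok, Expr.eval], ?_, by simp [Expr.Ok], by simp [Expr.eval], ?_⟩
  · simpa [Expr.eval, H.two] using H.abs_ix_le _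
  refine wp_seq (H.visit_wp (by decide) (by decide) (by decide)
    (P := fun j d v => T.CodeDer vec d v ∧ |v| ≤ (j + 1 : ℕ) * T.base) (l := [])
    (Queue.nil (by simpa [HState.setVar] using hq) hV hA) (d := T.out) (v := 0) ?_ ?_ ?_ ?_) ?_
  · simp [HState.setVar, Expr.eval, H.two]
  · simp [HState.setVar, Expr.eval]
  · refine fun _ => ⟨CodeDer.out, by simp; omega⟩
  · simp
  rintro σ1 hF1 ⟨l₀, -, hd₀, hl₀⟩
  refine wp_loop (K := k)
    (fun j σ' => ∃ l, T.Queue 7 8 9 11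
      (fun j d v => T.CodeDer vec d v ∧ |v| ≤ (j + 1 : ℕ) * T.base) l σ' ∧ T.out ∈ l ∧
      ∀ i < j, ∀ h : i < l.length, T.rev l[i] ∈ l ∧ T.rot l[i] ∈ l)
    (by decide) (by decide) (by decide) ?_ H.loops H.k_le ?_ ?_ ?_
  · rw [hF1.var 2 (by decide)]; simpa [HState.setVar] using hk
  · exact ⟨l₀, hl₀.setVar (by decide), hd₀, fun i hi => by omega⟩
  · rintro j hj σ' hF ⟨l, hl, ho, hm⟩ hi hb
    have hA5 : ∀ d, σ'.arr 5 (T.ix d) = vec d := by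
      rw [hF.arr 5 (by decide), hF1.arr 5 (by decide)]; exact h5
    refine ⟨trivial, trivial, fun hlt => ?_, fun hlt => ?_⟩
    · simp only [Cond.Holds, Expr.eval, hi, hl.len] at hlt
      have hjl : j < l.length := by exact_mod_cast hlt
      have hg := hl.get j hjl
      obtain ⟨hval, hbd⟩ := hl.val j hjl
      have hbd' : |σ'.arr 8 (T.ix l[j]) + vec l[j]| ≤ (j + 1 + 1 : ℕ) * T.base := by
        have := abs_add_le (σ'.arr 8 (T.ix l[j])) (vec l[j])
        have := hvec l[j]
        push_cast at *
        linarith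
      have hbN := hbd.trans (H.base_mul_le (by omega))
      have hbN' := hbd'.trans (H.base_mul_le (by omega))
      -- A dart found from entry j is appended at a place larger than j, so its bound may be
      -- weakened to the one for that place.
      have hmono : ∀ {a : ℤ} {i i' : ℕ}, i ≤ i' → |a| ≤ (i : ℤ) * T.base → |a| ≤ (i' : ℤ) * T.base :=
        fun hii ha => ha.trans (mul_le_mul_of_nonneg_right (by exact_mod_cast hii) (by omega))
      refine ⟨⟨trivial, ?_⟩, ?_, ⟨?_, ?_⟩, ?_, ⟨⟨trivial, ?_⟩, trivial, ?_⟩, ?_, ?_⟩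
      · simp [Expr.eval, hi]
      · simpa [Expr.eval, hi, hg] using H.abs_ix_le _
      · simp [Expr.Ok]
      · simp [Expr.eval, HState.setVar, hi, hg, hb, num_nonneg₂]
      · simpa [Expr.eval, HState.setVar, hi, hg, hb, revE, H.rev] using H.abs_ix_le _
      · simp [Expr.eval, HState.setVar, hi, hg]
      · simp [Expr.eval, HState.setVar, hi, hg]
      · simpa [Expr.eval, HState.setVar, hi, hg, hA5] using hbN'
      refine wp_seq (H.visit_wp (by decide) (by decide) (by decide)
        (((hl.setVar (by decide)).setVar (by decide)).setVar (by decide)) (d := T.rev l[j])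
        (v := σ'.arr 8 (T.ix l[j]) + vec l[j]) ?_ ?_ ?_ ?_) ?_
      · simp [Expr.eval, HState.setVar, hi, hg, hb, revE, H.rev]
      · simp [Expr.eval, HState.setVar, hi, hg, hA5]
      · exact fun _ => ⟨CodeDer.rev _ _ hval, hmono (by omega) hbd'⟩
      · exact hbN'
      rintro σ2 hF2 ⟨l1, hp1, hd1, hl1⟩
      have e2 : σ2.var 2 = k := by
        rw [hF2.var 2 (by decide)]; simpa [HState.setVar] using hb
      have e5 : σ2.var 5 = T.ix l[j] := by
        rw [hF2.var 5 (by decide)]; simp [HState.setVar, Expr.eval, hi, hg]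
      have hjl1 : j < l1.length := hjl.trans_le hp1.length_le
      obtain ⟨hval1, hbd1⟩ := hl1.val j hjl1
      rw [← hp1.getElem hjl] at hval1 hbd1
      have hbN1 := hbd1.trans (H.base_mul_le (by omega))
      refine ⟨⟨?_, ?_⟩, ?_, ⟨trivial, ?_⟩, ?_, ?_⟩
      · simp [Expr.Ok]
      · simp [Expr.eval, e5, e2, num_nonneg₃]
      · simpa [Expr.eval, HState.setVar, e5, e2, rotE, H.rot] using H.abs_ix_le _
      · simp [Expr.eval, HState.setVar, e5]
      · simpa [Expr.eval, HState.setVar, e5] using hbN1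
      refine wp_mono (H.visit_wp (by decide) (by decide) (by decide)
        ((hl1.setVar (by decide)).setVar (by decide)) (d := T.rot l[j])
        (v := σ2.arr 8 (T.ix l[j])) ?_ ?_ ?_ ?_) ?_
      · simp [Expr.eval, HState.setVar, e5, e2, rotE, H.rot]
      · simp [Expr.eval, HState.setVar, e5]
      · exact fun _ => ⟨CodeDer.rot _ _ hval1, hmono (by omega) hbd1⟩
      · exact hbN1
      rintro σ3 ⟨l2, hp2, hd2, hl2⟩
      refine ⟨l2, hl2.setVar (by decide), hp2.subset (hp1.subset ho), fun i hi h => ?_⟩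
      rcases Nat.lt_succ_iff_lt_or_eq.1 hi with hi | rfl
      · have hil : i < l.length := by omega
        have := hm i hi hil
        rw [← (hp1.trans hp2).getElem hil]
        exact ⟨(hp1.trans hp2).subset this.1, (hp1.trans hp2).subset this.2⟩
      · rw [← (hp1.trans hp2).getElem hjl]; exact ⟨hp2.subset hd1, hd2⟩
    · simp only [Cond.Holds, Expr.eval, hi, hl.len] at hlt
      refine ⟨l, hl.setVar (by decide), ho, fun i hi h => hm i ?_ h⟩
      have : l.length ≤ j := by exact_mod_cast not_lt.1 hlt
      omega
  · rintro σ' hF ⟨l, hl, ho, hm⟩ _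
    refine ⟨l, hl, ho, fun d hd => ?_⟩
    obtain ⟨i, hi, rfl⟩ := List.getElem_of_mem hd
    exact hm i (hi.trans_le (T.length_le_of_nodup hl.nodup)) hi

/-- The product is formed by k additions. Added to a position code, it yields a nonnegative array
index. -/
theorem radiusLoop_wp {σ : HState} (hk : σ.var 2 = k) (h6 : σ.var 6 = T.base) :
    radiusLoop.wp I N κ (fun σ' => σ'.var 7 = (k + 1 : ℕ) * T.base) σ := by
  have hb1 := one_le_base (T := T)
  refine ⟨trivial, ?_, ?_⟩
  · simp only [Expr.eval, h6]; rw [abs_of_nonneg (by omega)]; exact H.base_le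
  refine wp_loop (K := k) (fun j σ' => σ'.var 7 = (j + 1 : ℕ) * T.base)
    (by decide) (by decide) (by decide) (by simpa [HState.setVar] using hk) H.loops H.k_le ?_ ?_ ?_
  · simp [HState.setVar, Expr.eval, h6]
  · intro j hj σ' hF h7 hi hb
    have e6 : σ'.var 6 = T.base := by
      rw [hF.var 6 (by decide)]; simpa [HState.setVar] using h6
    have e : σ'.var 7 + σ'.var 6 = (j + 1 + 1 : ℕ) * T.base := by
      rw [h7, e6]; push_cast; ring
    refine ⟨⟨trivial, trivial⟩, ?_, ?_⟩
    · simp only [Expr.eval, e]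
      rw [abs_of_nonneg (by positivity)]
      exact H.base_mul_le (by omega)
    · simp only [Expr.eval, e]; simp [HState.setVar]
  · exact fun σ' _ h _ => h

omit H in
theorem check_wp {c : Cond} {Q : HState → Prop} {σ : HState} (h1 : c.lhs.Ok I σ) (h2 : c.rhs.Ok I σ)
    (ht : c.Holds I σ → Q σ) (hf : ¬ c.Holds I σ → Q (σ.setVar 0 0)) :
    (check c).wp I N κ Q σ :=
  ⟨h1, h2, ht, fun h => ⟨trivial, by simp [Expr.eval], hf h⟩⟩

open Classical in
-- Variable `0` is never set back to one by a check, so at the end it holds the conjunction of all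
-- outcomes so far.
theorem checkLoop_wp {p : Cmd} {σ : HState} (hk : σ.var 2 = k) (h4 : 4 ∉ p.modVar)
    (h2 : 2 ∉ p.modVar) {C : D → Prop}
    (hs : ∀ d σ', (loop 4 2 p).Frame σ σ' → σ'.var 4 = T.ix d → σ'.var 2 = k →
      p.wp I N κ (fun σ'' => σ''.var 0 = if C d then σ'.var 0 else 0) σ') :
    (loop 4 2 p).wp I N κ (fun σ' => σ'.var 0 = if ∀ d, C d then σ.var 0 else 0) σ := by
  refine wp_dartLoop T hk H.loops H.k_le h4 h2
    (fun j σ' => σ'.var 0 = if ∀ d, (T.num d : ℕ) < j → C d then σ.var 0 else 0) ?_ ?_ ?_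
  · rw [if_pos (fun d hd => by omega)]; simp [HState.setVar]
  · intro d σ' hF hInv hv4 hv2
    refine wp_mono (hs d σ' hF hv4 hv2) fun σ'' h => ?_
    have : (∀ e, (T.num e : ℕ) < T.num d + 1 → C e) ↔ C d ∧ ∀ e, (T.num e : ℕ) < T.num d → C e := by
      simp only [lt_succ_num]
      constructor
      · exact fun h => ⟨h d (Or.inl rfl), fun e he => h e (Or.inr he)⟩
      · rintro ⟨h1, h2⟩ e (rfl | he)
        · exact h1
        · exact h2 e he
    simp only [HState.setVar, this]
    rw [Function.update_of_ne (by decide), h, hInv]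
    split_ifs <;> tauto
  · intro σ' hF hInv
    rw [hInv]
    have : (∀ d, (T.num d : ℕ) < k → C d) ↔ ∀ d, C d :=
      ⟨fun h d => h d (T.num d).isLt, fun h d _ => h d⟩
    simp only [this]

end Setup

end Table

/-! ### The acceptance test and the loops that carry it out. -/

namespace Table

open UnitGrid.Prg UnitGrid.Cmd

variable {D : Type} {n k : ℕ} {T : Table D n k} {I : ℤ → ℤ} {N κ : ℕ}

/-- The word represents a unit vector. -/
def IsDir (T : Table D n k) (v : ℤ) : Prop := v = T.base ∨ v = 1 ∨ v = -T.base ∨ v = -1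

open Classical in
/-- The number of quarter turns from the horizontal unit vector to a unit vector. -/
noncomputable def dir (T : Table D n k) (v : ℤ) : ℤ :=
  if v = T.base then 0 else if v = 1 then 1 else if v = -T.base then 2
  else if v = -1 then 3 else 0

theorem dir_nonneg (v : ℤ) : 0 ≤ T.dir v := by
  unfold dir; split_ifs <;> norm_num

theorem dir_lt (v : ℤ) : T.dir v < 4 := by
  unfold dir; split_ifs <;> norm_num

/-- The positions are consistent with the vectors and the rotation. -/
def Consistent (T : Table D n k) (vec code : D → ℤ) (d : D) : Prop :=
  code (T.rev d) = code d + vec d ∧ code (T.rot d) = code d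

/-- The vectors on the outer face are the prescribed ones; on the internal faces all turns are
straight or to the left. -/
def FaceOk (T : Table D n k) (vec : D → ℤ) (d : D) : Prop :=
  (T.Outer d → vec d = T.given d) ∧
    (¬ T.Outer d → T.dir (vec (T.next d)) - T.dir (vec d) = 0 ∨
      T.dir (vec (T.next d)) - T.dir (vec d) = 1 ∨ T.dir (vec (T.next d)) - T.dir (vec d) = -3)

/-- The number of quarter turns to the next dart with the same tail, between `1` and `4`. -/
noncomputable def turn (T : Table D n k) (vec : D → ℤ) (d : D) : ℤ :=
  if 0 < T.dir (vec (T.rot d)) - T.dir (vec d) then T.dir (vec (T.rot d)) - T.dir (vec d)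
  else T.dir (vec (T.rot d)) - T.dir (vec d) + 4

/-- The directions between a dart and its successor do not occur. -/
def RotOk (T : Table D n k) (vec : D → ℤ) (d : D) : Prop :=
  ∀ j : ℤ, 1 ≤ j → j < T.turn vec d → ¬ ∃ e, T.tail e = T.tail d ∧
    (T.dir (vec d) + j = T.dir (vec e) ∨ T.dir (vec d) + j = T.dir (vec e) + 4)

/-- Distinct vertices have distinct positions. -/
def InjOk (T : Table D n k) (code : D → ℤ) : Prop :=
  ∀ d e, code d = code e → T.tail d = T.tail e

/-- The computed vectors and positions define a drawing. -/
def Accepts (T : Table D n k) (vec code : D → ℤ) : Prop :=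
  (∀ d, T.IsDir (vec d)) ∧ (∀ d, T.Consistent vec code d) ∧ (∀ d, T.FaceOk vec d) ∧
    (∀ d, T.RotOk vec d) ∧ T.InjOk code

theorem eight_eval (σ : HState) (e : Expr) : (eight e).eval I σ = 8 * e.eval I σ := by
  simp only [eight, Expr.eval]; ring

theorem eight_ok (σ : HState) (e : Expr) : (eight e).Ok I σ ↔ e.Ok I σ := by
  simp only [eight, Expr.Ok]; tauto

namespace Setup

variable (H : T.Setup I N κ)
include H

theorem record_wp {σ : HState} {Q : HState → Prop} {d : D} {c : ℤ} (h4 : σ.var 4 = T.ix d)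
    (hc : 0 ≤ c) (hc' : c < 4) (hQ : Q (((σ.setArr 10 (T.ix d) c).setArr 11
      (8 * (T.tail d : ℕ) + c) 1).setArr 11 (8 * (T.tail d : ℕ) + (c + 4)) 1)) :
    (record c).wp I N κ Q σ := by
  have hN : 4 ≤ N := by
    have := H.size
    have hk : 0 < k := lt_of_le_of_lt (Nat.zero_le _) (T.num T.out).isLt
    have hn : 0 < n := lt_of_le_of_lt (Nat.zero_le _) (T.tail T.out).isLt
    nlinarith [Nat.zero_le (k * n)]
  have hN' : (4 : ℤ) ≤ N := by exact_mod_cast hN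
  have ht : (0 : ℤ) ≤ (T.tail d : ℕ) := by positivity
  simp only [record, Cmd.wp, Expr.eval, Expr.Ok, eight_eval, eight_ok, tailE, h4, HState.setArr,
    H.tail, num_nonneg₁, ix_nonneg, true_and, and_true]
  refine ⟨?_, by omega, ?_, by omega, ?_, hQ⟩
  · rw [abs_le]; constructor <;> omega
  · rw [abs_le]; constructor <;> omega
  · rw [abs_le]; constructor <;> omega

open Classical in
-- Each vertex owns eight cells of array `11`, and a direction c is recorded at both c and c + 4.
-- Thus a direction plus an offset of at most three can be looked up without reduction modulo four.
-- The table is complete only if every vector is a unit vector; otherwise the answer is already no.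
theorem dirLoop_wp {σ : HState} (hk : σ.var 2 = k) (h6 : σ.var 6 = T.base) {vec : D → ℤ}
    (h5 : ∀ d, σ.arr 5 (T.ix d) = vec d) (h10 : ∀ j, σ.arr 10 j = 0) (h11 : ∀ j, σ.arr 11 j = 0) :
    dirLoop.wp I N κ (fun σ' => σ'.var 0 = (if ∀ d, T.IsDir (vec d) then σ.var 0 else 0) ∧
      (∀ d, σ'.arr 10 (T.ix d) = T.dir (vec d)) ∧
      ((∀ d, T.IsDir (vec d)) → ∀ (u : Fin n) (c : ℤ), 0 ≤ c → c < 8 →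
        (σ'.arr 11 (8 * (u : ℕ) + c) = 0 ↔
          ¬ ∃ e, T.tail e = u ∧ (c = T.dir (vec e) ∨ c = T.dir (vec e) + 4)))) σ := by
  have hbase := one_le_base (T := T)
  refine wp_dartLoop T hk H.loops H.k_le (by decide) (by decide)
    (fun j σ' => σ'.var 0 = (if ∀ d, (T.num d : ℕ) < j → T.IsDir (vec d) then σ.var 0 else 0) ∧
      (∀ d, (T.num d : ℕ) < j → σ'.arr 10 (T.ix d) = T.dir (vec d)) ∧
      (∀ d, ¬ (T.num d : ℕ) < j → σ'.arr 10 (T.ix d) = 0) ∧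
      (∀ (u : Fin n) (c : ℤ), 0 ≤ c → c < 8 →
        (σ'.arr 11 (8 * (u : ℕ) + c) = 0 ↔
          ¬ ∃ e, (T.num e : ℕ) < j ∧ T.IsDir (vec e) ∧ T.tail e = u ∧
            (c = T.dir (vec e) ∨ c = T.dir (vec e) + 4)))) ?_ ?_ ?_
  · refine ⟨?_, fun d hd => by omega, fun d _ => h10 _, fun u c _ _ => ?_⟩
    · rw [if_pos (fun d hd => by omega)]; simp [HState.setVar]
    · simp [HState.setVar, h11]
  · rintro d σ' hF ⟨i0, i1, i2, i3⟩ hv4 hv2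
    have hA5 : ∀ d, σ'.arr 5 (T.ix d) = vec d := by
      rw [hF.arr 5 (by decide)]; exact h5
    have hv6 : σ'.var 6 = T.base := (hF.var 6 (by decide)).trans h6
    have hall : (∀ e, (T.num e : ℕ) < T.num d + 1 → T.IsDir (vec e)) ↔
        T.IsDir (vec d) ∧ ∀ e, (T.num e : ℕ) < T.num d → T.IsDir (vec e) := by
      simp only [lt_succ_num]
      constructor
      · exact fun h => ⟨h d (Or.inl rfl), fun e he => h e (Or.inr he)⟩
      · rintro ⟨h1, h2⟩ e (rfl | he)
        · exact h1
        · exact h2 e he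
    -- The four successful branches re-establish the invariant in the same way.
    have key : ∀ c : ℤ, T.IsDir (vec d) → T.dir (vec d) = c → (record c).wp I N κ (fun σ'' =>
        (fun j σ' => σ'.var 0 = (if ∀ d, (T.num d : ℕ) < j → T.IsDir (vec d) then σ.var 0 else 0) ∧
          (∀ d, (T.num d : ℕ) < j → σ'.arr 10 (T.ix d) = T.dir (vec d)) ∧
          (∀ d, ¬ (T.num d : ℕ) < j → σ'.arr 10 (T.ix d) = 0) ∧
          (∀ (u : Fin n) (c : ℤ), 0 ≤ c → c < 8 →
            (σ'.arr 11 (8 * (u : ℕ) + c) = 0 ↔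
              ¬ ∃ e, (T.num e : ℕ) < j ∧ T.IsDir (vec e) ∧ T.tail e = u ∧
                (c = T.dir (vec e) ∨ c = T.dir (vec e) + 4)))) ((T.num d : ℕ) + 1)
          (σ''.setVar 4 (((T.num d : ℕ) + 1 : ℕ) : ℤ))) σ' := by
      intro c hd hdc
      have hc0 : 0 ≤ c := hdc ▸ T.dir_nonneg _
      have hc4 : c < 4 := hdc ▸ T.dir_lt _
      refine H.record_wp hv4 hc0 hc4 ⟨?_, ?_, ?_, ?_⟩
      · simp only [HState.setVar, HState.setArr, hall]
        rw [Function.update_of_ne (by decide), i0]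
        simp only [hd, true_and]
      · intro e he
        simp only [HState.setVar, HState.setArr, Function.update_apply]
        rcases lt_succ_num.1 he with rfl | he'
        · simp [hdc]
        · by_cases hed : e = d
          · subst hed; simp [hdc]
          · simp [hed, i1 e he']
      · intro e he
        simp only [HState.setVar, HState.setArr, Function.update_apply]
        have hed : e ≠ d := by rintro rfl; omega
        simp [hed, i2 e (by omega)]
      · intro u c' hc1 hc2
        have hi := i3 u c' hc1 hc2
        have hval : ((((σ'.setArr 10 (T.ix d) c).setArr 11 (8 * (T.tail d : ℕ) + c) 1).setArr 11
            (8 * (T.tail d : ℕ) + (c + 4)) 1).setVar 4 (((T.num d : ℕ) + 1 : ℕ) : ℤ)).arr 11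
              (8 * (u : ℕ) + c') = if 8 * ((u : ℕ) : ℤ) + c' = 8 * (T.tail d : ℕ) + (c + 4) then 1
              else if 8 * ((u : ℕ) : ℤ) + c' = 8 * (T.tail d : ℕ) + c then 1
              else σ'.arr 11 (8 * (u : ℕ) + c') := by
          simp [HState.setVar, HState.setArr, Function.update_apply]
        rw [hval]
        -- Since both offsets lie between 0 and 7, a cell is among the two just written exactly if
        -- vertex and direction match.
        by_cases h : T.tail d = u ∧ (c' = c ∨ c' = c + 4)
        · have hz : (8 * ((u : ℕ) : ℤ) + c' = 8 * ((T.tail d : ℕ) : ℤ) + (c + 4)) ∨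
              (8 * ((u : ℕ) : ℤ) + c' = 8 * ((T.tail d : ℕ) : ℤ) + c) := by
            rw [h.1]; omega
          constructor
          · intro h0; exfalso
            split_ifs at h0 with g1 g2 <;> first | exact one_ne_zero h0 | tauto
          · intro h0; exfalso
            exact h0 ⟨d, by omega, hd, h.1, by rw [hdc]; exact h.2⟩
        · rw [if_neg, if_neg, hi]
          · refine not_congr ⟨?_, ?_⟩
            · rintro ⟨e, he, h'⟩; exact ⟨e, by omega, h'⟩
            · rintro ⟨e, he, h'⟩
              rcases lt_succ_num.1 he with rfl | he'
              · exact absurd ⟨h'.2.1, by rw [← hdc]; exact h'.2.2⟩ h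
              · exact ⟨e, he', h'⟩
          · intro hh; apply h
            refine ⟨Fin.ext ?_, Or.inl ?_⟩ <;> omega
          · intro hh; apply h
            refine ⟨Fin.ext ?_, Or.inr ?_⟩ <;> omega
    simp only [Cmd.wp, Cond.lhs, Cond.rhs, Cond.Holds, Expr.eval, Expr.Ok, hv4, hv6, hA5,
      ix_nonneg, true_and]
    refine ⟨fun e1 => key 0 (Or.inl e1) (by simp [dir, e1]), fun e1 =>
      ⟨fun e2 => key 1 (Or.inr (Or.inl e2)) (by rw [dir, if_neg e1, if_pos e2]), fun e2 =>
        ⟨fun e3 => ?_, fun e3 => ⟨fun e4 => ?_, fun e4 => ?_⟩⟩⟩⟩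
    · rw [zero_sub] at e3
      exact key 2 (Or.inr (Or.inr (Or.inl e3))) (by rw [dir, if_neg e1, if_neg e2, if_pos e3])
    · rw [zero_sub] at e3
      exact key 3 (Or.inr (Or.inr (Or.inr e4)))
        (by rw [dir, if_neg e1, if_neg e2, if_neg e3, if_pos e4])
    · rw [zero_sub] at e3
      have hd : ¬ T.IsDir (vec d) := by unfold IsDir; tauto
      refine ⟨by simp, ?_, ?_, ?_, ?_⟩
      · rw [if_neg (fun h => hd (hall.1 h).1)]
        simp [HState.setVar]
      · intro e he
        rcases lt_succ_num.1 he with rfl | he'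
        · have : T.dir (vec e) = 0 := by rw [dir, if_neg e1, if_neg e2, if_neg e3, if_neg e4]
          rw [this]
          exact i2 e (lt_irrefl _)
        · exact i1 e he'
      · intro e he
        exact i2 e (by omega)
      · intro u c hc1 hc2
        refine (i3 u c hc1 hc2).trans (not_congr ⟨?_, ?_⟩)
        · rintro ⟨e, he, h⟩; exact ⟨e, by omega, h⟩
        · rintro ⟨e, he, h⟩
          rcases lt_succ_num.1 he with rfl | he'
          · exact absurd h.1 hd
          · exact ⟨e, he', h⟩
  · rintro σ' hF ⟨i0, i1, i2, i3⟩
    refine ⟨?_, fun d => i1 d (T.num d).isLt, fun hall u c hc1 hc2 => (i3 u c hc1 hc2).trans ?_⟩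
    · rw [i0]
      have : (∀ d, (T.num d : ℕ) < k → T.IsDir (vec d)) ↔ ∀ d, T.IsDir (vec d) :=
        ⟨fun h d => h d (T.num d).isLt, fun h d _ => h d⟩
      simp only [this]
    · refine not_congr ⟨?_, ?_⟩
      · rintro ⟨e, -, -, h⟩; exact ⟨e, h⟩
      · rintro ⟨e, h⟩; exact ⟨e, (T.num e).isLt, hall e, h⟩

open Classical in
theorem consistLoop_wp {σ : HState} (hk : σ.var 2 = k) {vec code : D → ℤ}
    (h5 : ∀ d, σ.arr 5 (T.ix d) = vec d) (h8 : ∀ d, σ.arr 8 (T.ix d) = code d) :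
    consistLoop.wp I N κ (fun σ' => σ'.var 0 =
      if ∀ d, T.Consistent vec code d then σ.var 0 else 0) σ := by
  refine H.checkLoop_wp hk (by decide) (by decide) fun d σ' hF hv4 hv2 => ?_
  have hA5 : ∀ d, σ'.arr 5 (T.ix d) = vec d := by rw [hF.arr 5 (by decide)]; exact h5
  have hA8 : ∀ d, σ'.arr 8 (T.ix d) = code d := by rw [hF.arr 8 (by decide)]; exact h8
  simp only [Cmd.wp, check, revE, rotE, Cond.lhs, Cond.rhs, Cond.Holds, Expr.eval, Expr.Ok, hv4, hv2,
    hA5, hA8, H.rev, H.rot, HState.setVar, ix_nonneg, num_nonneg₂, num_nonneg₃, Function.update_self,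
    Consistent, true_and, and_true, Function.update_of_ne (show (2 : ℕ) ≠ 0 by decide),
    Function.update_of_ne (show (4 : ℕ) ≠ 0 by decide)]
  split_ifs <;> simp_all

open Classical in
-- Directions lie between 0 and 3, so a left turn appears as a difference of 1 or, from direction 3
-- to direction 0, of −3.
theorem faceLoop_wp {σ : HState} (hn : σ.var 1 = n) (hk : σ.var 2 = k) (h6 : σ.var 6 = T.base)
    {vec : D → ℤ} (h1 : ∀ d, σ.arr 1 (T.ix d) = T.ix (T.next d))
    (h2 : ∀ d, σ.arr 2 (T.ix d) = 1 ↔ T.Outer d) (h5 : ∀ d, σ.arr 5 (T.ix d) = vec d)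
    (h10 : ∀ d, σ.arr 10 (T.ix d) = T.dir (vec d)) :
    faceLoop.wp I N κ (fun σ' => σ'.var 0 = if ∀ d, T.FaceOk vec d then σ.var 0 else 0) σ := by
  refine H.checkLoop_wp hk (by decide) (by decide) fun d σ' hF hv4 hv2 => ?_
  have hA1 : ∀ d, σ'.arr 1 (T.ix d) = T.ix (T.next d) := by rw [hF.arr 1 (by decide)]; exact h1
  have hA2 : ∀ d, σ'.arr 2 (T.ix d) = 1 ↔ T.Outer d := by rw [hF.arr 2 (by decide)]; exact h2
  have hA5 : ∀ d, σ'.arr 5 (T.ix d) = vec d := by rw [hF.arr 5 (by decide)]; exact h5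
  have hA10 : ∀ d, σ'.arr 10 (T.ix d) = T.dir (vec d) := by
    rw [hF.arr 10 (by decide)]; exact h10
  have hv1 : σ'.var 1 = n := (hF.var 1 (by decide)).trans hn
  have hv6 : σ'.var 6 = T.base := (hF.var 6 (by decide)).trans h6
  refine ⟨by simp [Cond.lhs, Expr.Ok, Expr.eval, hv4], by simp [Cond.rhs, Expr.Ok], ?_, ?_⟩
  · intro ho
    simp only [Cond.Holds, Expr.eval, hv4, hA2] at ho
    refine H.givenCmd_wp hv1 hv2 hv4 hv6 ho (check_wp ?_ trivial ?_ ?_)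
    · simp [Cond.lhs, Expr.Ok, Expr.eval, HState.setVar, hv4]
    · intro h
      simp only [Cond.Holds, Expr.eval, HState.setVar, Function.update_self, hA5,
        Function.update_of_ne (show (4 : ℕ) ≠ 10 by decide), hv4] at h
      rw [if_pos ⟨fun _ => h, fun h => absurd ho h⟩]
      simp [HState.setVar]
    · intro h
      simp only [Cond.Holds, Expr.eval, HState.setVar, Function.update_self, hA5,
        Function.update_of_ne (show (4 : ℕ) ≠ 10 by decide), hv4] at h
      rw [if_neg (fun hh => h (hh.1 ho))]
      simp [HState.setVar]
  · intro ho
    simp only [Cond.Holds, Expr.eval, hv4, hA2] at ho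
    have hN4 : (4 : ℤ) ≤ N := by
      have := H.base_le
      have hn : 0 < n := lt_of_le_of_lt (Nat.zero_le _) (T.tail T.out).isLt
      unfold base at this
      omega
    have b1 := T.dir_nonneg (vec d)
    have b2 := T.dir_lt (vec d)
    have b3 := T.dir_nonneg (vec (T.next d))
    have b4 := T.dir_lt (vec (T.next d))
    simp only [Cmd.wp, check, Cond.lhs, Cond.rhs, Cond.Holds, Expr.eval, Expr.Ok, hv4,
      hA1, hA10, HState.setVar, ix_nonneg, Function.update_self, FaceOk, ho, true_and, and_true,
      Function.update_of_ne (show (0 : ℕ) ≠ 9 by decide), false_imp_iff, not_false_iff,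
      true_imp_iff]
    refine ⟨by rw [abs_le]; constructor <;> omega, fun c => ?_, fun c => ⟨fun c' => ?_, fun c' =>
      ⟨fun c'' => ?_, fun c'' => ⟨by simp, ?_⟩⟩⟩⟩
    · rw [if_pos (by tauto)]
    · rw [if_pos (by tauto)]
    · rw [if_pos (by tauto)]
    · rw [if_neg (by tauto)]

end Setup

end Table

namespace Table

open UnitGrid.Prg UnitGrid.Cmd

variable {D : Type} {n k : ℕ} {T : Table D n k} {I : ℤ → ℤ} {N κ : ℕ}

/-- The vectors are the ones that are determined by the prescribed ones, the positions are
determined by the vectors. -/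
def Computed (T : Table D n k) (vec code : D → ℤ) : Prop :=
  (∃ S : Set D, (∀ d, T.Outer d → d ∈ S ∧ T.rev d ∈ S) ∧ (∀ d ∈ S, T.transport d ∈ S) ∧
    ∀ d ∈ S, T.VecDer d (vec d)) ∧
  ∃ S : Set D, T.out ∈ S ∧ (∀ d ∈ S, T.rev d ∈ S ∧ T.rot d ∈ S) ∧ ∀ d ∈ S, T.CodeDer vec d (code d)

/-- The entries of an array for the directions between a dart and its successor vanish. -/
def GapFree (T : Table D n k) (occ : ℤ → ℤ) (vec : D → ℤ) (d : D) : Prop :=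
  ∀ j : ℤ, 1 ≤ j → j < T.turn vec d → occ (8 * (T.tail d : ℕ) + T.dir (vec d) + j) = 0

namespace Setup

variable (H : T.Setup I N κ)
include H

open Classical in
theorem gap_wp {σ : HState} {Q : HState → Prop} {d : D} {j z : ℤ} (h4 : σ.var 4 = T.ix d)
    (h10 : σ.arr 10 (T.ix d) = z) (hz : 0 ≤ z) (hj : 0 ≤ j)
    (ht : (j < σ.var 9 → σ.arr 11 (8 * (T.tail d : ℕ) + z + j) = 0) → Q σ)
    (hf : ¬ (j < σ.var 9 → σ.arr 11 (8 * (T.tail d : ℕ) + z + j) = 0) → Q (σ.setVar 0 0)) :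
    (gap j).wp I N κ Q σ := by
  have ht' : (0 : ℤ) ≤ (T.tail d : ℕ) := by positivity
  simp only [gap, check, Cmd.wp, Cond.lhs, Cond.rhs, Cond.Holds, Expr.eval, Expr.Ok, eight_eval,
    eight_ok, tailE, h4, H.tail, h10, num_nonneg₁, ix_nonneg, true_and, and_true]
  refine ⟨fun h => ⟨by positivity, fun h' => ht fun _ => h', fun h' => ⟨by simp, hf fun hh => h' (hh h)⟩⟩,
    fun h => ht fun hh => absurd hh h⟩

open Classical in
theorem gap_wp' {σ : HState} {d : D} {j z : ℤ} (h4 : σ.var 4 = T.ix d)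
    (h10 : σ.arr 10 (T.ix d) = z) (hz : 0 ≤ z) (hj : 0 ≤ j) :
    (gap j).wp I N κ (fun σ' => (σ'.var 0 = if j < σ.var 9 →
        σ.arr 11 (8 * (T.tail d : ℕ) + z + j) = 0 then σ.var 0 else 0) ∧ σ'.var 4 = σ.var 4 ∧
      σ'.var 9 = σ.var 9 ∧ σ'.arr = σ.arr) σ := by
  refine H.gap_wp h4 h10 hz hj (fun h => ⟨by rw [if_pos h], rfl, rfl, rfl⟩)
    fun h => ⟨by rw [if_neg h]; simp [HState.setVar], ?_, ?_, rfl⟩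
  · simp [HState.setVar]
  · simp [HState.setVar]

open Classical in
-- The turn is at most 4, so only the offsets 1, 2 and 3 can lie strictly before it.
theorem rotLoop_wp {σ : HState} (hk : σ.var 2 = k) {vec : D → ℤ}
    (h10 : ∀ d, σ.arr 10 (T.ix d) = T.dir (vec d)) :
    rotLoop.wp I N κ (fun σ' => σ'.var 0 =
      if ∀ d, T.GapFree (σ.arr 11) vec d then σ.var 0 else 0) σ := by
  refine H.checkLoop_wp hk (by decide) (by decide) fun d σ' hF hv4 hv2 => ?_
  have hA10 : ∀ d, σ'.arr 10 (T.ix d) = T.dir (vec d) := by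
    rw [hF.arr 10 (by decide)]; exact h10
  have hA11 : σ'.arr 11 = σ.arr 11 := hF.arr 11 (by decide)
  have b1 := T.dir_nonneg (vec d)
  have b2 := T.dir_lt (vec d)
  have b3 := T.dir_nonneg (vec (T.rot d))
  have b4 := T.dir_lt (vec (T.rot d))
  have hN4 : (5 : ℤ) ≤ N := by
    have := H.base_le
    have hn : 0 < n := lt_of_le_of_lt (Nat.zero_le _) (T.tail T.out).isLt
    unfold base at this
    omega
  have hturn : T.turn vec d ≤ 4 := by unfold turn; split_ifs <;> omega
  have key : ∀ σ1 : HState, σ1.var 9 = T.turn vec d → σ1.var 4 = T.ix d → σ1.var 0 = σ'.var 0 →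
      σ1.arr = σ'.arr → (seq (gap 1) (seq (gap 2) (gap 3))).wp I N κ (fun σ'' => σ''.var 0 =
        if T.GapFree (σ.arr 11) vec d then σ'.var 0 else 0) σ1 := by
    intro σ1 e9 e4 e0 ea
    have hall : T.GapFree (σ.arr 11) vec d ↔
        (1 < T.turn vec d → σ.arr 11 (8 * (T.tail d : ℕ) + T.dir (vec d) + 1) = 0) ∧
        (2 < T.turn vec d → σ.arr 11 (8 * (T.tail d : ℕ) + T.dir (vec d) + 2) = 0) ∧
        (3 < T.turn vec d → σ.arr 11 (8 * (T.tail d : ℕ) + T.dir (vec d) + 3) = 0) := by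
      constructor
      · exact fun h => ⟨h 1 (by norm_num), h 2 (by norm_num), h 3 (by norm_num)⟩
      · rintro ⟨g1, g2, g3⟩ j hj hj'
        have : j = 1 ∨ j = 2 ∨ j = 3 := by omega
        rcases this with rfl | rfl | rfl
        · exact g1 hj'
        · exact g2 hj'
        · exact g3 hj'
    rw [if_congr hall rfl rfl]
    refine wp_seq (H.gap_wp' e4 (by rw [ea]; exact hA10 d) b1 (by norm_num)) fun σ2 _ h2 => ?_
    obtain ⟨f0, f4, f9, fa⟩ := h2
    rw [e4] at f4
    rw [e9] at f9 f0
    rw [ea] at fa f0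
    refine wp_seq (H.gap_wp' f4 (by rw [fa]; exact hA10 d) b1 (by norm_num)) fun σ3 _ h3 => ?_
    obtain ⟨g0, g4, g9, ga⟩ := h3
    rw [f4] at g4
    rw [f9] at g9 g0
    rw [fa] at ga g0
    refine wp_mono (H.gap_wp' g4 (by rw [ga]; exact hA10 d) b1 (by norm_num)) fun σ4 h4 => ?_
    obtain ⟨l0, -, -, -⟩ := h4
    rw [ga, g9] at l0
    rw [l0, g0, f0, hA11, e0]
    rw [← ite_and, ← ite_and]
    refine if_congr ⟨?_, ?_⟩ rfl rfl
    · rintro ⟨⟨a, b⟩, c⟩; exact ⟨c, b, a⟩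
    · rintro ⟨a, b, c⟩; exact ⟨⟨c, b⟩, a⟩
  refine ⟨?_, ?_, trivial, trivial, ?_, ?_⟩
  · simp [Expr.Ok, Expr.eval, rotE, hv4, hv2, num_nonneg₃, H.rot]
  · simp only [Expr.eval, rotE, hv4, hv2, H.rot, hA10]
    rw [abs_le]; constructor <;> omega
  · intro h
    simp only [Cond.Holds, Expr.eval, HState.setVar, Function.update_self, rotE, hv4, hv2, H.rot,
      hA10] at h
    refine key (σ'.setVar 9 _) ?_ (by simpa [HState.setVar] using hv4) (by simp [HState.setVar]) rfl
    simp only [Expr.eval, HState.setVar, Function.update_self, rotE, hv4, hv2, H.rot, hA10]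
    rw [turn, if_pos h]
  · intro h
    simp only [Cond.Holds, Expr.eval, HState.setVar, Function.update_self, rotE, hv4, hv2, H.rot,
      hA10] at h
    refine ⟨⟨trivial, trivial⟩, ?_, key ((σ'.setVar 9 _).setVar 9 _) ?_ (by simpa [HState.setVar] using hv4)
      (by simp [HState.setVar]) rfl⟩
    · simp only [Expr.eval, HState.setVar, Function.update_self, rotE, hv4, hv2, H.rot, hA10]
      rw [abs_le]; constructor <;> omega
    · simp only [Expr.eval, HState.setVar, Function.update_self, rotE, hv4, hv2, H.rot, hA10]
      rw [turn, if_neg h]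

open Classical in
-- A cell holds the tail plus one of the first dart with the corresponding position; zero means
-- empty. Comparing every later dart with this first one suffices because equality is transitive.
theorem injLoop_wp {σ : HState} (hk : σ.var 2 = k) {code : D → ℤ} {R : ℤ} (h7 : σ.var 7 = R)
    (h8 : ∀ d, σ.arr 8 (T.ix d) = code d) (hR : ∀ d, |code d| ≤ R) (h12 : ∀ j, σ.arr 12 j = 0) :
    injLoop.wp I N κ (fun σ' => σ'.var 0 = if T.InjOk code then σ.var 0 else 0) σ := by
  have hn := H.n_lt
  have htN : ∀ d, |((T.tail d : ℕ) : ℤ) + 1| ≤ N := fun d => by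
    have := (T.tail d).isLt
    rw [abs_of_nonneg (by positivity)]; omega
  refine wp_dartLoop T hk H.loops H.k_le (by decide) (by decide)
    (fun j σ' => σ'.var 0 = (if ∀ d e, (T.num d : ℕ) < j → (T.num e : ℕ) < j → code d = code e →
        T.tail d = T.tail e then σ.var 0 else 0) ∧
      (∀ d, (T.num d : ℕ) < j → σ'.arr 12 (code d + R) ≠ 0) ∧
      (∀ z, σ'.arr 12 z ≠ 0 → ∃ d, (T.num d : ℕ) < j ∧ code d + R = z ∧
        σ'.arr 12 z = (T.tail d : ℕ) + 1)) ?_ ?_ ?_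
  · refine ⟨?_, fun d hd => by omega, fun z hz => absurd (h12 z) hz⟩
    rw [if_pos (fun d e hd => by omega)]; simp [HState.setVar]
  · rintro d σ' hF ⟨i0, i1, i2⟩ hv4 hv2
    have hA8 : ∀ d, σ'.arr 8 (T.ix d) = code d := by rw [hF.arr 8 (by decide)]; exact h8
    have hv7 : σ'.var 7 = R := (hF.var 7 (by decide)).trans h7
    have hpos : 0 ≤ code d + R := by have := neg_abs_le (code d); have := hR d; omega
    have hbd : |σ'.arr 12 (code d + R)| ≤ N := by
      by_cases h : σ'.arr 12 (code d + R) = 0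
      · simp [h]
      · obtain ⟨e, -, -, he⟩ := i2 _ h
        rw [he]; exact htN e
    simp only [Cmd.wp, check, tailE, Cond.lhs, Cond.rhs, Cond.Holds, Expr.eval, Expr.Ok, hv4, hv7,
      hA8, H.tail, HState.setVar, HState.setArr, ix_nonneg, num_nonneg₁, Function.update_self,
      true_and, and_true, Function.update_of_ne (show (7 : ℕ) ≠ 9 by decide),
      Function.update_of_ne (show (4 : ℕ) ≠ 9 by decide),
      Function.update_of_ne (show (0 : ℕ) ≠ 9 by decide),
      Function.update_of_ne (show (0 : ℕ) ≠ 4 by decide), hpos, hbd, htN]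
    refine ⟨fun h0 => ⟨?_, ?_, ?_⟩, fun h0 => ⟨fun h1 => ⟨?_, ?_, ?_⟩, fun h1 => ⟨by simp, ?_, ?_, ?_⟩⟩⟩
    · rw [i0]
      -- An empty cell means that no earlier dart has this position, so no new comparison arises.
      have hne : ∀ e, (T.num e : ℕ) < T.num d → code e ≠ code d := fun e he hc =>
        i1 e he (by rw [hc]; exact h0)
      refine if_congr ⟨fun h e e' he he' => ?_, fun h e e' he he' => h e e' (by omega) (by omega)⟩
        rfl rfl
      rcases lt_succ_num.1 he with rfl | he1 <;> rcases lt_succ_num.1 he' with rfl | he1'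
      · exact fun _ => rfl
      · exact fun hc => absurd hc.symm (hne _ he1')
      · exact fun hc => absurd hc (hne _ he1)
      · exact h e e' he1 he1'
    · intro e he
      rw [Function.update_apply]
      split_ifs with hc
      · have : (0 : ℤ) ≤ (T.tail d : ℕ) := by positivity
        omega
      · rcases lt_succ_num.1 he with rfl | he1
        · exact absurd rfl hc
        · exact i1 e he1
    · intro z
      rw [Function.update_apply]
      split_ifs with hc
      · exact fun _ => ⟨d, by omega, hc.symm, rfl⟩
      · intro hz
        obtain ⟨e, he, h⟩ := i2 z hz
        exact ⟨e, by omega, h⟩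
    · rw [i0]
      obtain ⟨e₀, he₀, hc₀, ht₀⟩ := i2 _ h0
      have hte : T.tail e₀ = T.tail d := by
        apply Fin.ext; rw [h1] at ht₀; omega
      have hc₀' : code e₀ = code d := by omega
      refine if_congr ⟨fun h e e' he he' => ?_, fun h e e' he he' => h e e' (by omega) (by omega)⟩
        rfl rfl
      rcases lt_succ_num.1 he with rfl | he1 <;> rcases lt_succ_num.1 he' with rfl | he1'
      · exact fun _ => rfl
      · exact fun hc => hte.symm.trans (h _ _ he₀ he1' (hc₀'.trans hc))
      · exact fun hc => (h _ _ he1 he₀ (hc.trans hc₀'.symm)).trans hte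
      · exact h e e' he1 he1'
    · intro e he
      rcases lt_succ_num.1 he with rfl | he1
      · exact h0
      · exact i1 e he1
    · intro z hz
      obtain ⟨e, he, h⟩ := i2 z hz
      exact ⟨e, by omega, h⟩
    · obtain ⟨e₀, he₀, hc₀, ht₀⟩ := i2 _ h0
      rw [if_neg]
      intro h
      apply h1
      rw [ht₀, h e₀ d (by omega) (by omega) (by omega)]
    · intro e he
      rcases lt_succ_num.1 he with rfl | he1
      · exact h0
      · exact i1 e he1
    · intro z hz
      obtain ⟨e, he, h⟩ := i2 z hz
      exact ⟨e, by omega, h⟩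
  · rintro σ' hF ⟨i0, -, -⟩
    rw [i0]
    exact if_congr ⟨fun h d e => h d e (T.num d).isLt (T.num e).isLt, fun h d e _ _ => h d e⟩ rfl rfl

open Classical in
-- The frames carry the tables from the loop that computes them to the loops that use them, and show
-- that an array is still zero when its first writer starts.
theorem main_wp {σ : HState} (hn : σ.var 1 = n) (hk : σ.var 2 = k) (h8 : σ.var 8 = 0)
    (h11 : σ.var 11 = 0) (ha : ∀ a j, σ.arr a j = 0) :
    main.wp I N κ (fun σ' => ∃ vec code : D → ℤ, T.Computed vec code ∧
      σ'.var 0 = if T.Accepts vec code then 1 else 0) σ := by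
  have hb1 := one_le_base (T := T)
  refine wp_seq (H.rotSymmLoop_wp hk) fun σ1 F1 p1 => ?_
  have k1 : σ1.var 2 = k := (F1.var 2 (by decide)).trans hk
  refine wp_seq (H.nextLoop_wp k1 p1) fun σ2 F2 p2 => ?_
  have k2 : σ2.var 2 = k := (F2.var 2 (by decide)).trans k1
  refine wp_seq (H.outerLoop_wp k2 p2 ?_) fun σ3 F3 p3 => ?_
  · rw [F2.arr 2 (by decide), F1.arr 2 (by decide)]; exact ha 2
  have k3 : σ3.var 2 = k := (F3.var 2 (by decide)).trans k2
  have n3 : σ3.var 1 = n := by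
    rw [F3.var 1 (by decide), F2.var 1 (by decide), F1.var 1 (by decide), hn]
  have q3 : ∀ d, σ3.arr 1 (T.ix d) = T.ix (T.next d) := by rw [F3.arr 1 (by decide)]; exact p2
  refine wp_seq (H.transportLoop_wp k3 q3 p3) fun σ4 F4 p4 => ?_
  have k4 : σ4.var 2 = k := (F4.var 2 (by decide)).trans k3
  have n4 : σ4.var 1 = n := (F4.var 1 (by decide)).trans n3
  refine ⟨by simp [Expr.Ok], ?_, ?_⟩
  · simp only [Expr.eval, n4]
    have := H.base_le
    unfold base at this
    rw [abs_of_nonneg (by positivity)]; exact this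
  set σ5 := σ4.setVar 6 ((Expr.add (.add (.add (.add (.var 1) (.var 1)) (.var 1)) (.var 1))
    (.lit 1)).eval I σ4) with hσ5
  have b5 : σ5.var 6 = T.base := by
    simp [hσ5, HState.setVar, Expr.eval, n4, base]
  have k5 : σ5.var 2 = k := by simpa [hσ5, HState.setVar] using k4
  have n5 : σ5.var 1 = n := by simpa [hσ5, HState.setVar] using n4
  have v5 : ∀ x, x = 8 ∨ x = 11 → σ5.var x = 0 := by
    intro x hx
    have e5 : σ5.var x = σ4.var x := by
      simp only [hσ5, HState.setVar]; rw [Function.update_of_ne (by omega)]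
    rw [e5]
    rcases hx with rfl | rfl
    · rw [F4.var 8 (by decide), F3.var 8 (by decide), F2.var 8 (by decide), F1.var 8 (by decide), h8]
    · rw [F4.var 11 (by decide), F3.var 11 (by decide), F2.var 11 (by decide),
        F1.var 11 (by decide), h11]
  have a5 : ∀ a, a ∉ main.modArr ∨ (a ∈ [4, 5, 7, 8, 10, 11, 12]) → ∀ j, σ5.arr a j = 0 := by
    intro a h j
    have e5 : σ5.arr a = σ4.arr a := rfl
    have hne : a ≠ 0 ∧ a ≠ 1 ∧ a ≠ 2 ∧ a ≠ 3 := by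
      rcases h with h | h
      · refine ⟨?_, ?_, ?_, ?_⟩ <;> rintro rfl <;> exact h (by decide)
      · refine ⟨?_, ?_, ?_, ?_⟩ <;> rintro rfl <;> exact absurd h (by decide)
    rw [e5, F4.arr a, F3.arr a, F2.arr a, F1.arr a, ha]
    all_goals simp [rotSymmLoop, nextLoop, outerLoop, transportLoop, modArr, hne]
  have q5 : ∀ d, σ5.arr 1 (T.ix d) = T.ix (T.next d) := by
    change ∀ d, σ4.arr 1 (T.ix d) = _
    rw [F4.arr 1 (by decide)]; exact q3
  have o5 : ∀ d, σ5.arr 2 (T.ix d) = 1 ↔ T.Outer d := by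
    change ∀ d, σ4.arr 2 (T.ix d) = 1 ↔ _
    rw [F4.arr 2 (by decide)]; exact p3
  have p5 : ∀ d, σ5.arr 3 (T.ix d) = T.ix (T.transport d) := p4
  clear_value σ5
  refine wp_seq (H.seedLoop_wp n5 k5 b5 o5 (a5 4 (by simp)) (a5 5 (by simp)) (v5 8 (by simp)))
    fun σ6 F6 => ?_
  rintro ⟨l₀, hl₀, hs⟩
  have k6 : σ6.var 2 = k := (F6.var 2 (by decide)).trans k5
  refine wp_seq (H.vecLoop_wp k6 (by
    rw [F6.arr 3 (by decide)]; exact p5) hl₀) fun σ7 F7 => ?_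
  rintro ⟨l, hl, hp, hc⟩
  have k7 : σ7.var 2 = k := (F7.var 2 (by decide)).trans k6
  set vec : D → ℤ := fun d => σ7.arr 5 (T.ix d) with hvec
  have hvecb : ∀ d, |vec d| ≤ T.base := by
    intro d
    by_cases hd : d ∈ l
    · obtain ⟨j, -, h⟩ := hl.val_of_mem hd
      exact h.abs_le H
    -- A dart that was never reached keeps the value zero. This is not the word of a unit vector, so
    -- such a candidate is rejected later.
    · rw [hvec]; simp only [(hl.notMem d hd).2, abs_zero]; omega
  have z7 : ∀ a ∈ [7, 8, 10, 11, 12], ∀ j, σ7.arr a j = 0 := by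
    intro a h j
    have hne : a ≠ 4 ∧ a ≠ 5 ∧ a ≠ 6 := by
      refine ⟨?_, ?_, ?_⟩ <;> rintro rfl <;> exact absurd h (by decide)
    rw [F7.arr a, F6.arr a, a5 a (Or.inr (by simp at h ⊢; tauto))]
    all_goals simp [seedLoop, vecLoop, givenCmd, visit, modArr, hne]
  refine wp_seq (H.codeLoop_wp k7 (vec := vec) (fun _ => rfl) hvecb (z7 7 (by simp)) (z7 8 (by simp))
    (by rw [F7.var 11 (by decide), F6.var 11 (by decide)]; exact v5 11 (by simp))) fun σ8 F8 => ?_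
  rintro ⟨l', hl', ho', hc'⟩
  have k8 : σ8.var 2 = k := (F8.var 2 (by decide)).trans k7
  have b8 : σ8.var 6 = T.base := by
    rw [F8.var 6 (by decide), F7.var 6 (by decide), F6.var 6 (by decide), b5]
  set code : D → ℤ := fun d => σ8.arr 8 (T.ix d) with hcode
  have hcodeb : ∀ d, |code d| ≤ (k + 1 : ℕ) * T.base := by
    intro d
    by_cases hd : d ∈ l'
    · obtain ⟨j, hj, h⟩ := hl'.val_of_mem hd
      refine h.2.trans (mul_le_mul_of_nonneg_right ?_ (by omega))
      have := T.length_le_of_nodup hl'.nodup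
      exact_mod_cast (by omega)
    · rw [hcode]; simp only [(hl'.notMem d hd).2, abs_zero]; positivity
  refine wp_seq (H.radiusLoop_wp k8 b8) fun σ9 F9 p9 => ?_
  have k9 : σ9.var 2 = k := (F9.var 2 (by decide)).trans k8
  refine ⟨trivial, ?_, ?_⟩
  · have := H.n_lt
    simp only [Expr.eval, abs_one]; omega
  simp only [Expr.eval]
  have r10 : (σ9.setVar 0 1).var 0 = 1 := by simp [HState.setVar]
  have k10 : (σ9.setVar 0 1).var 2 = k := by simpa [HState.setVar] using k9
  have g10 : (σ9.setVar 0 1).var 7 = (k + 1 : ℕ) * T.base := by simpa [HState.setVar] using p9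
  have b10 : (σ9.setVar 0 1).var 6 = T.base := by
    simp only [HState.setVar]; rw [Function.update_of_ne (by decide), F9.var 6 (by decide), b8]
  have n10 : (σ9.setVar 0 1).var 1 = n := by
    simp only [HState.setVar]
    rw [Function.update_of_ne (by decide), F9.var 1 (by decide), F8.var 1 (by decide),
      F7.var 1 (by decide), F6.var 1 (by decide), n5]
  have ar : ∀ a, (σ9.setVar 0 1).arr a = σ9.arr a := fun _ => rfl
  generalize hσ10 : σ9.setVar 0 1 = σ10 at r10 k10 g10 b10 n10 ar
  have ea : ∀ a, σ10.arr a = σ8.arr a := fun a => by rw [ar, F9.arr a (by simp [radiusLoop, modArr])]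
  have v10 : ∀ d, σ10.arr 5 (T.ix d) = vec d := by
    rw [ea, F8.arr 5 (by decide)]; exact fun _ => rfl
  have c10 : ∀ d, σ10.arr 8 (T.ix d) = code d := by rw [ea]; exact fun _ => rfl
  have z10 : ∀ a ∈ [10, 11, 12], ∀ j, σ10.arr a j = 0 := by
    intro a h j
    have hne : a ≠ 7 ∧ a ≠ 8 ∧ a ≠ 9 := by
      refine ⟨?_, ?_, ?_⟩ <;> rintro rfl <;> exact absurd h (by decide)
    rw [ea, F8.arr a, z7 a (by simp at h ⊢; tauto)]
    simp [codeLoop, visit, modArr, hne]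
  have q10 : ∀ d, σ10.arr 1 (T.ix d) = T.ix (T.next d) := by
    rw [ea, F8.arr 1 (by decide), F7.arr 1 (by decide), F6.arr 1 (by decide)]; exact q5
  have o10 : ∀ d, σ10.arr 2 (T.ix d) = 1 ↔ T.Outer d := by
    rw [ea, F8.arr 2 (by decide), F7.arr 2 (by decide), F6.arr 2 (by decide)]; exact o5
  refine wp_seq (H.dirLoop_wp k10 b10 v10 (z10 10 (by simp)) (z10 11 (by simp))) fun σ11 F11 => ?_
  rintro ⟨p11, d11, t11⟩
  have k11 : σ11.var 2 = k := (F11.var 2 (by decide)).trans k10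
  have v11 : ∀ d, σ11.arr 5 (T.ix d) = vec d := by rw [F11.arr 5 (by decide)]; exact v10
  have c11 : ∀ d, σ11.arr 8 (T.ix d) = code d := by rw [F11.arr 8 (by decide)]; exact c10
  refine wp_seq (H.consistLoop_wp k11 v11 c11) fun σ12 F12 p12 => ?_
  have k12 : σ12.var 2 = k := (F12.var 2 (by decide)).trans k11
  refine wp_seq (H.faceLoop_wp (vec := vec) ?_ k12 ?_ ?_ ?_ ?_ ?_) fun σ13 F13 p13 => ?_
  · rw [F12.var 1 (by decide), F11.var 1 (by decide)]; exact n10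
  · rw [F12.var 6 (by decide), F11.var 6 (by decide)]; exact b10
  · rw [F12.arr 1 (by decide), F11.arr 1 (by decide)]; exact q10
  · rw [F12.arr 2 (by decide), F11.arr 2 (by decide)]; exact o10
  · rw [F12.arr 5 (by decide)]; exact v11
  · rw [F12.arr 10 (by decide)]; exact d11
  have k13 : σ13.var 2 = k := (F13.var 2 (by decide)).trans k12
  have a13 : ∀ a, σ13.arr a = σ11.arr a := fun a => by
    rw [F13.arr a (by simp [faceLoop, givenCmd, check, modArr]),
      F12.arr a (by simp [consistLoop, check, modArr])]
  refine wp_seq (H.rotLoop_wp (vec := vec) k13 (by rw [a13]; exact d11)) fun σ14 F14 p14 => ?_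
  have k14 : σ14.var 2 = k := (F14.var 2 (by decide)).trans k13
  refine wp_mono (H.injLoop_wp (R := (k + 1 : ℕ) * T.base) (code := code) k14 ?_ ?_ hcodeb ?_)
    fun σ15 p15 => ?_
  · rw [F14.var 7 (by decide), F13.var 7 (by decide), F12.var 7 (by decide), F11.var 7 (by decide)]
    exact g10
  · rw [F14.arr 8 (by decide), a13]; exact c11
  · rw [F14.arr 12 (by decide), a13, F11.arr 12 (by decide)]; exact z10 12 (by simp)
  refine ⟨vec, code, ⟨⟨{d | d ∈ l}, ?_, hc, ?_⟩, {d | d ∈ l'}, ho', hc', ?_⟩, ?_⟩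
  · exact fun d hd => ⟨hp.subset (hs d hd).1, hp.subset (hs d hd).2⟩
  · intro d hd
    obtain ⟨j, -, h⟩ := hl.val_of_mem hd
    exact h
  · intro d hd
    obtain ⟨j, -, h⟩ := hl'.val_of_mem hd
    exact h.1
  · rw [p15, p14, p13, p12, p11, r10]
    -- The table of occurring directions is meaningful only if all vectors are unit vectors; in the
    -- other case the answer is no regardless.
    by_cases hdir : ∀ d, T.IsDir (vec d)
    · have hrot : (∀ d, T.GapFree (σ13.arr 11) vec d) ↔ ∀ d, T.RotOk vec d := by
        refine forall_congr' fun d => forall_congr' fun j => forall_congr' fun hj =>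
          forall_congr' fun hj' => ?_
        have b1 := T.dir_nonneg (vec d)
        have b2 := T.dir_lt (vec d)
        have b4 := T.dir_lt (vec (T.rot d))
        have hturn : T.turn vec d ≤ 4 := by unfold turn; split_ifs <;> omega
        rw [a13, add_assoc]
        exact t11 hdir (T.tail d) (T.dir (vec d) + j) (by omega) (by omega)
      rw [if_congr hrot rfl rfl]
      unfold Accepts
      by_cases e1 : ∀ d, T.Consistent vec code d <;> by_cases e2 : ∀ d, T.FaceOk vec d <;>
        by_cases e3 : ∀ d, T.RotOk vec d <;> by_cases e4 : T.InjOk code <;>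
        simp only [hdir, e1, e2, e3, e4, implies_true, if_true, if_false, and_true, and_false]
    · have : ¬ T.Accepts vec code := fun h => hdir h.1
      simp only [hdir, this, if_false, ite_self]

end Setup

end Table

/-! ### Faces of a drawing -/

theorem int_sq_add_sq_eq_one {a b : ℤ} (h : a ^ 2 + b ^ 2 = 1) :
    (a = 1 ∧ b = 0) ∨ (a = -1 ∧ b = 0) ∨ (a = 0 ∧ b = 1) ∨ (a = 0 ∧ b = -1) := by
  have h1 : a ≤ 1 := by nlinarith
  have h2 : -1 ≤ a := by nlinarith
  have h3 : b ≤ 1 := by nlinarith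
  have h4 : -1 ≤ b := by nlinarith
  interval_cases a <;> interval_cases b <;> simp_all

theorem int_eq_zero_of_abs_lt_one {a : ℤ} (h1 : (-1 : ℝ) < a) (h2 : (a : ℝ) < 1) : a = 0 := by
  have h3 : -1 < a := by exact_mod_cast h1
  have h4 : a < 1 := by exact_mod_cast h2
  omega

/-- A grid vector of length one. -/
def IsUnitVec (w : ℤ × ℤ) : Prop := w.1 ^ 2 + w.2 ^ 2 = 1

theorem IsUnitVec.quarterTurn {w : ℤ × ℤ} (h : IsUnitVec w) : IsUnitVec (quarterTurn w) := by
  unfold IsUnitVec UnitGrid.quarterTurn at *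
  simp only; linarith [neg_sq w.2]

theorem IsUnitVec.iterate {w : ℤ × ℤ} (h : IsUnitVec w) (k : ℕ) : IsUnitVec (UnitGrid.quarterTurn^[k] w) := by
  induction k with
  | zero => exact h
  | succ k ih => rw [Function.iterate_succ_apply']; exact ih.quarterTurn

theorem quarterTurn_quarterTurn (w : ℤ × ℤ) : quarterTurn (quarterTurn w) = -w := by
  simp [quarterTurn, Prod.ext_iff]

section Drawing

variable {n : ℕ} {G : SimpleGraph (Fin n)} {pos : Fin n → ℤ × ℤ}

theorem pos_snd (pos : Fin n → ℤ × ℤ) (d : G.Dart) : pos d.snd = pos d.fst + dartVec pos d := by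
  simp [dartVec]

@[simp] theorem dartVec_symm (d : G.Dart) : dartVec pos d.symm = -dartVec pos d := by
  simp [dartVec]

theorem IsUnitGridDrawing.isUnitVec (h : IsUnitGridDrawing G pos) (d : G.Dart) :
    IsUnitVec (dartVec pos d) := by
  have := h.2 d.fst d.snd d.adj
  unfold UnitDist at this
  unfold IsUnitVec dartVec
  simp only [Prod.fst_sub, Prod.snd_sub]
  nlinarith

theorem dart_eq_of_ends {d e : G.Dart} (h1 : d.fst = e.fst) (h2 : d.snd = e.snd) : d = e :=
  SimpleGraph.Dart.ext _ _ (Prod.ext h1 h2)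

theorem IsUnitGridDrawing.dart_ext (h : IsUnitGridDrawing G pos) {d e : G.Dart}
    (h1 : pos d.fst = pos e.fst) (h2 : dartVec pos d = dartVec pos e) : d = e := by
  refine dart_eq_of_ends (h.1 h1) (h.1 ?_)
  rw [pos_snd pos d, pos_snd pos e, h1, h2]

theorem mem_drawnSet {q : ℝ × ℝ} : q ∈ drawnSet G pos ↔ ∃ (d : G.Dart) (t : ℝ), 0 ≤ t ∧ t ≤ 1 ∧
    q = ((pos d.fst).1 + t * (dartVec pos d).1, (pos d.fst).2 + t * (dartVec pos d).2) := by
  unfold drawnSet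
  simp only [Set.mem_iUnion, segment_eq_image', Set.mem_image, Set.mem_Icc]
  refine exists_congr fun d => exists_congr fun t => ?_
  rw [and_assoc]
  refine and_congr_right fun _ => and_congr_right fun _ => ?_
  have : toPlane (pos d.fst) + t • (toPlane (pos d.snd) - toPlane (pos d.fst)) =
      ((pos d.fst).1 + t * (dartVec pos d).1, (pos d.fst).2 + t * (dartVec pos d).2) := by
    simp [toPlane, dartVec]
  rw [this, eq_comm]

/-- The centre of the unit square at the grid point `p` between the directions `w` and
`quarterTurn w`. -/
noncomputable def quadCentre (p w : ℤ × ℤ) : ℝ × ℝ :=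
  (p.1 + w.1 / 2 - w.2 / 2, p.2 + w.2 / 2 + w.1 / 2)

theorem leftCentre_eq (d : G.Dart) :
    leftCentre pos d = quadCentre (pos d.fst) (dartVec pos d) := by
  unfold leftCentre quadCentre
  rw [pos_snd pos d]
  simp only [toPlane, quarterTurn, Prod.fst_add, Prod.snd_add, Prod.mk_add_mk, Prod.smul_mk,
    smul_eq_mul, Int.cast_add, Int.cast_neg]
  ext <;> simp only <;> ring

theorem leftCentre_eq_snd (d : G.Dart) :
    leftCentre pos d = quadCentre (pos d.snd) (quarterTurn (dartVec pos d)) := by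
  rw [leftCentre_eq, pos_snd pos d]
  simp only [quadCentre, quarterTurn, Prod.fst_add, Prod.snd_add, Int.cast_add, Int.cast_neg]
  ext <;> simp only <;> ring

/-- The points lie on the segment joining the centres of the two squares on both sides of the grid
edge from `p` in direction `quarterTurn w`. The only grid edge that meets this segment is that one,
at its midpoint. -/
theorem crossing_notMem_drawnSet (h : IsUnitGridDrawing G pos) {p w : ℤ × ℤ} (hw : IsUnitVec w)
    (hno : ∀ e : G.Dart, pos e.fst = p → dartVec pos e ≠ quarterTurn w) {s : ℝ} (hs : |s| ≤ 1 / 2) :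
    ((p.1 - w.2 / 2 + s * w.1, p.2 + w.1 / 2 + s * w.2) : ℝ × ℝ) ∉ drawnSet G pos := by
  rw [mem_drawnSet]
  rintro ⟨d, t, h0, h1, he⟩
  have hu := h.isUnitVec d
  set u := dartVec pos d with hud
  unfold IsUnitVec at hu hw
  simp only [Prod.mk.injEq] at he
  obtain ⟨e1, e2⟩ := he
  obtain ⟨s1, s2⟩ := abs_le.1 hs
  have hwR : (w.1 : ℝ) ^ 2 + (w.2 : ℝ) ^ 2 = 1 := by exact_mod_cast hw
  set a := pos d.fst - p with ha
  have ha1 : (pos d.fst).1 = p.1 + a.1 := by simp [ha]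
  have ha2 : (pos d.fst).2 = p.2 + a.2 := by simp [ha]
  rw [ha1] at e1
  rw [ha2] at e2
  push_cast at e1 e2
  -- Pass to the orthonormal frame of `w` and `quarterTurn w`: A, B are the coordinates of the tail
  -- relative to `p`, and U, V those of the dart. The point has coordinates s and 1/2.
  have hA : ((a.1 * w.1 + a.2 * w.2 : ℤ) : ℝ) + t * ((u.1 * w.1 + u.2 * w.2 : ℤ) : ℝ) = s := by
    push_cast
    linear_combination -(w.1 : ℝ) * e1 - (w.2 : ℝ) * e2 + s * hwR
  have hB : ((a.2 * w.1 - a.1 * w.2 : ℤ) : ℝ) + t * ((u.2 * w.1 - u.1 * w.2 : ℤ) : ℝ) = 1 / 2 := by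
    push_cast
    linear_combination (w.2 : ℝ) * e1 - (w.1 : ℝ) * e2 + 1 / 2 * hwR
  have hUV : (u.1 * w.1 + u.2 * w.2) ^ 2 + (u.2 * w.1 - u.1 * w.2) ^ 2 = 1 := by
    linear_combination (w.1 ^ 2 + w.2 ^ 2) * hu + hw
  have hu1 : u.1 = (u.1 * w.1 + u.2 * w.2) * w.1 - (u.2 * w.1 - u.1 * w.2) * w.2 := by
    linear_combination -u.1 * hw
  have hu2 : u.2 = (u.1 * w.1 + u.2 * w.2) * w.2 + (u.2 * w.1 - u.1 * w.2) * w.1 := by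
    linear_combination -u.2 * hw
  have ha1' : a.1 = (a.1 * w.1 + a.2 * w.2) * w.1 - (a.2 * w.1 - a.1 * w.2) * w.2 := by
    linear_combination -a.1 * hw
  have ha2' : a.2 = (a.1 * w.1 + a.2 * w.2) * w.2 + (a.2 * w.1 - a.1 * w.2) * w.1 := by
    linear_combination -a.2 * hw
  generalize a.1 * w.1 + a.2 * w.2 = A at *
  generalize a.2 * w.1 - a.1 * w.2 = B at *
  generalize u.1 * w.1 + u.2 * w.2 = U at *
  generalize u.2 * w.1 - u.1 * w.2 = V at *
  have half : ∀ B : ℤ, (B : ℝ) ≠ 1 / 2 := by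
    intro B hB
    have h2 : (2 : ℝ) * B = 1 := by linarith
    have : 2 * B = 1 := by exact_mod_cast h2
    omega
  -- A dart parallel to `w` has integral height, never 1/2. A perpendicular one has integral
  -- abscissa s, hence s = 0, and then the dart or its reverse is the excluded edge at `p`.
  rcases int_sq_add_sq_eq_one hUV with ⟨rfl, rfl⟩ | ⟨rfl, rfl⟩ | ⟨rfl, rfl⟩ | ⟨rfl, rfl⟩
  · exact half B (by simpa using hB)
  · exact half B (by simpa using hB)
  · simp only [Int.cast_zero, Int.cast_one, mul_zero, mul_one, add_zero] at hA hB
    have hA0 : A = 0 := int_eq_zero_of_abs_lt_one (by linarith) (by linarith)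
    have hB0 : B = 0 := int_eq_zero_of_abs_lt_one (by linarith) (by linarith)
    subst hA0 hB0
    refine hno d ?_ ?_
    · ext
      · rw [ha1, ha1']; ring
      · rw [ha2, ha2']; ring
    · rw [← hud]
      ext
      · rw [hu1]; simp [quarterTurn]
      · rw [hu2]; simp [quarterTurn]
  · simp only [Int.cast_zero, Int.cast_one, Int.cast_neg, mul_zero, mul_neg, mul_one, add_zero] at hA hB
    have hA0 : A = 0 := int_eq_zero_of_abs_lt_one (by linarith) (by linarith)
    have hB0 : B - 1 = 0 := int_eq_zero_of_abs_lt_one (by push_cast; linarith) (by push_cast; linarith)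
    obtain rfl : B = 1 := by omega
    subst hA0
    refine hno d.symm ?_ ?_
    · change pos d.snd = p
      rw [pos_snd pos d, ← hud]
      ext
      · simp only [Prod.fst_add]; rw [ha1, ha1', hu1]; ring
      · simp only [Prod.snd_add]; rw [ha2, ha2', hu2]; ring
    · rw [dartVec_symm, ← hud]
      ext
      · simp only [Prod.fst_neg]; rw [hu1]; simp [quarterTurn]
      · simp only [Prod.snd_neg]; rw [hu2]; simp [quarterTurn]

theorem component_quarterTurn (h : IsUnitGridDrawing G pos) {p w : ℤ × ℤ} (hw : IsUnitVec w)
    (hno : ∀ e : G.Dart, pos e.fst = p → dartVec pos e ≠ quarterTurn w) :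
    connectedComponentIn (drawnSet G pos)ᶜ (quadCentre p w) =
      connectedComponentIn (drawnSet G pos)ᶜ (quadCentre p (quarterTurn w)) := by
  apply connectedComponentIn_eq
  have hsub : segment ℝ (quadCentre p w) (quadCentre p (quarterTurn w)) ⊆ (drawnSet G pos)ᶜ := by
    rw [segment_eq_image']
    rintro _ ⟨t, ⟨h0, h1⟩, rfl⟩
    have := crossing_notMem_drawnSet h hw hno (s := 1 / 2 - t) (by rw [abs_le]; constructor <;> linarith)
    convert this using 2
    simp only [quadCentre, quarterTurn, Int.cast_neg]
    ext <;> simp <;> ring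
  exact (convex_segment _ _).isPreconnected.subset_connectedComponentIn (left_mem_segment _ _ _) hsub
    (right_mem_segment _ _ _)

theorem component_iterate (h : IsUnitGridDrawing G pos) {p w : ℤ × ℤ} (hw : IsUnitVec w) {k : ℕ}
    (hno : ∀ e : G.Dart, pos e.fst = p → ∀ j, 1 ≤ j → j ≤ k → dartVec pos e ≠ quarterTurn^[j] w) :
    connectedComponentIn (drawnSet G pos)ᶜ (quadCentre p w) =
      connectedComponentIn (drawnSet G pos)ᶜ (quadCentre p (quarterTurn^[k] w)) := by
  induction k with
  | zero => rfl
  | succ k ih =>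
    rw [ih fun e he j h1 h2 => hno e he j h1 (by omega), Function.iterate_succ_apply']
    refine component_quarterTurn h (hw.iterate k) fun e he => ?_
    have := hno e he (k + 1) (by omega) le_rfl
    rwa [Function.iterate_succ_apply'] at this

end Drawing

section Plane

variable {n : ℕ} {G : PlaneGraph n} {pos : Fin n → ℤ × ℤ}

theorem PlaneGraph.rot_faceNext (G : PlaneGraph n) (d : G.graph.Dart) :
    G.rot (faceNext G.graph G.rot d) = d.symm := by
  simp [faceNext]

theorem PlaneGraph.rot_fst (G : PlaneGraph n) (d : G.graph.Dart) : (G.rot d).fst = d.fst :=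
  ((G.rot_sameCycle d (G.rot d)).1 (Equiv.Perm.SameCycle.refl _ _ |>.apply_right)).symm

theorem PlaneGraph.faceNext_fst (G : PlaneGraph n) (d : G.graph.Dart) :
    (faceNext G.graph G.rot d).fst = d.snd := by
  rw [← G.rot_fst, G.rot_faceNext]; rfl

/-- The left sides of `d` and of the next dart are two sectors at the head of `d`. Turning
counterclockwise from the next dart, the first edge met is `d` reversed, so the sectors in between
belong to one face. -/
theorem leftFace_faceNext (h : IsUnitGridDrawing G.graph pos) (hr : PreservesRotation G pos)
    (d : G.graph.Dart) : leftFace pos (faceNext G.graph G.rot d) = leftFace pos d := by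
  obtain ⟨k, h1, -, hk, hno⟩ := hr (faceNext G.graph G.rot d)
  unfold leftFace
  rw [leftCentre_eq, leftCentre_eq_snd, G.faceNext_fst]
  rw [G.rot_faceNext, dartVec_symm] at hk
  rw [G.faceNext_fst] at hno
  -- Only k − 1 quarter turns are made: the k-th would end at the direction of the reversed dart,
  -- and the sector left of `d` is the one just before it.
  have := component_iterate h (p := pos d.snd) (h.isUnitVec (faceNext G.graph G.rot d)) (k := k - 1)
    fun e he j hj hj' => hno e (h.1 he) j hj (by omega)
  rw [this]
  congr 2
  have hq : quarterTurn (quarterTurn^[k - 1] (dartVec pos (faceNext G.graph G.rot d))) =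
      quarterTurn (quarterTurn (dartVec pos d)) := by
    rw [← Function.iterate_succ_apply' quarterTurn, quarterTurn_quarterTurn, hk]
    congr 2
    omega
  have hinj : Function.Injective quarterTurn := by
    intro a b hab
    simp only [quarterTurn, Prod.mk.injEq, neg_inj] at hab
    exact Prod.ext hab.2 hab.1
  exact hinj hq

theorem leftFace_eq_of_sameFace (h : IsUnitGridDrawing G.graph pos) (hr : PreservesRotation G pos)
    {d e : G.graph.Dart} (hde : G.SameFace d e) : leftFace pos e = leftFace pos d := by
  obtain ⟨i, rfl⟩ := hde
  have key : ∀ (i : ℕ) d, leftFace pos (((faceNext G.graph G.rot) ^ i) d) = leftFace pos d := by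
    intro i
    induction i with
    | zero => intro d; rfl
    | succ i ih =>
      intro d
      rw [pow_succ', Equiv.Perm.mul_apply, leftFace_faceNext h hr, ih]
  obtain ⟨i, rfl | rfl⟩ := i.eq_nat_or_neg
  · simpa using key i d
  · have := key i (((faceNext G.graph G.rot) ^ (-(i : ℤ))) d)
    rw [← this, ← Equiv.Perm.mul_apply, ← zpow_natCast, ← zpow_add]
    simp

/-! ### Criteria for unbounded and bounded faces. -/

/-- The signed distance of a grid point from the line through a dart, positive to the left. -/
def leftDist (pos : Fin n → ℤ × ℤ) (d : G.graph.Dart) (p : ℤ × ℤ) : ℤ :=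
  (p.2 - (pos d.fst).2) * (dartVec pos d).1 - (p.1 - (pos d.fst).1) * (dartVec pos d).2

/-- If all vertices lie on or to the right of the line through the dart, so do all edges by
convexity. The perpendicular ray from the centre of the left square then escapes to infinity within
the face. -/
theorem not_isBounded_leftFace (h : IsUnitGridDrawing G.graph pos) (d : G.graph.Dart)
    (hd : ∀ v, leftDist pos d (pos v) ≤ 0) : ¬ Bornology.IsBounded (leftFace pos d) := by
  have hu := h.isUnitVec d
  unfold leftFace
  rw [leftCentre_eq]
  unfold leftDist at hd
  set p := pos d.fst with hp
  set w := dartVec pos d with hw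
  unfold IsUnitVec at hu
  have hwR : (w.1 : ℝ) ^ 2 + (w.2 : ℝ) ^ 2 = 1 := by exact_mod_cast hu
  let f : ℝ → ℝ × ℝ := fun t => ((p.1 : ℝ) + w.1 / 2 - (1 / 2 + t) * w.2,
    (p.2 : ℝ) + w.2 / 2 + (1 / 2 + t) * w.1)
  have hdR : ∀ v, ((pos v).2 - p.2 : ℝ) * w.1 - ((pos v).1 - p.1) * w.2 ≤ 0 := fun v => by
    exact_mod_cast hd v
  have hsub : f '' Set.Ici 0 ⊆ connectedComponentIn (drawnSet G.graph pos)ᶜ (quadCentre p w) := by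
    refine IsPreconnected.subset_connectedComponentIn ?_ ⟨0, by simp, ?_⟩ ?_
    · refine (convex_Ici (0 : ℝ)).isPreconnected.image f (Continuous.continuousOn ?_)
      fun_prop
    · simp only [f, quadCentre]
      ext <;> simp only <;> ring
    · rintro _ ⟨t, ht, rfl⟩ hmem
      rw [mem_drawnSet] at hmem
      obtain ⟨e, s, h0, h1, he⟩ := hmem
      simp only [f, Prod.mk.injEq] at he
      have g1 := hdR e.fst
      have g2 := hdR e.snd
      have e1 : ((pos e.snd).1 : ℝ) = (pos e.fst).1 + (dartVec pos e).1 := by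
        rw [pos_snd pos e]; push_cast [Prod.fst_add]; rfl
      have e2 : ((pos e.snd).2 : ℝ) = (pos e.fst).2 + (dartVec pos e).2 := by
        rw [pos_snd pos e]; push_cast [Prod.snd_add]; rfl
      rw [e1, e2] at g2
      have ht' : (0 : ℝ) ≤ t := ht
      -- The height of a common point, 1/2 + t > 0, would be a convex combination of the nonpositive
      -- heights of the ends of an edge.
      have key : (1 / 2 + t : ℝ) = (1 - s) * (((pos e.fst).2 - p.2 : ℝ) * w.1 - ((pos e.fst).1 - p.1) * w.2)
          + s * (((pos e.fst).2 + (dartVec pos e).2 - p.2 : ℝ) * w.1 -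
            ((pos e.fst).1 + (dartVec pos e).1 - p.1) * w.2) := by
        linear_combination (-(1 / 2 + t : ℝ)) * hwR - (w.2 : ℝ) * he.1 + (w.1 : ℝ) * he.2
      nlinarith [mul_nonneg (sub_nonneg.2 h1) (neg_nonneg.2 g1), mul_nonneg h0 (neg_nonneg.2 g2)]
  intro hb
  have hb2 := hb.subset hsub
  obtain ⟨C, hC⟩ := hb2.exists_norm_le
  have hC0 : 0 ≤ C := (norm_nonneg _).trans (hC (f 0) ⟨0, by simp, rfl⟩)
  set T : ℝ := C + |(p.1 : ℝ)| + |(p.2 : ℝ)| + 2 with hT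
  have hT0 : 0 ≤ T := by positivity
  have := hC (f T) ⟨T, hT0, rfl⟩
  rw [Prod.norm_def] at this
  have m1 := (le_max_left _ _).trans this
  have m2 := (le_max_right _ _).trans this
  simp only [f, Real.norm_eq_abs] at m1 m2
  rw [abs_le] at m1 m2
  have q1 := neg_abs_le (p.1 : ℝ)
  have q2 := le_abs_self (p.1 : ℝ)
  have q3 := neg_abs_le (p.2 : ℝ)
  have q4 := le_abs_self (p.2 : ℝ)
  rcases int_sq_add_sq_eq_one hu with ⟨c1, c2⟩ | ⟨c1, c2⟩ | ⟨c1, c2⟩ | ⟨c1, c2⟩ <;>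
    rw [c1, c2] at m1 m2 <;> push_cast at m1 m2 <;> linarith [m1.1, m1.2, m2.1, m2.2]

/-- There is an edge from the grid point `p` in direction `w`. -/
def EdgeAt (G : PlaneGraph n) (pos : Fin n → ℤ × ℤ) (p w : ℤ × ℤ) : Prop :=
  ∃ e : G.graph.Dart, pos e.fst = p ∧ dartVec pos e = w

theorem EdgeAt.mem_drawnSet {p w : ℤ × ℤ} (h : EdgeAt G pos p w) {t : ℝ} (h0 : 0 ≤ t) (h1 : t ≤ 1) :
    ((p.1 + t * w.1, p.2 + t * w.2) : ℝ × ℝ) ∈ drawnSet G.graph pos := by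
  obtain ⟨e, rfl, rfl⟩ := h
  exact UnitGrid.mem_drawnSet.2 ⟨e, t, h0, h1, rfl⟩

/-- The four sides of the 1×l rectangle to the left of the dart are drawn. So the complement of the
drawing is covered by the disjoint open inside and outside of the rectangle, and the component of
the centre stays inside. -/
theorem isBounded_leftFace (h : IsUnitGridDrawing G.graph pos) (d : G.graph.Dart) {l : ℤ} (hl : 0 < l)
    (hbot : ∀ i, 0 ≤ i → i < l → EdgeAt G pos (pos d.fst + i • dartVec pos d) (dartVec pos d))
    (htop : ∀ i, 0 ≤ i → i < l →
      EdgeAt G pos (pos d.fst + i • dartVec pos d + quarterTurn (dartVec pos d)) (dartVec pos d))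
    (hleft : EdgeAt G pos (pos d.fst) (quarterTurn (dartVec pos d)))
    (hright : EdgeAt G pos (pos d.fst + l • dartVec pos d) (quarterTurn (dartVec pos d))) :
    Bornology.IsBounded (leftFace pos d) := by
  have hu := h.isUnitVec d
  unfold leftFace
  rw [leftCentre_eq]
  set p := pos d.fst with hp
  set w := dartVec pos d with hw
  unfold IsUnitVec at hu
  have hwR : (w.1 : ℝ) ^ 2 + (w.2 : ℝ) ^ 2 = 1 := by exact_mod_cast hu
  have hlR : (1 : ℝ) ≤ l := by exact_mod_cast hl
  let α : ℝ × ℝ → ℝ := fun q => (q.1 - p.1) * w.1 + (q.2 - p.2) * w.2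
  let β : ℝ × ℝ → ℝ := fun q => (q.2 - p.2) * w.1 - (q.1 - p.1) * w.2
  have hα : Continuous α := by fun_prop
  have hβ : Continuous β := by fun_prop
  have hq : ∀ q : ℝ × ℝ, q = (p.1 + α q * w.1 - β q * w.2, p.2 + α q * w.2 + β q * w.1) := by
    intro q
    ext
    · simp only [α, β]; linear_combination -(q.1 - p.1) * hwR
    · simp only [α, β]; linear_combination -(q.2 - p.2) * hwR
  set F := (drawnSet G.graph pos)ᶜ with hF
  let U : Set (ℝ × ℝ) := {q | 0 < α q ∧ α q < l ∧ 0 < β q ∧ β q < 1}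
  let V : Set (ℝ × ℝ) := {q | α q < 0 ∨ (l : ℝ) < α q ∨ β q < 0 ∨ 1 < β q}
  have hU : IsOpen U := by
    refine (isOpen_lt continuous_const hα).inter ((isOpen_lt hα continuous_const).inter
      ((isOpen_lt continuous_const hβ).inter (isOpen_lt hβ continuous_const)))
  have hV : IsOpen V := by
    refine (isOpen_lt hα continuous_const).union ((isOpen_lt continuous_const hα).union
      ((isOpen_lt hβ continuous_const).union (isOpen_lt continuous_const hβ)))
  have hdisj : Disjoint U V := by
    rw [Set.disjoint_left]
    rintro q ⟨a1, a2, a3, a4⟩ (b | b | b | b) <;> linarith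
  -- The unit edge over a point of a long side is found by rounding down, except at the right end,
  -- which belongs to the last edge.
  have horiz : ∀ a : ℝ, 0 ≤ a → a ≤ l → ∃ i : ℤ, 0 ≤ i ∧ i < l ∧ 0 ≤ a - i ∧ a - i ≤ 1 := by
    intro a h0 h1
    by_cases hal : a = l
    · exact ⟨l - 1, by omega, by omega, by rw [hal]; push_cast; linarith, by rw [hal]; push_cast; linarith⟩
    · refine ⟨⌊a⌋, Int.floor_nonneg.2 h0, ?_, by linarith [Int.floor_le a],
        by linarith [Int.lt_floor_add_one a]⟩
      exact Int.floor_lt.2 (lt_of_le_of_ne h1 hal)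
  have hcover : F ⊆ U ∪ V := by
    intro q hqF
    by_contra hn
    rw [Set.mem_union, not_or] at hn
    obtain ⟨hnU, hnV⟩ := hn
    simp only [V, Set.mem_ofPred_eq, not_or, not_lt] at hnV
    obtain ⟨a0, a1, b0, b1⟩ := hnV
    apply hqF
    rw [hq q]
    rcases eq_or_lt_of_le b0 with hb | hb
    · obtain ⟨i, i0, i1, i2, i3⟩ := horiz _ a0 a1
      have := (hbot i i0 i1).mem_drawnSet i2 i3
      convert this using 1
      rw [← hb]
      simp only [Prod.fst_add, Prod.snd_add, Prod.smul_fst, Prod.smul_snd, smul_eq_mul]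
      ext <;> simp only <;> push_cast <;> ring
    rcases eq_or_lt_of_le b1 with hb' | hb'
    · obtain ⟨i, i0, i1, i2, i3⟩ := horiz _ a0 a1
      have := (htop i i0 i1).mem_drawnSet i2 i3
      convert this using 1
      rw [hb']
      simp only [Prod.fst_add, Prod.snd_add, Prod.smul_fst, Prod.smul_snd, smul_eq_mul, quarterTurn]
      ext <;> simp only <;> push_cast <;> ring
    rcases eq_or_lt_of_le a0 with ha | ha
    · have := hleft.mem_drawnSet b0 b1
      convert this using 1
      rw [← ha]
      simp only [quarterTurn]
      ext <;> simp only <;> push_cast <;> ring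
    rcases eq_or_lt_of_le a1 with ha' | ha'
    · have := hright.mem_drawnSet b0 b1
      convert this using 1
      rw [ha']
      simp only [Prod.fst_add, Prod.snd_add, Prod.smul_fst, Prod.smul_snd, smul_eq_mul, quarterTurn]
      ext <;> simp only <;> push_cast <;> ring
    exact (hnU ⟨ha, ha', hb, hb'⟩).elim
  have hUb : Bornology.IsBounded U := by
    refine (Metric.isBounded_closedBall (x := ((p.1, p.2) : ℝ × ℝ)) (r := l + 1)).subset ?_
    rintro q ⟨a1, a2, b1, b2⟩
    rw [Metric.mem_closedBall, hq q, Prod.dist_eq, Real.dist_eq, Real.dist_eq]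
    refine max_le ?_ ?_ <;> rw [abs_le] <;>
    rcases int_sq_add_sq_eq_one hu with ⟨c1, c2⟩ | ⟨c1, c2⟩ | ⟨c1, c2⟩ | ⟨c1, c2⟩ <;>
      rw [c1, c2] <;> push_cast <;> constructor <;> linarith
  -- A centre on the drawing would have an empty component.
  by_cases hc : quadCentre p w ∈ F
  · refine hUb.subset (IsPreconnected.subset_left_of_subset_union hU hV hdisj
      ((connectedComponentIn_subset _ _).trans hcover) ⟨quadCentre p w,
        mem_connectedComponentIn hc, ?_⟩ isPreconnected_connectedComponentIn)
    have e1 : α (quadCentre p w) = 1 / 2 := by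
      simp only [α, quadCentre]; linear_combination 1 / 2 * hwR
    have e2 : β (quadCentre p w) = 1 / 2 := by
      simp only [β, quadCentre]; linear_combination 1 / 2 * hwR
    refine ⟨?_, ?_, ?_, ?_⟩ <;> simp only [e1, e2] <;> linarith
  · rw [connectedComponentIn_eq_empty hc]
    exact Bornology.isBounded_empty

end Plane

/-! ### Closed walks of length at most six -/

/-- The four unit vectors in counterclockwise order. -/
def unitVec (a : Fin 4) : ℤ × ℤ :=
  if a = 0 then (1, 0) else if a = 1 then (0, 1) else if a = 2 then (-1, 0) else (0, -1)

/-- The number of a unit vector. -/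
def heading (w : ℤ × ℤ) : Fin 4 :=
  if w = (1, 0) then 0 else if w = (0, 1) then 1 else if w = (-1, 0) then 2 else 3

theorem heading_unitVec (a : Fin 4) : heading (unitVec a) = a := by revert a; decide

theorem unitVec_injective : Function.Injective unitVec :=
  Function.LeftInverse.injective heading_unitVec

theorem isUnitVec_unitVec (a : Fin 4) : IsUnitVec (unitVec a) := by
  unfold IsUnitVec; revert a; decide

theorem IsUnitVec.unitVec_heading {w : ℤ × ℤ} (h : IsUnitVec w) : unitVec (heading w) = w := by
  obtain ⟨a, b⟩ := w
  rcases int_sq_add_sq_eq_one h with ⟨rfl, rfl⟩ | ⟨rfl, rfl⟩ | ⟨rfl, rfl⟩ | ⟨rfl, rfl⟩ <;> decide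

theorem quarterTurn_unitVec (a : Fin 4) : quarterTurn (unitVec a) = unitVec (a + 1) := by
  revert a; decide

theorem neg_unitVec (a : Fin 4) : -unitVec a = unitVec (a + 2) := by revert a; decide

theorem iterate_quarterTurn_unitVec (a : Fin 4) (k : ℕ) :
    quarterTurn^[k] (unitVec a) = unitVec (a + Fin.ofNat 4 k) := by
  induction k with
  | zero => simp
  | succ k ih =>
    rw [Function.iterate_succ_apply', ih, quarterTurn_unitVec]
    congr 1
    ext
    simp only [Fin.val_add, Fin.ofNat, Fin.val_one]
    omega

/-- The second component of a vector in the orthonormal frame given by a unit vector. -/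
def cross (u w : ℤ × ℤ) : ℤ := w.2 * u.1 - w.1 * u.2

/-- The heading after a straight or left turn. -/
def TurnsLeft (a b : Fin 4) : Prop := b = a ∨ b = a + 1

/-- The heading after a straight or right turn. -/
def TurnsRight (a b : Fin 4) : Prop := b = a ∨ b = a + 3

instance (a b : Fin 4) : Decidable (TurnsLeft a b) := inferInstanceAs (Decidable (_ ∨ _))

instance (a b : Fin 4) : Decidable (TurnsRight a b) := inferInstanceAs (Decidable (_ ∨ _))

/-- The headings along the boundary of a rectangle of height one, counterclockwise from the lower
left corner. -/
def IsRectangle (l : ℕ) (δ : ℕ → Fin 4) : Prop :=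
  (∀ i < l, δ i = δ 0) ∧ δ l = δ 0 + 1 ∧ (∀ i < l, δ (l + 1 + i) = δ 0 + 2) ∧
    δ (l + 1 + l) = δ 0 + 3

/-- A closed walk of length at most six in the grid, given by its headings. -/
structure ClosedWalk (g : ℕ) (δ : ℕ → Fin 4) : Prop where
  pos : 1 ≤ g
  le : g ≤ 6
  periodic : ∀ i, δ (i + g) = δ i
  sum : ∑ i ∈ Finset.range g, unitVec (δ i) = 0

theorem ClosedWalk.shift {g : ℕ} {δ : ℕ → Fin 4} (h : ClosedWalk g δ) (i : ℕ) :
    ClosedWalk g fun j => δ (i + j) := by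
  refine ⟨h.pos, h.le, fun j => by rw [← add_assoc]; exact h.periodic _, ?_⟩
  induction i with
  | zero => simpa using h.sum
  | succ i ih =>
    have h1 := Finset.sum_range_succ (fun j => unitVec (δ (i + j))) g
    rw [ih, Finset.sum_range_succ', h.periodic, zero_add, add_zero, add_eq_right] at h1
    rw [← h1]
    exact Finset.sum_congr rfl fun j _ => by rw [add_assoc, add_comm 1 j]

theorem forall_of_forall_lt {g : ℕ} {δ : ℕ → Fin 4} (hg : 1 ≤ g) (h : ∀ i, δ (i + g) = δ i)
    {P : Fin 4 → Fin 4 → Prop} (hP : ∀ i < g, P (δ i) (δ (i + 1))) (i : ℕ) : P (δ i) (δ (i + 1)) := by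
  have hmul : ∀ q j, δ (j + g * q) = δ j := by
    intro q
    induction q with
    | zero => intro j; rfl
    | succ q ih => intro j; rw [mul_add, mul_one, ← add_assoc, h, ih]
  have h1 := hP (i % g) (Nat.mod_lt _ hg)
  rw [← hmul (i / g) (i % g), ← hmul (i / g) (i % g + 1), add_right_comm, Nat.mod_add_div] at h1
  exact h1

theorem closed_four : ∀ a b c d : Fin 4, (TurnsLeft a b ∨ TurnsRight a b) →
    (TurnsLeft b c ∨ TurnsRight b c) → (TurnsLeft c d ∨ TurnsRight c d) →
    unitVec a + unitVec b + unitVec c + unitVec d = 0 →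
    (b = a + 1 ∧ c = a + 2 ∧ d = a + 3) ∨ (b = a + 3 ∧ c = a + 2 ∧ d = a + 1) := by decide

set_option synthInstance.maxHeartbeats 400000 in
set_option synthInstance.maxSize 2048 in
-- The walk goes around a 1×2 rectangle, counterclockwise or clockwise, and edges three apart are
-- opposite. The three cases in each group tell where on a half of the boundary the walk starts: at
-- the first or the second edge of a long side, or at a short side.
theorem closed_six : ∀ a b c d e f : Fin 4, (TurnsLeft a b ∨ TurnsRight a b) →
    (TurnsLeft b c ∨ TurnsRight b c) → (TurnsLeft c d ∨ TurnsRight c d) →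
    (TurnsLeft d e ∨ TurnsRight d e) → (TurnsLeft e f ∨ TurnsRight e f) →
    (TurnsLeft f a ∨ TurnsRight f a) →
    unitVec a + unitVec b + unitVec c + unitVec d + unitVec e + unitVec f = 0 →
    (d = a + 2 ∧ e = b + 2 ∧ f = c + 2 ∧
      ((b = a ∧ c = a + 1) ∨ (b = a + 1 ∧ c = a + 1) ∨ (b = a + 1 ∧ c = a + 2))) ∨
    (d = a + 2 ∧ e = b + 2 ∧ f = c + 2 ∧
      ((b = a ∧ c = a + 3) ∨ (b = a + 3 ∧ c = a + 3) ∨ (b = a + 3 ∧ c = a + 2))) := by decide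

/-- Every step changes the parity of the coordinate sum; here all cases are simply enumerated. -/
theorem not_closed_odd : (∀ a b c : Fin 4, unitVec a + unitVec b + unitVec c ≠ 0) ∧
    ∀ a b c d e : Fin 4, unitVec a + unitVec b + unitVec c + unitVec d + unitVec e ≠ 0 := by decide


theorem six_left : ∀ a b c : Fin 4, TurnsLeft a b → TurnsLeft b c →
    (((b = a ∧ c = a + 1) ∨ (b = a + 1 ∧ c = a + 1) ∨ (b = a + 1 ∧ c = a + 2)) ∨
      ((b = a ∧ c = a + 3) ∨ (b = a + 3 ∧ c = a + 3) ∨ (b = a + 3 ∧ c = a + 2))) →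
    (b = a ∧ c = a + 1) ∨ (b = a + 1 ∧ c = a + 1) ∨ (b = a + 1 ∧ c = a + 2) := by decide

theorem six_right : ∀ a b c : Fin 4, TurnsRight a b → TurnsRight b c →
    (((b = a ∧ c = a + 1) ∨ (b = a + 1 ∧ c = a + 1) ∨ (b = a + 1 ∧ c = a + 2)) ∨
      ((b = a ∧ c = a + 3) ∨ (b = a + 3 ∧ c = a + 3) ∨ (b = a + 3 ∧ c = a + 2))) →
    (b = a ∧ c = a + 3) ∨ (b = a + 3 ∧ c = a + 3) ∨ (b = a + 3 ∧ c = a + 2) := by decide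

namespace ClosedWalk

variable {g : ℕ} {δ : ℕ → Fin 4}

/-- All turns of a closed walk of length at most six without backtracking go to the same side. -/
theorem cases (h : ClosedWalk g δ)
    (ht : ∀ i, TurnsLeft (δ i) (δ (i + 1)) ∨ TurnsRight (δ i) (δ (i + 1))) :
    (g = 4 ∧ ((δ 1 = δ 0 + 1 ∧ δ 2 = δ 0 + 2 ∧ δ 3 = δ 0 + 3) ∨
      (δ 1 = δ 0 + 3 ∧ δ 2 = δ 0 + 2 ∧ δ 3 = δ 0 + 1))) ∨
    (g = 6 ∧ δ 3 = δ 0 + 2 ∧ δ 4 = δ 1 + 2 ∧ δ 5 = δ 2 + 2 ∧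
      (((δ 1 = δ 0 ∧ δ 2 = δ 0 + 1) ∨ (δ 1 = δ 0 + 1 ∧ δ 2 = δ 0 + 1) ∨
        (δ 1 = δ 0 + 1 ∧ δ 2 = δ 0 + 2)) ∨
      ((δ 1 = δ 0 ∧ δ 2 = δ 0 + 3) ∨ (δ 1 = δ 0 + 3 ∧ δ 2 = δ 0 + 3) ∨
        (δ 1 = δ 0 + 3 ∧ δ 2 = δ 0 + 2)))) := by
  obtain ⟨hp, hl, hper, hsum⟩ := h
  have h0 := hper 0
  rw [zero_add] at h0
  have c : g = 1 ∨ g = 2 ∨ g = 3 ∨ g = 4 ∨ g = 5 ∨ g = 6 := by omega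
  rcases c with rfl | rfl | rfl | rfl | rfl | rfl <;>
    simp only [Finset.sum_range_succ, Finset.sum_range_zero, zero_add] at hsum
  · exact absurd hsum (by generalize δ 0 = a; revert a; decide)
  -- Length two would require turning back.
  · have := ht 0
    exact absurd hsum (by
      revert this; rw [zero_add]; generalize δ 0 = a; generalize δ 1 = b; revert a b; decide)
  · exact absurd hsum (not_closed_odd.1 _ _ _)
  · exact Or.inl ⟨rfl, closed_four _ _ _ _ (ht 0) (ht 1) (ht 2) hsum⟩
  · exact absurd hsum (not_closed_odd.2 _ _ _ _ _)
  · have t5 := ht 5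
    rw [h0] at t5
    have := closed_six _ _ _ _ _ _ (ht 0) (ht 1) (ht 2) (ht 3) (ht 4) t5 hsum
    refine Or.inr ⟨rfl, ?_⟩
    tauto

/-- All turns of a closed walk of length at most six without backtracking go to the same side. -/
theorem left_or_right (h : ClosedWalk g δ)
    (ht : ∀ i, TurnsLeft (δ i) (δ (i + 1)) ∨ TurnsRight (δ i) (δ (i + 1))) :
    (∀ i, TurnsLeft (δ i) (δ (i + 1))) ∨ ∀ i, TurnsRight (δ i) (δ (i + 1)) := by
  have hc := h.cases ht
  have h0 := h.periodic 0
  rw [zero_add] at h0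
  have key : (∀ i < g, TurnsLeft (δ i) (δ (i + 1))) ∨ ∀ i < g, TurnsRight (δ i) (δ (i + 1)) := by
    rcases hc with ⟨rfl, ⟨h1, h2, h3⟩ | ⟨h1, h2, h3⟩⟩ | ⟨rfl, h3, h4, h5, h12 | h12⟩
    · left; intro i hi
      interval_cases i <;> simp only [zero_add, Nat.reduceAdd, h0, h1, h2, h3] <;>
        (generalize δ 0 = a; revert a; decide)
    · right; intro i hi
      interval_cases i <;> simp only [zero_add, Nat.reduceAdd, h0, h1, h2, h3] <;>
        (generalize δ 0 = a; revert a; decide)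
    · left; intro i hi
      rcases h12 with ⟨h1, h2⟩ | ⟨h1, h2⟩ | ⟨h1, h2⟩ <;>
      interval_cases i <;> simp only [zero_add, Nat.reduceAdd, h0, h1, h2, h3, h4, h5] <;>
        (generalize δ 0 = a; revert a; decide)
    · right; intro i hi
      rcases h12 with ⟨h1, h2⟩ | ⟨h1, h2⟩ | ⟨h1, h2⟩ <;>
      interval_cases i <;> simp only [zero_add, Nat.reduceAdd, h0, h1, h2, h3, h4, h5] <;>
        (generalize δ 0 = a; revert a; decide)
  exact key.imp (forall_of_forall_lt h.pos h.periodic) (forall_of_forall_lt h.pos h.periodic)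

/-- The edge opposite to the first one has the opposite heading and lies to the left. -/
theorem opposite_of_left (h : ClosedWalk g δ) (ht : ∀ i, TurnsLeft (δ i) (δ (i + 1))) :
    (g = 4 ∧ δ 2 = δ 0 + 2 ∧
      0 < cross (unitVec (δ 0)) (∑ i ∈ Finset.range 3, unitVec (δ i))) ∨
    (g = 6 ∧ δ 3 = δ 0 + 2 ∧
      0 < cross (unitVec (δ 0)) (∑ i ∈ Finset.range 4, unitVec (δ i))) := by
  have t1 := ht 0
  have t2 := ht 1
  simp only [zero_add, Nat.reduceAdd] at t1 t2
  rcases h.cases fun i => Or.inl (ht i) with ⟨rfl, ⟨h1, h2, h3⟩ | ⟨h1, h2, h3⟩⟩ | ⟨rfl, h3, h4, h5, h12⟩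
  · left
    simp only [Finset.sum_range_succ, Finset.sum_range_zero, zero_add, h1, h2, true_and]
    generalize δ 0 = a; revert a; decide
  · rw [h1] at t1
    exact absurd t1 (by generalize δ 0 = a; revert a; decide)
  · right
    simp only [Finset.sum_range_succ, Finset.sum_range_zero, zero_add, h3, true_and]
    rcases six_left _ _ _ t1 t2 h12 with ⟨h1, h2⟩ | ⟨h1, h2⟩ | ⟨h1, h2⟩ <;> rw [h1, h2] <;>
      (generalize δ 0 = a; revert a; decide)

/-- A closed walk of length at most six without right turns bounds a rectangle. -/
theorem isRectangle_of_left (h : ClosedWalk g δ) (ht : ∀ i, TurnsLeft (δ i) (δ (i + 1))) :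
    ∃ i l, 0 < l ∧ IsRectangle l fun j => δ (i + j) := by
  have t1 := ht 0
  have t2 := ht 1
  have h0 := h.periodic 0
  have hp1 := h.periodic 1
  simp only [zero_add, Nat.reduceAdd] at t1 t2 h0
  rcases h.cases fun i => Or.inl (ht i) with ⟨rfl, ⟨h1, h2, h3⟩ | ⟨h1, h2, h3⟩⟩ | ⟨rfl, h3, h4, h5, h12⟩
  · refine ⟨0, 1, one_pos, fun i hi => ?_, by simpa using h1, fun i hi => ?_, by simpa using h3⟩
    · obtain rfl : i = 0 := by omega
      rfl
    · obtain rfl : i = 0 := by omega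
      simpa using h2
  · rw [h1] at t1
    exact absurd t1 (by generalize δ 0 = a; revert a; decide)
  · have c := six_left _ _ _ t1 t2 h12
    have mk : ∀ i, δ (i + 1) = δ i → δ (i + 2) = δ i + 1 → δ (i + 3) = δ i + 2 → δ (i + 4) = δ i + 2 →
        δ (i + 5) = δ i + 3 → IsRectangle 2 fun j => δ (i + j) := by
      intro i e1 e2 e3 e4 e5
      refine ⟨fun j hj => ?_, e2, fun j hj => ?_, e5⟩ <;> interval_cases j
      · rfl
      · exact e1
      · exact e3
      · exact e4
    -- The rectangle is read from the first edge of a long side, which comes after 0, 1 or 2 steps.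
    rcases c with ⟨h1, h2⟩ | ⟨h1, h2⟩ | ⟨h1, h2⟩
    · refine ⟨0, 2, two_pos, mk 0 ?_ ?_ ?_ ?_ ?_⟩ <;>
        simp only [zero_add, h1, h2, h3, h4, h5]
      generalize δ 0 = a; revert a; decide
    · refine ⟨1, 2, two_pos, mk 1 ?_ ?_ ?_ ?_ ?_⟩ <;>
        simp only [Nat.reduceAdd, h0, h1, h2, h3, h4, h5] <;> (generalize δ 0 = a; revert a; decide)
    · refine ⟨2, 2, two_pos, mk 2 ?_ ?_ ?_ ?_ ?_⟩ <;>
        simp only [Nat.reduceAdd, h0, hp1, h1, h2, h3, h4, h5] <;> (generalize δ 0 = a; revert a; decide)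

/-- A closed walk of length at most six without left turns stays on one side of its first edge. -/
theorem cross_nonpos_of_right (h : ClosedWalk g δ) (ht : ∀ i, TurnsRight (δ i) (δ (i + 1))) {j : ℕ}
    (hj : j < g) : cross (unitVec (δ 0)) (∑ i ∈ Finset.range j, unitVec (δ i)) ≤ 0 := by
  have t1 := ht 0
  have t2 := ht 1
  simp only [zero_add, Nat.reduceAdd] at t1 t2
  rcases h.cases fun i => Or.inr (ht i) with ⟨rfl, ⟨h1, h2, h3⟩ | ⟨h1, h2, h3⟩⟩ | ⟨rfl, h3, h4, h5, h12⟩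
  · rw [h1] at t1
    exact absurd t1 (by generalize δ 0 = a; revert a; decide)
  · interval_cases j <;>
      simp only [Finset.sum_range_succ, Finset.sum_range_zero, zero_add, h1, h2] <;>
      (generalize δ 0 = a; revert a; decide)
  · interval_cases j <;>
      simp only [Finset.sum_range_succ, Finset.sum_range_zero, zero_add, h3, h4] <;>
      rcases six_right _ _ _ t1 t2 h12 with ⟨h1, h2⟩ | ⟨h1, h2⟩ | ⟨h1, h2⟩ <;>
      (try simp only [h1, h2]) <;> (generalize δ 0 = a; revert a; decide)

/-- On a closed walk of length at most six without left turns, after two straight edges the walk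
comes back to the right of their common end. -/
theorem sum_of_straight (h : ClosedWalk g δ) (ht : ∀ i, TurnsRight (δ i) (δ (i + 1)))
    (h01 : δ 1 = δ 0) : unitVec (δ 1) + unitVec (δ 2) + unitVec (δ 3) = unitVec (δ 0 + 3) := by
  have t1 := ht 0
  have t2 := ht 1
  simp only [zero_add, Nat.reduceAdd] at t1 t2
  rcases h.cases fun i => Or.inr (ht i) with ⟨rfl, ⟨h1, h2, h3⟩ | ⟨h1, h2, h3⟩⟩ | ⟨rfl, h3, h4, h5, h12⟩
  · rw [h1] at h01
    exact absurd h01 (by generalize δ 0 = a; revert a; decide)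
  · rw [h1] at h01
    exact absurd h01 (by generalize δ 0 = a; revert a; decide)
  · rw [h3]
    rcases six_right _ _ _ t1 t2 h12 with ⟨h1, h2⟩ | ⟨h1, h2⟩ | ⟨h1, h2⟩ <;> rw [h1] at h01 <;>
      simp only [h1, h2] <;> revert h01 <;> (generalize δ 0 = a; revert a; decide)

end ClosedWalk

variable {n : ℕ}

instance (G : SimpleGraph (Fin n)) : Finite G.Dart :=
  Finite.of_injective (fun d => d.toProd) fun _ _ h => SimpleGraph.Dart.ext _ _ h

namespace PlaneGraph

variable (G : PlaneGraph n)

/-! ### Face walks -/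

/-- The next dart on the boundary walk of the face to the left. -/
def next : Equiv.Perm G.graph.Dart := faceNext G.graph G.rot

theorem next_fst (d : G.graph.Dart) : (G.next d).fst = d.snd := G.faceNext_fst d

theorem rot_next (d : G.graph.Dart) : G.rot (G.next d) = d.symm := G.rot_faceNext d

/-- The length of the boundary walk of the face to the left. -/
noncomputable def period (d : G.graph.Dart) : ℕ := Function.minimalPeriod G.next d

theorem period_pos (d : G.graph.Dart) : 0 < G.period d :=
  Function.minimalPeriod_pos_of_mem_periodicPts (G.next.injective.mem_periodicPts d)

theorem iterate_period (d : G.graph.Dart) : G.next^[G.period d] d = d :=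
  Function.iterate_minimalPeriod

theorem iterate_add_period (d : G.graph.Dart) (i : ℕ) : G.next^[i + G.period d] d = G.next^[i] d := by
  rw [Function.iterate_add_apply, G.iterate_period]

theorem sameFace_iterate (d : G.graph.Dart) (i : ℕ) : G.SameFace d (G.next^[i] d) :=
  ⟨i, by rw [zpow_natCast, ← Equiv.Perm.iterate_eq_pow]; rfl⟩

theorem SameFace.exists_iterate {G : PlaneGraph n} {d e : G.graph.Dart} (h : G.SameFace d e) :
    ∃ i < G.period d, G.next^[i] d = e := by
  obtain ⟨i, hi⟩ := h.exists_nat_pow_eq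
  refine ⟨i % G.period d, Nat.mod_lt _ (G.period_pos d), ?_⟩
  rw [period, Function.iterate_mod_minimalPeriod_eq, ← hi, ← Equiv.Perm.iterate_eq_pow]; rfl

theorem period_le_faceDegree (d : G.graph.Dart) : G.period d ≤ G.faceDegree d := by
  have h1 : ((fun i => G.next^[i] d) '' Set.Iio (G.period d)).ncard = G.period d := by
    have hi : Set.InjOn (fun i => G.next^[i] d) (Set.Iio (G.period d)) :=
      Function.iterate_injOn_Iio_minimalPeriod
    rw [hi.ncard_image, ← Finset.coe_Iio, Set.ncard_coe_finset, Nat.card_Iio]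
  rw [← h1]
  refine Set.ncard_le_ncard ?_ (Set.toFinite _)
  rintro _ ⟨i, -, rfl⟩
  exact G.sameFace_iterate d i

theorem onOuter_congr {d e : G.graph.Dart} (h : G.SameFace d e) : G.OnOuter d ↔ G.OnOuter e :=
  ⟨fun h' => h'.trans h, fun h' => h'.trans h.symm⟩

theorem onOuter_iterate {d : G.graph.Dart} (i : ℕ) : G.OnOuter (G.next^[i] d) ↔ G.OnOuter d :=
  (G.onOuter_congr (G.sameFace_iterate d i)).symm

theorem eq_univ_of_adj {S : Set (Fin n)} {v : Fin n} (hv : v ∈ S)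
    (hS : ∀ d : G.graph.Dart, d.fst ∈ S → d.snd ∈ S) (w : Fin n) : w ∈ S := by
  obtain ⟨p⟩ := G.connected v w
  induction p with
  | nil => exact hv
  | cons h p ih => exact ih (hS ⟨(_, _), h⟩ hv)

/-- Rotation reaches all darts at a vertex, reversal leads to its neighbours, and the graph is
connected. Hence the search for positions reaches every dart. -/
theorem forall_of_rev_rot {S : Set G.graph.Dart} {d : G.graph.Dart} (hd : d ∈ S)
    (hS : ∀ e ∈ S, e.symm ∈ S ∧ G.rot e ∈ S) (e : G.graph.Dart) : e ∈ S := by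
  have hrot : ∀ e ∈ S, ∀ e', e.fst = e'.fst → e' ∈ S := by
    intro e he e' hee
    obtain ⟨i, rfl⟩ := ((G.rot_sameCycle e e').2 hee).exists_nat_pow_eq
    rw [← Equiv.Perm.iterate_eq_pow]
    clear hee
    induction i with
    | zero => exact he
    | succ i ih => rw [Function.iterate_succ_apply']; exact (hS _ ih).2
  refine G.eq_univ_of_adj (S := {v | ∀ e : G.graph.Dart, e.fst = v → e ∈ S}) (v := d.fst)
    (fun e he => hrot d hd e he.symm) (fun e he e' he' => ?_) e.fst e rfl
  exact hrot e.symm (hS e (he e rfl)).1 e' he'.symm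

theorem eq_of_rot_eq {d e : G.graph.Dart} (hd : G.rot d = d) (he : e.fst = d.fst) : e = d := by
  obtain ⟨i, rfl⟩ := ((G.rot_sameCycle d e).2 he.symm).exists_nat_pow_eq
  rw [← Equiv.Perm.iterate_eq_pow]
  exact Function.iterate_fixed hd i

/-- A biconnected plane graph with a vertex of degree one has only two vertices. -/
theorem eq_or_eq_of_rot_eq (hb : G.Biconnected) {d : G.graph.Dart} (hd : G.rot d = d) (v : Fin n) :
    v = d.fst ∨ v = d.snd := by
  by_contra! hv
  obtain ⟨hv1, hv2⟩ := hv
  have hne : d.fst ≠ d.snd := d.adj.ne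
  obtain ⟨p⟩ := (hb.2 d.snd) ⟨d.fst, hne⟩ ⟨v, hv2⟩
  cases p with
  | nil => exact hv1 rfl
  | @cons _ w _ h p =>
    have hadj : G.graph.Adj d.fst w := h
    have := G.eq_of_rot_eq hd (e := ⟨(d.fst, w), hadj⟩) rfl
    exact w.2 (congrArg (fun e : G.graph.Dart => e.snd) this)

theorem eq_or_eq_symm_of_rot_eq (hb : G.Biconnected) {d : G.graph.Dart} (hd : G.rot d = d)
    (e : G.graph.Dart) : e = d ∨ e = d.symm := by
  rcases G.eq_or_eq_of_rot_eq hb hd e.fst with h | h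
  · exact Or.inl (G.eq_of_rot_eq hd h)
  · right
    refine dart_eq_of_ends h ?_
    rcases G.eq_or_eq_of_rot_eq hb hd e.snd with h' | h'
    · exact h'
    · exact absurd (h.trans h'.symm) e.adj.ne

/-- A vertex of degree one forces the graph to be a single edge, whose only face is the outer one.
Hence face walks can turn back only if there are no internal faces. -/
theorem onOuter_of_rot_eq (hb : G.Biconnected) {d : G.graph.Dart} (hd : G.rot d = d)
    (e : G.graph.Dart) : G.OnOuter e := by
  have hn : G.next d = d.symm := by
    rcases G.eq_or_eq_symm_of_rot_eq hb hd (G.next d) with h | h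
    · exact absurd ((congrArg (fun e : G.graph.Dart => e.fst) h).symm.trans (G.next_fst d)) d.adj.ne
    · exact h
  have hs : G.SameFace d d.symm := by
    have := G.sameFace_iterate d 1
    rwa [Function.iterate_one, hn] at this
  have key : ∀ e, G.SameFace d e := fun e => by
    rcases G.eq_or_eq_symm_of_rot_eq hb hd e with rfl | rfl
    · exact Equiv.Perm.SameCycle.refl _ _
    · exact hs
  exact (key _).symm.trans (key _)

end PlaneGraph

/-! ### Face walks in a drawing -/

/-- The heading of a dart in a drawing. -/
def dartHeading {G : SimpleGraph (Fin n)} (pos : Fin n → ℤ × ℤ) (d : G.Dart) : Fin 4 :=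
  heading (dartVec pos d)

section Drawing

variable {G : PlaneGraph n} {pos : Fin n → ℤ × ℤ}

theorem IsUnitGridDrawing.unitVec_dartHeading (h : IsUnitGridDrawing G.graph pos) (d : G.graph.Dart) :
    unitVec (dartHeading pos d) = dartVec pos d := (h.isUnitVec d).unitVec_heading

theorem IsUnitGridDrawing.dartHeading_symm (h : IsUnitGridDrawing G.graph pos) (d : G.graph.Dart) :
    dartHeading pos d.symm = dartHeading pos d + 2 := by
  apply unitVec_injective
  rw [← neg_unitVec, h.unitVec_dartHeading, h.unitVec_dartHeading, dartVec_symm]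

theorem IsUnitGridDrawing.eq_of_dartHeading (h : IsUnitGridDrawing G.graph pos) {d e : G.graph.Dart}
    (h1 : d.fst = e.fst) (h2 : dartHeading pos d = dartHeading pos e) : d = e := by
  refine h.dart_ext (by rw [h1]) ?_
  rw [← h.unitVec_dartHeading, h2, h.unitVec_dartHeading]

theorem pos_iterate_fst (pos : Fin n → ℤ × ℤ) (d : G.graph.Dart) (i : ℕ) :
    pos (G.next^[i] d).fst = pos d.fst + ∑ j ∈ Finset.range i, dartVec pos (G.next^[j] d) := by
  induction i with
  | zero => simp
  | succ i ih =>
    rw [Finset.sum_range_succ, ← add_assoc, ← ih, ← pos_snd pos, Function.iterate_succ_apply',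
      G.next_fst]

theorem closedWalk (h : IsUnitGridDrawing G.graph pos) {d : G.graph.Dart} (hd : G.period d ≤ 6) :
    ClosedWalk (G.period d) fun i => dartHeading pos (G.next^[i] d) := by
  refine ⟨G.period_pos d, hd, fun i => by rw [G.iterate_add_period], ?_⟩
  simp only [h.unitVec_dartHeading]
  have := pos_iterate_fst pos d (G.period d)
  rw [G.iterate_period] at this
  simpa using this

theorem preservesRotation_iff (h : IsUnitGridDrawing G.graph pos) :
    PreservesRotation G pos ↔ ∀ d : G.graph.Dart, ∃ k : ℕ, 1 ≤ k ∧ k ≤ 4 ∧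
      dartHeading pos (G.rot d) = dartHeading pos d + Fin.ofNat 4 k ∧
      ∀ e : G.graph.Dart, e.fst = d.fst → ∀ j : ℕ, 1 ≤ j → j < k →
        dartHeading pos e ≠ dartHeading pos d + Fin.ofNat 4 j := by
  unfold PreservesRotation
  simp only [← h.unitVec_dartHeading, iterate_quarterTurn_unitVec, unitVec_injective.eq_iff, ne_eq]

/-- The turns on a face walk without backtracking, and the edges at the turning point. -/
theorem next_turn (h : IsUnitGridDrawing G.graph pos) (hr : PreservesRotation G pos)
    {d : G.graph.Dart} (hd : G.rot d.symm ≠ d.symm) :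
    (TurnsLeft (dartHeading pos d) (dartHeading pos (G.next d)) ∨
      TurnsRight (dartHeading pos d) (dartHeading pos (G.next d))) ∧
    (TurnsRight (dartHeading pos d) (dartHeading pos (G.next d)) → ∀ e : G.graph.Dart, e.fst = d.snd →
      e = G.next d ∨ e = d.symm ∨
        (dartHeading pos (G.next d) = dartHeading pos d ∧ dartHeading pos e = dartHeading pos d + 3)) := by
  obtain ⟨k, h1, h4, hk, hno⟩ := (preservesRotation_iff h).1 hr (G.next d)
  rw [G.rot_next, h.dartHeading_symm] at hk
  have key : ∀ e : G.graph.Dart, e.fst = d.snd → (dartHeading pos e = dartHeading pos (G.next d) → e = G.next d) ∧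
      (dartHeading pos e = dartHeading pos d + 2 → e = d.symm) := by
    intro e he
    refine ⟨fun h' => h.eq_of_dartHeading (by rw [he, G.next_fst]) h', fun h' => ?_⟩
    exact h.eq_of_dartHeading he (h'.trans (h.dartHeading_symm d).symm)
  -- A full turn would mean that the next dart is the reverse of `d`, a dead end.
  have hk4 : k ≠ 4 := by
    rintro rfl
    have hne : G.next d = d.symm := (key _ (G.next_fst d)).2 (by rw [hk]; simp)
    exact hd (by rw [← hne, G.rot_next, hne])
  have hno' : ∀ e : G.graph.Dart, e.fst = d.snd → ∀ j : ℕ, 1 ≤ j → j < k →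
      dartHeading pos e ≠ dartHeading pos (G.next d) + Fin.ofNat 4 j := fun e he =>
    hno e (he.trans (G.next_fst d).symm)
  constructor
  · have : k = 1 ∨ k = 2 ∨ k = 3 := by omega
    clear key hno hno'
    revert hk
    generalize dartHeading pos d = a; generalize dartHeading pos (G.next d) = b
    rcases this with rfl | rfl | rfl <;> revert a b <;> decide
  · intro hR e he
    obtain ⟨k1, k2⟩ := key e he
    have n1 := hno' e he 1
    have n2 := hno' e he 2
    clear key hno hno'
    have : k = 1 ∨ k = 2 ∨ k = 3 := by omega
    have c : dartHeading pos e = dartHeading pos (G.next d) ∨ dartHeading pos e = dartHeading pos d + 2 ∨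
        (dartHeading pos (G.next d) = dartHeading pos d ∧ dartHeading pos e = dartHeading pos d + 3) := by
      clear k1 k2
      revert hk hR n1 n2
      generalize dartHeading pos d = a; generalize dartHeading pos (G.next d) = b
      generalize dartHeading pos e = c
      rcases this with rfl | rfl | rfl <;> revert a b c <;> decide
    exact c.imp k1 (Or.imp_left k2)

end Drawing

variable {n : ℕ} {G : PlaneGraph n} {pos : Fin n → ℤ × ℤ}

/-! ### Internal faces of a drawing -/

theorem leftDist_eq_cross (pos : Fin n → ℤ × ℤ) (d : G.graph.Dart) (p : ℤ × ℤ) :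
    leftDist pos d p = cross (dartVec pos d) (p - pos d.fst) := rfl

theorem snd_iterate (d : G.graph.Dart) (i : ℕ) : (G.next^[i] d).snd = (G.next^[i + 1] d).fst := by
  rw [Function.iterate_succ_apply', G.next_fst]

/-- In a drawing the internal faces of degree at most six have no right turns. -/
theorem turnsLeft_of_internal (hb : G.Biconnected) (h : IsUnitGridDrawing G.graph pos)
    (hp : PreservesEmbedding G pos) {d : G.graph.Dart} (hd : ¬ G.OnOuter d) (h6 : G.period d ≤ 6)
    (i : ℕ) : TurnsLeft (dartHeading pos (G.next^[i] d)) (dartHeading pos (G.next^[i + 1] d)) := by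
  have hrot : ∀ e, G.rot e ≠ e := fun e he => hd (G.onOuter_of_rot_eq hb he d)
  have hturn := fun i => next_turn h hp.1 (d := G.next^[i] d) (hrot _)
  simp only [← Function.iterate_succ_apply' G.next] at hturn
  have hc := closedWalk h h6
  rcases hc.left_or_right fun i => (hturn i).1 with hL | hR
  · exact hL i
  exfalso
  -- If all turns go to the right, the walk runs around a rectangle lying to its right and already
  -- visits all vertices: no edge leads from it to a new vertex.
  have hS : ∀ v, v ∈ {v | ∃ i, (G.next^[i] d).fst = v} := by
    refine G.eq_univ_of_adj ⟨0, rfl⟩ ?_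
    rintro e ⟨i, hi⟩
    obtain ⟨j, hj⟩ : ∃ j, e.fst = (G.next^[j] d).snd := by
      -- The predecessor on the periodic walk.
      refine ⟨i + (G.period d - 1), ?_⟩
      have := G.period_pos d
      rw [snd_iterate, add_assoc, Nat.sub_add_cancel this, G.iterate_add_period, hi]
    rcases (hturn j).2 (hR j) e hj with rfl | rfl | ⟨h1, h2⟩
    · exact ⟨j + 2, (snd_iterate d (j + 1)).symm⟩
    · exact ⟨j, rfl⟩
    -- The only further edge that can start on the walk is the chord cutting the 1×2 rectangle into
    -- two squares. Its far end has the position of the vertex four places after the tail of the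
    -- j-th dart, hence is that vertex.
    · refine ⟨j + 4, h.1 ?_⟩
      have hsum := (hc.shift j).sum_of_straight (fun i => hR (j + i)) h1
      have e1 := snd_iterate d j
      have e2 := snd_iterate d (j + 1)
      have e3 := snd_iterate d (j + 1 + 1)
      have e4 := snd_iterate d (j + 1 + 1 + 1)
      change _ = (G.next^[j + 4] d).fst at e4
      rw [← e4, pos_snd pos, ← e3, pos_snd pos, ← e2, pos_snd pos, ← e1, ← hj, pos_snd pos,
        ← h.unitVec_dartHeading e, h2]
      simp only [h.unitVec_dartHeading] at hsum
      have hsum' : dartVec pos (G.next^[j + 1] d) + dartVec pos (G.next^[j + 1 + 1] d) +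
        dartVec pos (G.next^[j + 1 + 1 + 1] d) = unitVec (dartHeading pos (G.next^[j] d) + 3) := hsum
      rw [← hsum']
      abel
  have hbd : Bornology.IsBounded (leftFace pos d) := by
    by_contra hn
    exact hd ((hp.2 d).1 hn)
  -- All vertices are on the walk, hence on or to the right of the line through `d`, although the
  -- face to the left of `d` is internal and must be bounded.
  refine not_isBounded_leftFace h d (fun v => ?_) hbd
  obtain ⟨i, rfl⟩ := hS v
  obtain ⟨j, hj, hij⟩ := (G.sameFace_iterate d i).exists_iterate
  rw [← hij, leftDist_eq_cross, pos_iterate_fst pos, add_sub_cancel_left]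
  have := hc.cross_nonpos_of_right hR hj
  simpa only [h.unitVec_dartHeading, Function.iterate_zero, id] using this

namespace PlaneGraph

open Classical in
/-- The opposite dart on the boundary of a face of degree four or six. -/
noncomputable def opp (G : PlaneGraph n) (d : G.graph.Dart) : G.graph.Dart :=
  if G.next^[4] d = d then G.next^[2] d else G.next^[3] d

theorem sameFace_opp (G : PlaneGraph n) (d : G.graph.Dart) : G.SameFace d (G.opp d) := by
  unfold opp; split_ifs <;> exact G.sameFace_iterate _ _

theorem next_iterate_injective (G : PlaneGraph n) (i : ℕ) : Function.Injective G.next^[i] :=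
  G.next.injective.iterate i

theorem opp_opp_of_four {G : PlaneGraph n} {d : G.graph.Dart} (h : G.period d = 4) :
    G.opp d = G.next^[2] d ∧ G.opp (G.opp d) = d := by
  have h4 : G.next^[4] d = d := by rw [← h]; exact G.iterate_period d
  have h1 : G.opp d = G.next^[2] d := if_pos h4
  refine ⟨h1, ?_⟩
  rw [h1, opp, if_pos, ← Function.iterate_add_apply, h4]
  rw [← Function.iterate_add_apply, add_comm, Function.iterate_add_apply, h4]

/-- Six does not divide four, so the test in the definition of `opp` tells the two degrees apart. -/
theorem opp_opp_of_six {G : PlaneGraph n} {d : G.graph.Dart} (h : G.period d = 6) :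
    G.opp d = G.next^[3] d ∧ G.opp (G.opp d) = d := by
  have h6 : G.next^[6] d = d := by rw [← h]; exact G.iterate_period d
  have h4 : ¬ G.next^[4] d = d := fun h4 => by
    have := Function.IsPeriodicPt.minimalPeriod_dvd (f := G.next) (x := d) (n := 4) h4
    rw [← period, h] at this
    omega
  have h1 : G.opp d = G.next^[3] d := if_neg h4
  refine ⟨h1, ?_⟩
  rw [h1, opp, if_neg, ← Function.iterate_add_apply, h6]
  rw [← Function.iterate_add_apply, add_comm, Function.iterate_add_apply]
  exact fun h' => h4 (G.next_iterate_injective 3 h')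

end PlaneGraph

/-- Opposite darts of an internal face of a drawing have opposite vectors; the opposite dart lies
to the left. -/
theorem opp_of_turnsLeft (h : IsUnitGridDrawing G.graph pos) {d : G.graph.Dart} (h6 : G.period d ≤ 6)
    (hL : ∀ i, TurnsLeft (dartHeading pos (G.next^[i] d)) (dartHeading pos (G.next^[i + 1] d))) :
    G.opp (G.opp d) = d ∧ dartVec pos (G.opp d) = -dartVec pos d ∧
      0 < leftDist pos d (pos (G.opp d).snd) := by
  have hneg : ∀ e : G.graph.Dart, dartHeading pos e = dartHeading pos d + 2 →
      dartVec pos e = -dartVec pos d := by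
    intro e he
    rw [← h.unitVec_dartHeading e, he, ← neg_unitVec, h.unitVec_dartHeading]
  simp only [leftDist_eq_cross]
  rcases (closedWalk h h6).opposite_of_left hL with ⟨h1, h2, h3⟩ | ⟨h1, h2, h3⟩
  · obtain ⟨o1, o2⟩ := PlaneGraph.opp_opp_of_four h1
    refine ⟨o2, hneg _ (by rw [o1]; exact h2), ?_⟩
    rw [o1, snd_iterate, pos_iterate_fst pos, add_sub_cancel_left]
    simpa only [h.unitVec_dartHeading, Function.iterate_zero, id] using h3
  · obtain ⟨o1, o2⟩ := PlaneGraph.opp_opp_of_six h1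
    refine ⟨o2, hneg _ (by rw [o1]; exact h2), ?_⟩
    rw [o1, snd_iterate, pos_iterate_fst pos, add_sub_cancel_left]
    simpa only [h.unitVec_dartHeading, Function.iterate_zero, id] using h3

/-- An internal face without right turns is bounded. -/
theorem isBounded_of_turnsLeft (h : IsUnitGridDrawing G.graph pos) (hr : PreservesRotation G pos)
    {d : G.graph.Dart} (h6 : G.period d ≤ 6)
    (hL : ∀ i, TurnsLeft (dartHeading pos (G.next^[i] d)) (dartHeading pos (G.next^[i + 1] d))) :
    Bornology.IsBounded (leftFace pos d) := by
  obtain ⟨i, l, hl, hrect⟩ := (closedWalk h h6).isRectangle_of_left hL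
  rw [← leftFace_eq_of_sameFace h hr (G.sameFace_iterate d i)]
  simp only [add_comm i, Function.iterate_add_apply] at hrect
  set e := G.next^[i] d with he
  set a := dartHeading pos e with ha
  obtain ⟨r1, r2, r3, r4⟩ := hrect
  simp only [Function.iterate_zero, id, ← ha] at r1 r2 r3 r4
  have hv : ∀ f b, dartHeading pos f = b → dartVec pos f = unitVec b := fun f b hf => by
    rw [← hf, h.unitVec_dartHeading]
  have p1 : ∀ j, j ≤ l → pos (G.next^[j] e).fst = pos e.fst + (j : ℤ) • unitVec a := by
    intro j
    induction j with
    | zero => intro _; simp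
    | succ j ih =>
      intro hj
      rw [← snd_iterate, pos_snd pos, ih (by omega), hv _ _ (r1 j (by omega))]
      push_cast; rw [add_smul, one_smul, add_assoc]
  have p2 : ∀ j, j ≤ l → pos (G.next^[l + 1 + j] e).fst =
      pos e.fst + ((l : ℤ) - j) • unitVec a + unitVec (a + 1) := by
    intro j
    induction j with
    | zero =>
      intro _
      rw [add_zero, ← snd_iterate, pos_snd pos, p1 l le_rfl, hv _ _ r2]
      simp
    | succ j ih =>
      intro hj
      rw [← add_assoc, ← snd_iterate, pos_snd pos, ih (by omega), hv _ _ (r3 j (by omega)), ← neg_unitVec]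
      push_cast; rw [← sub_sub, sub_smul ((l : ℤ) - j), one_smul]; abel
  have hea : dartVec pos e = unitVec a := (h.unitVec_dartHeading e).symm
  have hsymm : ∀ f b, dartHeading pos f = b + 2 → dartVec pos f.symm = unitVec b := fun f b hf => by
    rw [dartVec_symm, hv f _ hf, ← neg_unitVec, neg_neg]
  refine isBounded_leftFace h e (l := l) (by exact_mod_cast hl) ?_ ?_ ?_ ?_
  · intro j h0 h1
    lift j to ℕ using h0
    have hj : j < l := by exact_mod_cast h1
    exact ⟨G.next^[j] e, by rw [hea, p1 j hj.le], by rw [hea, hv _ _ (r1 j hj)]⟩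
  · intro j h0 h1
    lift j to ℕ using h0
    have hj : j < l := by exact_mod_cast h1
    -- The upper side is walked backwards: over the j-th lower edge lies the reverse of the upper
    -- edge number l − 1 − j.
    refine ⟨(G.next^[l + 1 + (l - 1 - j)] e).symm, ?_, ?_⟩
    · change pos (G.next^[l + 1 + (l - 1 - j)] e).snd = _
      rw [snd_iterate, add_assoc, p2 _ (by omega), hea, quarterTurn_unitVec]
      congr 3
      omega
    · rw [hea]; exact hsymm _ _ (r3 _ (by omega))
  · refine ⟨(G.next^[l + 1 + l] e).symm, ?_, ?_⟩
    · change pos (G.next^[l + 1 + l] e).snd = _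
      rw [pos_snd pos, p2 l le_rfl, hv _ _ r4, show a + 3 = a + 1 + 2 from by rw [add_assoc]; rfl, ← neg_unitVec]
      simp
    · rw [hea, quarterTurn_unitVec]
      exact hsymm _ _ (r4.trans (by rw [add_assoc]; rfl))
  · refine ⟨G.next^[l] e, ?_, ?_⟩
    · rw [p1 l le_rfl, hea]
    · rw [hea, quarterTurn_unitVec, hv _ _ r2]

theorem PlaneGraph.exists_fst_eq (G : PlaneGraph n) (v : Fin n) : ∃ d : G.graph.Dart, d.fst = v :=
  G.eq_univ_of_adj (S := {w | ∃ d : G.graph.Dart, d.fst = w}) ⟨G.outer, rfl⟩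
    (fun d _ => ⟨d.symm, rfl⟩) v

/-- Some dart of a drawing has all the vertices on its right. -/
theorem exists_extremal (hb : G.Biconnected) (h : IsUnitGridDrawing G.graph pos) :
    ∃ d : G.graph.Dart, ∀ v, leftDist pos d (pos v) ≤ 0 := by
  by_cases hrot : ∃ d, G.rot d = d
  · obtain ⟨d, hd⟩ := hrot
    refine ⟨d, fun v => ?_⟩
    rcases G.eq_or_eq_of_rot_eq hb hd v with rfl | rfl
    · simp [leftDist]
    · refine le_of_eq ?_
      rw [leftDist_eq_cross, pos_snd pos, add_sub_cancel_left, cross]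
      ring
  push Not at hrot
  have : Nonempty (Fin n) := ⟨G.outer.fst⟩
  -- A horizontal edge at a highest vertex, directed to the right, has everything on or below its
  -- line. No edge goes up from such a vertex, so it is enough to find a dart there that does not
  -- point down.
  obtain ⟨v, hv⟩ := Finite.exists_max fun v => (pos v).2
  obtain ⟨d, rfl⟩ := G.exists_fst_eq v
  have horiz : ∀ e : G.graph.Dart, (pos e.fst).2 = (pos d.fst).2 → dartVec pos e = (1, 0) →
      ∀ v, leftDist pos e (pos v) ≤ 0 := by
    intro e h1 h2 w
    rw [leftDist, h1, h2]
    have := hv w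
    simp only
    linarith
  have horiz' : ∀ e : G.graph.Dart, e.fst = d.fst → dartVec pos e ≠ (0, -1) →
      ∃ d : G.graph.Dart, ∀ v, leftDist pos d (pos v) ≤ 0 := by
    intro e h1 h2
    have hs := congrArg Prod.snd (pos_snd pos e)
    have hm := hv e.snd
    rw [h1] at hs
    rw [Prod.snd_add] at hs
    rcases int_sq_add_sq_eq_one (h.isUnitVec e) with ⟨a, b⟩ | ⟨a, b⟩ | ⟨a, b⟩ | ⟨a, b⟩
    · exact ⟨e, horiz e (by rw [h1]) (Prod.ext a b)⟩
    · refine ⟨e.symm, horiz e.symm ?_ ?_⟩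
      · change (pos e.snd).2 = _
        rw [hs, b, add_zero]
      · rw [dartVec_symm]; exact Prod.ext (by simp [a]) (by simp [b])
    · omega
    · exact absurd (Prod.ext a b) h2
  -- Of two different darts at the vertex, at most one points down, and here no vertex has degree
  -- one.
  by_cases hd : dartVec pos d = (0, -1)
  · refine horiz' (G.rot d) (G.rot_fst d) fun h' => hrot d (h.dart_ext (by rw [G.rot_fst]) ?_)
    rw [h', hd]
  · exact horiz' d rfl hd

variable {n k : ℕ}

/-! ### The instance as a table -/

theorem OuterDrawing.posD_of_mem {G : PlaneGraph n} (Γ : OuterDrawing G) {v : Fin n}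
    (hv : v ∈ G.outerVertices) : Γ.posD v = Γ.pos ⟨v, hv⟩ := by
  unfold OuterDrawing.posD; exact dif_pos hv

theorem PlaneGraph.OnOuter.fst_mem {G : PlaneGraph n} {d : G.graph.Dart} (hd : G.OnOuter d) :
    d.fst ∈ G.outerVertices := ⟨d, hd, rfl⟩

theorem PlaneGraph.OnOuter.snd_mem {G : PlaneGraph n} {d : G.graph.Dart} (hd : G.OnOuter d) :
    d.snd ∈ G.outerVertices :=
  ⟨G.next d, (G.onOuter_iterate 1).2 hd, G.next_fst d⟩

/-- The table of an instance. -/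
noncomputable def instanceTable (G : PlaneGraph n) (Γ : OuterDrawing G) (num : G.graph.Dart ≃ Fin k) :
    Table G.graph.Dart n k where
  num := num
  rev := SimpleGraph.Dart.symm
  rot := G.rot
  tail d := d.fst
  out := G.outer
  px v := (Γ.posD v).1
  py v := (Γ.posD v).2

/-- The word that represents a grid vector. -/
def gridCode (n : ℕ) (w : ℤ × ℤ) : ℤ := (4 * n + 1) * w.1 + w.2

theorem gridCode_add (w w' : ℤ × ℤ) : gridCode n (w + w') = gridCode n w + gridCode n w' := by
  simp only [gridCode, Prod.fst_add, Prod.snd_add]; ring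

theorem gridCode_neg (w : ℤ × ℤ) : gridCode n (-w) = -gridCode n w := by
  simp only [gridCode, Prod.fst_neg, Prod.snd_neg]; ring

theorem gridCode_sub (w w' : ℤ × ℤ) : gridCode n (w - w') = gridCode n w - gridCode n w' := by
  rw [sub_eq_add_neg, gridCode_add, gridCode_neg, ← sub_eq_add_neg]

/-- The ordinate is divisible by 4n+1 but smaller in absolute value, so it vanishes, and then so
does the abscissa. -/
theorem eq_zero_of_gridCode {w : ℤ × ℤ} (h : gridCode n w = 0) (hw : |w.2| ≤ 4 * n) : w = 0 := by
  unfold gridCode at h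
  have h2 : w.2 = 0 := Int.eq_zero_of_abs_lt_dvd (m := 4 * n + 1) ⟨-w.1, by linarith⟩ (by omega)
  have h1 : w.1 = 0 := by
    rw [h2, add_zero, mul_eq_zero] at h
    exact h.resolve_left (by omega)
  exact Prod.ext h1 h2

section Instance

variable {G : PlaneGraph n} {Γ : OuterDrawing G} {num : G.graph.Dart ≃ Fin k}

local notation "𝓣" => instanceTable G Γ num

theorem instanceTable_base : (𝓣).base = 4 * n + 1 := by
  unfold Table.base; ring

theorem card_dart (num : G.graph.Dart ≃ Fin k) : Nat.card G.graph.Dart = k := by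
  rw [Nat.card_congr num, Nat.card_fin]

theorem two_le (G : PlaneGraph n) : 2 ≤ n := by
  have h1 := G.outer.fst.isLt
  have h2 := G.outer.snd.isLt
  have h3 : (G.outer.fst : ℕ) ≠ G.outer.snd := fun h => G.outer.adj.ne (Fin.ext h)
  omega

/-- The boundary walk of the outer face closes after at most k steps, as k is the number of all
darts. -/
theorem instanceTable_outer {d : G.graph.Dart} : (𝓣).Outer d ↔ G.OnOuter d := by
  constructor
  · rintro ⟨i, -, rfl⟩
    exact (G.onOuter_iterate i).2 (Equiv.Perm.SameCycle.refl _ _)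
  · intro h
    obtain ⟨i, hi, rfl⟩ := PlaneGraph.SameFace.exists_iterate h
    refine ⟨i, hi.trans_le ((G.period_le_faceDegree _).trans ?_), rfl⟩
    rw [← card_dart num]
    exact Set.ncard_le_card _

theorem instanceTable_transport {d : G.graph.Dart} (hd : ¬ G.OnOuter d) :
    (𝓣).transport d = (G.opp d).symm := by
  unfold Table.transport PlaneGraph.opp
  rw [if_neg (instanceTable_outer.not.2 hd)]
  by_cases h4 : G.next^[4] d = d
  · rw [if_pos h4]; exact if_pos h4
  · rw [if_neg h4]; exact if_neg h4

theorem instanceTable_transport_outer {d : G.graph.Dart} (hd : G.OnOuter d) : (𝓣).transport d = d :=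
  if_pos (instanceTable_outer.2 hd)

theorem isUnitVec_posD {d : G.graph.Dart} (hd : G.OnOuter d) : IsUnitVec (dartVec Γ.posD d) := by
  have := Γ.unit ⟨_, hd.fst_mem⟩ ⟨_, hd.snd_mem⟩ ⟨d, hd, rfl, rfl⟩
  unfold UnitDist at this
  unfold IsUnitVec dartVec
  rw [Γ.posD_of_mem hd.fst_mem, Γ.posD_of_mem hd.snd_mem]
  simp only [Prod.fst_sub, Prod.snd_sub]
  nlinarith

theorem instanceTable_given {d : G.graph.Dart} (hd : G.OnOuter d) :
    (𝓣).given d = gridCode n (dartVec Γ.posD d) := by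
  unfold Table.given gridCode
  rw [instanceTable_base]
  change (if (dartVec Γ.posD d).1 = 1 then _ else if (dartVec Γ.posD d).1 = -1 then _ else
    (dartVec Γ.posD d).2) = _
  rcases int_sq_add_sq_eq_one (isUnitVec_posD (Γ := Γ) hd) with ⟨a, b⟩ | ⟨a, b⟩ | ⟨a, b⟩ | ⟨a, b⟩ <;>
    rw [a, b] <;> norm_num

theorem instanceTable_isDir {v : ℤ} : (𝓣).IsDir v ↔ ∃ a, v = gridCode n (unitVec a) := by
  unfold Table.IsDir gridCode
  rw [instanceTable_base]
  constructor
  · rintro (rfl | rfl | rfl | rfl)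
    · exact ⟨0, by simp [unitVec]⟩
    · exact ⟨1, by simp [unitVec]⟩
    · exact ⟨2, by simp [unitVec]⟩
    · exact ⟨3, by simp [unitVec]⟩
  · rintro ⟨a, rfl⟩
    fin_cases a <;> simp [unitVec]

theorem instanceTable_dir (a : Fin 4) : (𝓣).dir (gridCode n (unitVec a)) = (a : ℕ) := by
  unfold Table.dir gridCode
  rw [instanceTable_base]
  have h2 := two_le G
  fin_cases a <;> simp [unitVec] <;> omega

theorem turn_aux (a b : Fin 4) :
    1 ≤ (if 0 < ((b : ℕ) : ℤ) - (a : ℕ) then ((b : ℕ) : ℤ) - (a : ℕ) else ((b : ℕ) : ℤ) - (a : ℕ) + 4) ∧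
    (if 0 < ((b : ℕ) : ℤ) - (a : ℕ) then ((b : ℕ) : ℤ) - (a : ℕ) else ((b : ℕ) : ℤ) - (a : ℕ) + 4) ≤ 4 ∧
    ∀ l : ℕ, 1 ≤ l → l ≤ 4 → (b = a + Fin.ofNat 4 l ↔
      (if 0 < ((b : ℕ) : ℤ) - (a : ℕ) then ((b : ℕ) : ℤ) - (a : ℕ) else ((b : ℕ) : ℤ) - (a : ℕ) + 4) = l) := by
  refine ⟨?_, ?_, fun l h1 h2 => ?_⟩
  · revert a b; decide
  · revert a b; decide
  · interval_cases l <;> revert a b <;> decide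

theorem dir_aux (a c : Fin 4) {j : ℕ} (h1 : 1 ≤ j) (h3 : j ≤ 3) :
    (((a : ℕ) : ℤ) + j = (c : ℕ) ∨ ((a : ℕ) : ℤ) + j = (c : ℕ) + 4) ↔ c = a + Fin.ofNat 4 j := by
  interval_cases j <;> revert a c <;> decide

theorem turnsLeft_iff (a b : Fin 4) : TurnsLeft a b ↔ ((b : ℕ) : ℤ) - (a : ℕ) = 0 ∨
    ((b : ℕ) : ℤ) - (a : ℕ) = 1 ∨ ((b : ℕ) : ℤ) - (a : ℕ) = -3 := by
  revert a b; decide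

/-- The quarter turns between two headings determine a number from 1 to 4 uniquely, so the `k` of
`PreservesRotation` must be the computed turn. -/
theorem instanceTable_rotOk {pos : Fin n → ℤ × ℤ} (h : IsUnitGridDrawing G.graph pos)
    {vec : G.graph.Dart → ℤ} (hvec : ∀ d, vec d = gridCode n (dartVec pos d)) :
    (∀ d, (𝓣).RotOk vec d) ↔ PreservesRotation G pos := by
  rw [preservesRotation_iff h]
  have hdir : ∀ d, (𝓣).dir (vec d) = (dartHeading pos d : ℕ) := fun d => by
    rw [hvec, ← h.unitVec_dartHeading, instanceTable_dir]
  refine forall_congr' fun d => ?_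
  obtain ⟨t1, t4, ht⟩ := turn_aux (dartHeading pos d) (dartHeading pos (G.rot d))
  unfold Table.RotOk Table.turn
  simp only [hdir]
  change (∀ j : ℤ, 1 ≤ j → j < (if 0 < ((dartHeading pos (G.rot d) : ℕ) : ℤ) - (dartHeading pos d : ℕ) then
    ((dartHeading pos (G.rot d) : ℕ) : ℤ) - (dartHeading pos d : ℕ) else
    ((dartHeading pos (G.rot d) : ℕ) : ℤ) - (dartHeading pos d : ℕ) + 4) → _) ↔ _
  generalize (if 0 < ((dartHeading pos (G.rot d) : ℕ) : ℤ) - (dartHeading pos d : ℕ) then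
    ((dartHeading pos (G.rot d) : ℕ) : ℤ) - (dartHeading pos d : ℕ) else
    ((dartHeading pos (G.rot d) : ℕ) : ℤ) - (dartHeading pos d : ℕ) + 4) = t at *
  lift t to ℕ using by omega
  constructor
  · intro H
    refine ⟨t, by omega, by omega, (ht t (by omega) (by omega)).2 rfl, fun e he j h1 h2 h3 => ?_⟩
    exact H j (by omega) (by omega) ⟨e, he, (dir_aux _ _ h1 (by omega)).2 h3⟩
  · rintro ⟨l, h1, h4, hl, hno⟩ j hj hj' ⟨e, he, h'⟩
    have := (ht l h1 h4).1 hl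
    lift j to ℕ using by omega
    exact hno e he j (by omega) (by omega) ((dir_aux _ _ (by omega) (by omega)).1 h')

/-- Short walks keep ordinates small, so that codes can be decoded. -/
theorem exists_walk_length_lt (G : PlaneGraph n) (u v : Fin n) :
    ∃ p : G.graph.Walk u v, p.length < n := by
  classical
  obtain ⟨p⟩ := G.connected u v
  have := p.toPath.2.length_lt
  rw [Fintype.card_fin] at this
  exact ⟨_, this⟩

/-! ### The test is passed if there is a drawing -/

section Necessity

variable {pos : Fin n → ℤ × ℤ}

theorem abs_snd_sub_le (h : IsUnitGridDrawing G.graph pos) {u v : Fin n} (p : G.graph.Walk u v) :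
    |(pos v - pos u).2| ≤ p.length := by
  induction p with
  | nil => simp
  | @cons u w v hadj p ih =>
    have h1 := h.isUnitVec ⟨(u, w), hadj⟩
    unfold IsUnitVec at h1
    have h2 : |(pos w - pos u).2| ≤ 1 := by
      rw [abs_le]
      change (pos w - pos u).1 ^ 2 + (pos w - pos u).2 ^ 2 = 1 at h1
      constructor <;> nlinarith [sq_nonneg (pos w - pos u).1]
    have h3 : (pos v - pos u).2 = (pos v - pos w).2 + (pos w - pos u).2 := by
      simp only [Prod.snd_sub]; ring
    rw [h3, SimpleGraph.Walk.length_cons]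
    push_cast
    exact (abs_add_le _ _).trans (by linarith)

theorem abs_snd_sub_lt (h : IsUnitGridDrawing G.graph pos) (u v : Fin n) :
    |(pos v - pos u).2| < n := by
  obtain ⟨p, hp⟩ := exists_walk_length_lt G u v
  have := abs_snd_sub_le h p
  omega

variable (hb : G.Biconnected) (h6 : ∀ d : G.graph.Dart, ¬ G.OnOuter d → G.faceDegree d ≤ 6)
  (h : IsUnitGridDrawing G.graph pos) (hp : PreservesEmbedding G pos)
  (hΓ : ∀ v : G.outerVertices, pos v = Γ.pos v)

include hb h6 h hp in
theorem opp_of_internal {d : G.graph.Dart} (hd : ¬ G.OnOuter d) :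
    G.opp (G.opp d) = d ∧ dartVec pos (G.opp d) = -dartVec pos d ∧
      0 < leftDist pos d (pos (G.opp d).snd) :=
  have h' := (G.period_le_faceDegree d).trans (h6 d hd)
  opp_of_turnsLeft h h' (turnsLeft_of_internal hb h hp hd h')

include hΓ in
theorem given_eq {d : G.graph.Dart} (hd : G.OnOuter d) : (𝓣).given d = gridCode n (dartVec pos d) := by
  rw [instanceTable_given hd, dartVec, dartVec, Γ.posD_of_mem hd.fst_mem, Γ.posD_of_mem hd.snd_mem,
    ← hΓ, ← hΓ]

include hb h6 h hp hΓ in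
-- The opposite dart of an internal face has the opposite vector, so its reverse has the same vector
-- as `d`. Consequently all derivations agree, whatever the order of the search.
theorem VecDer_sound {d : G.graph.Dart} {v : ℤ} (hv : (𝓣).VecDer d v) :
    v = gridCode n (dartVec pos d) := by
  induction hv with
  | out d hd => exact given_eq hΓ (instanceTable_outer.1 hd)
  | rev d hd =>
    rw [given_eq hΓ (instanceTable_outer.1 hd), ← gridCode_neg, ← dartVec_symm]
    rfl
  | step d v _ ih =>
    by_cases hd : G.OnOuter d
    · rw [instanceTable_transport_outer hd, ih]
    · rw [instanceTable_transport hd, dartVec_symm, (opp_of_internal hb h6 h hp hd).2.1, neg_neg, ih]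

include hb h6 h hp in
/-- In a drawing every vector is determined by those on the outer face. -/
theorem mem_of_transport {S : Set G.graph.Dart} (h1 : ∀ d, G.OnOuter d → d ∈ S ∧ d.symm ∈ S)
    (h2 : ∀ d ∈ S, (𝓣).transport d ∈ S) (d : G.graph.Dart) : d ∈ S := by
  by_contra hd
  let w := dartVec pos d
  -- Take an unreached dart with vector w that lies farthest to the right. Its reverse is not on the
  -- outer face, because reverses of outer darts are reached.
  obtain ⟨e, ⟨he, hw⟩, hmin⟩ := Set.exists_min_image {e | e ∉ S ∧ dartVec pos e = w}
    (fun e => cross w (pos e.snd)) (Set.toFinite _) ⟨d, hd, rfl⟩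
  have hes : ¬ G.OnOuter e.symm := fun ho => he (by simpa using (h1 _ ho).2)
  obtain ⟨o1, o2, o3⟩ := opp_of_internal hb h6 h hp hes
  have hf : ¬ G.OnOuter (G.opp e.symm) := (G.onOuter_congr (G.sameFace_opp _)).not.1 hes
  -- Transport leads from this dart to `e`, so it is unreached as well; it has vector w and lies to
  -- the left of the reverse of `e`, that is, farther to the right.
  have hfS : G.opp e.symm ∉ S := by
    intro hf'
    have := h2 _ hf'
    rw [instanceTable_transport hf, o1, SimpleGraph.Dart.symm_symm] at this
    exact he this
  rw [dartVec_symm, neg_neg] at o2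
  have := hmin _ ⟨hfS, o2.trans hw⟩
  rw [leftDist_eq_cross, dartVec_symm, hw] at o3
  change 0 < cross (-w) (_ - pos e.snd) at o3
  simp only [cross, Prod.fst_neg, Prod.snd_neg, Prod.fst_sub, Prod.snd_sub] at this o3
  linarith

include hb h6 h hp hΓ in
theorem accepts_of_drawing {vec code : G.graph.Dart → ℤ} (hc : (𝓣).Computed vec code) :
    (𝓣).Accepts vec code := by
  obtain ⟨⟨S, hS1, hS2, hS3⟩, ⟨S', hS1', hS2', hS3'⟩⟩ := hc
  have hvec : ∀ d, vec d = gridCode n (dartVec pos d) := fun d =>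
    VecDer_sound hb h6 h hp hΓ (hS3 d (mem_of_transport hb h6 h hp
      (fun d hd => hS1 d (instanceTable_outer.2 hd)) hS2 d))
  have hder : ∀ d z, (𝓣).CodeDer vec d z → z = gridCode n (pos d.fst - pos G.outer.fst) := by
    intro d z hz
    induction hz with
    | out =>
      change 0 = gridCode n (pos G.outer.fst - pos G.outer.fst)
      simp [gridCode]
    | rev d z _ ih =>
      rw [ih, hvec, ← gridCode_add]
      change _ = gridCode n (pos d.snd - _)
      rw [pos_snd pos]
      congr 1
      abel
    | rot d z _ ih =>
      rw [ih]
      change _ = gridCode n (pos (G.rot d).fst - _)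
      rw [G.rot_fst]
  have hcode : ∀ d, code d = gridCode n (pos d.fst - pos G.outer.fst) := fun d =>
    hder d _ (hS3' d (G.forall_of_rev_rot hS1' hS2' d))
  have hdir : ∀ d, (𝓣).dir (vec d) = (dartHeading pos d : ℕ) := fun d => by
    rw [hvec, ← h.unitVec_dartHeading, instanceTable_dir]
  refine ⟨fun d => ?_, fun d => ⟨?_, ?_⟩, fun d => ⟨fun hd => ?_, fun hd => ?_⟩,
    (instanceTable_rotOk h hvec).2 hp.1, fun d e hde => ?_⟩
  · exact instanceTable_isDir.2 ⟨dartHeading pos d, by rw [hvec, h.unitVec_dartHeading]⟩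
  · rw [hcode, hcode, hvec, ← gridCode_add]
    change gridCode n (pos d.snd - _) = _
    rw [pos_snd pos]
    congr 1
    abel
  · rw [hcode, hcode]
    change gridCode n (pos (G.rot d).fst - _) = _
    rw [G.rot_fst]
  · rw [hvec, given_eq hΓ (instanceTable_outer.1 hd)]
  · have hd' : ¬ G.OnOuter d := instanceTable_outer.not.1 hd
    rw [hdir, hdir]
    have := turnsLeft_of_internal hb h hp hd' ((G.period_le_faceDegree d).trans (h6 d hd')) 0
    exact (turnsLeft_iff _ _).1 this
  · rw [hcode, hcode, ← sub_eq_zero, ← gridCode_sub, sub_sub_sub_cancel_right] at hde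
    have : |(pos ((𝓣).tail d) - pos ((𝓣).tail e)).2| < n := abs_snd_sub_lt h e.fst d.fst
    exact h.1 (sub_eq_zero.1 (eq_zero_of_gridCode hde (by omega)))

include h in
-- A dart is determined by its tail and one of four headings. This justifies rejecting instances
-- with more than 4n darts without reading further.
theorem card_le_of_drawing (num : G.graph.Dart ≃ Fin k) : k ≤ 4 * n := by
  have hinj : Function.Injective fun d : G.graph.Dart => (d.fst, dartHeading pos d) := by
    intro d e hde
    rw [Prod.mk.injEq] at hde
    exact h.eq_of_dartHeading hde.1 hde.2
  have := Nat.card_le_card_of_injective _ hinj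
  rw [card_dart num] at this
  simpa [mul_comm] using this

end Necessity

end Instance

variable {n k : ℕ} {G : PlaneGraph n} {Γ : OuterDrawing G} {num : G.graph.Dart ≃ Fin k}

local notation "𝓣" => instanceTable G Γ num

/-! ### There is a drawing if the test is passed -/

section Sufficiency

variable {vec code : G.graph.Dart → ℤ}

theorem code_eq_of_fst (hc : ∀ d, (𝓣).Consistent vec code d) {d e : G.graph.Dart}
    (hde : d.fst = e.fst) : code e = code d := by
  obtain ⟨i, rfl⟩ := ((G.rot_sameCycle d e).2 hde).exists_nat_pow_eq
  rw [← Equiv.Perm.iterate_eq_pow]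
  clear hde
  induction i with
  | zero => rfl
  | succ i ih => rw [Function.iterate_succ_apply', ← ih]; exact (hc _).2

/-- Position codes are plain integers at this point. Along a walk their difference is the code of a
sum of unit vectors, whose ordinate is at most the length of the walk. -/
theorem exists_gridCode_of_walk (hc : ∀ d, (𝓣).Consistent vec code d) {a : G.graph.Dart → Fin 4}
    (hv : ∀ d, vec d = gridCode n (unitVec (a d))) {u v : Fin n} (p : G.graph.Walk u v) :
    ∃ q : ℤ × ℤ, |q.2| ≤ p.length ∧ ∀ d e : G.graph.Dart, d.fst = u → e.fst = v →
      code e - code d = gridCode n q := by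
  induction p with
  | nil =>
    refine ⟨0, by simp, fun d e hd he => ?_⟩
    rw [code_eq_of_fst hc (hd.trans he.symm)]
    simp [gridCode]
  | @cons u w v hadj p ih =>
    obtain ⟨q, hq, hcode⟩ := ih
    let f : G.graph.Dart := ⟨(u, w), hadj⟩
    refine ⟨q + unitVec (a f), ?_, fun d e hd he => ?_⟩
    · have h1 : |(unitVec (a f)).2| ≤ 1 := by generalize a f = b; revert b; decide
      rw [SimpleGraph.Walk.length_cons]
      push_cast
      exact (abs_add_le _ _).trans (by linarith)
    · have h1 := hcode f.symm e rfl he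
      have h2 : code f.symm = code f + vec f := (hc f).1
      have h3 : code f = code d := code_eq_of_fst hc hd
      rw [gridCode_add, ← h1, ← hv]
      linarith

theorem eq_of_gridCode {w w' : ℤ × ℤ} (h : gridCode n w = gridCode n w') (hw : |w.2 - w'.2| ≤ 4 * n) :
    w = w' := by
  rw [← sub_eq_zero, ← gridCode_sub] at h
  exact sub_eq_zero.1 (eq_zero_of_gridCode h hw)

theorem IsUnitVec.abs_snd_le {w : ℤ × ℤ} (h : IsUnitVec w) : |w.2| ≤ 1 := by
  unfold IsUnitVec at h
  rw [abs_le]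
  constructor <;> nlinarith [sq_nonneg w.1]

/-- Each code is decoded by means of a walk with fewer than n edges from the root. For the two ends
of an edge the decoded difference and the unit vector have equal codes and small ordinates, so they
are equal; the choice of walks does not matter. -/
theorem exists_positions (hc : ∀ d, (𝓣).Consistent vec code d) {a : G.graph.Dart → Fin 4}
    (hv : ∀ d, vec d = gridCode n (unitVec (a d))) (p : ℤ × ℤ) : ∃ pos : Fin n → ℤ × ℤ,
      pos G.outer.fst = p ∧ (∀ d, dartVec pos d = unitVec (a d)) ∧
      ∀ d e : G.graph.Dart, pos d.fst = pos e.fst → code d = code e := by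
  have hex : ∀ v, ∃ q : ℤ × ℤ, |q.2| < n ∧ ∀ e : G.graph.Dart, e.fst = v →
      code e - code G.outer = gridCode n q := fun v => by
    obtain ⟨w, hw⟩ := exists_walk_length_lt G G.outer.fst v
    obtain ⟨q, h1, h2⟩ := exists_gridCode_of_walk hc hv w
    exact ⟨q, by omega, fun e he => h2 _ e rfl he⟩
  choose q hq hcode using hex
  refine ⟨fun v => q v + (p - q G.outer.fst), by simp, fun d => ?_, fun d e hde => ?_⟩
  · have h1 := hcode _ d rfl
    have h2 := hcode _ d.symm rfl
    have h3 : code d.symm = code d + vec d := (hc d).1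
    have h4 : dartVec (fun v => q v + (p - q G.outer.fst)) d = q d.snd - q d.fst := by
      simp [dartVec]
    rw [h4]
    refine eq_of_gridCode (n := n) ?_ ?_
    · rw [gridCode_sub, ← h1, ← hv]
      change _ - _ = gridCode n (q d.snd) at h2
      rw [← h2]
      linarith
    · have b1 := (isUnitVec_unitVec (a d)).abs_snd_le
      have b2 := hq d.snd
      have b3 := hq d.fst
      rw [abs_le] at b1 ⊢
      rw [abs_lt] at b2 b3
      rw [Prod.snd_sub]
      constructor <;> linarith [b1.1, b1.2, b2.1, b2.2, b3.1, b3.2]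
  · have h1 := hcode _ d rfl
    have h2 := hcode _ e rfl
    rw [add_left_inj] at hde
    rw [hde, ← h2] at h1
    linarith

/-- The outer face has to be recognized without tracing its boundary: all internal faces are bounded
rectangles, so the dart with the whole drawing on its right lies on the outer face and shows that
face to be unbounded. -/
theorem hasDrawing_of_accepts (hb : G.Biconnected)
    (h6 : ∀ d : G.graph.Dart, ¬ G.OnOuter d → G.faceDegree d ≤ 6) (ha : (𝓣).Accepts vec code) :
    HasDrawing G Γ := by
  obtain ⟨hdir, hc, hf, hr, hinj⟩ := ha
  choose a hv using fun d => instanceTable_isDir.1 (hdir d)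
  obtain ⟨pos, hout, hpos, hcode⟩ := exists_positions hc hv (Γ.posD G.outer.fst)
  have hvec : ∀ d, vec d = gridCode n (dartVec pos d) := fun d => by rw [hpos, hv]
  have hunit : ∀ d : G.graph.Dart, IsUnitVec (dartVec pos d) := fun d => by
    rw [hpos]; exact isUnitVec_unitVec _
  have h : IsUnitGridDrawing G.graph pos := by
    refine ⟨fun u v huv => ?_, fun u v huv => ?_⟩
    · obtain ⟨d, rfl⟩ := G.exists_fst_eq u
      obtain ⟨e, rfl⟩ := G.exists_fst_eq v
      exact hinj d e (hcode d e huv)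
    · have := hunit ⟨(u, v), huv⟩
      unfold IsUnitVec dartVec at this
      unfold UnitDist
      simp only [Prod.fst_sub, Prod.snd_sub] at this
      nlinarith
  have hpr : PreservesRotation G pos := (instanceTable_rotOk h hvec).1 hr
  have hhead : ∀ d, (𝓣).dir (vec d) = (dartHeading pos d : ℕ) := fun d => by
    rw [hvec, ← h.unitVec_dartHeading, instanceTable_dir]
  have hint : ∀ d, ¬ G.OnOuter d → Bornology.IsBounded (leftFace pos d) := by
    intro d hd
    refine isBounded_of_turnsLeft h hpr ((G.period_le_faceDegree d).trans (h6 d hd)) fun i => ?_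
    have := (hf (G.next^[i] d)).2 (instanceTable_outer.not.2 ((G.onOuter_iterate i).not.2 hd))
    rw [hhead, hhead] at this
    rw [turnsLeft_iff, Function.iterate_succ_apply']
    exact this
  obtain ⟨e, he⟩ := exists_extremal hb h
  have hunb := not_isBounded_leftFace h e he
  have heo : G.OnOuter e := by
    by_contra hn
    exact hunb (hint e hn)
  refine ⟨pos, h, ⟨hpr, fun d => ⟨fun hd => ?_, fun hd => ?_⟩⟩, ?_⟩
  · by_contra hn
    exact hd (hint d hn)
  · rwa [leftFace_eq_of_sameFace h hpr (Equiv.Perm.SameCycle.trans (Equiv.Perm.SameCycle.symm heo) hd)]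
  -- The drawing is anchored at the prescribed position of one outer vertex and has the prescribed
  -- vectors along the outer walk, so by induction it has all the prescribed positions.
  · have key : ∀ i, pos (G.next^[i] G.outer).fst = Γ.posD (G.next^[i] G.outer).fst := by
      intro i
      induction i with
      | zero => exact hout
      | succ i ih =>
        have ho : G.OnOuter (G.next^[i] G.outer) := G.sameFace_iterate _ i
        have hg := (hf (G.next^[i] G.outer)).1 (instanceTable_outer.2 ho)
        rw [instanceTable_given ho, hvec] at hg
        have b1 := (hunit (G.next^[i] G.outer)).abs_snd_le
        have b2 := (isUnitVec_posD (Γ := Γ) ho).abs_snd_le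
        have h2 := two_le G
        rw [abs_le] at b1 b2
        have hw := eq_of_gridCode hg (by rw [abs_le]; constructor <;> omega)
        rw [← snd_iterate, pos_snd pos, pos_snd Γ.posD, ih, hw]
    rintro ⟨v, hv⟩
    obtain ⟨d, hd, rfl⟩ := id hv
    rw [← Γ.posD_of_mem hv]
    obtain ⟨i, -, rfl⟩ := PlaneGraph.SameFace.exists_iterate hd
    exact key i

end Sufficiency

theorem Runs.mono {B B' : ℕ} (hB : B ≤ B') {p : Prog} {s s' : State} {t : ℕ} (h : Runs B p s t s') :
    Runs B' p s t s' := by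
  have hZ : (B : ℤ) ≤ B' := by exact_mod_cast hB
  induction h with
  | skip s => exact .skip s
  | const s r z h => exact .const s r z (h.trans hZ)
  | add s r a b h => exact .add s r a b (h.trans hZ)
  | sub s r a b h => exact .sub s r a b (h.trans hZ)
  | load s r a h => exact .load s r a (h.trans hZ)
  | store s a b => exact .store s a b
  | seq _ _ h1 h2 => exact .seq h1 h2
  | ite_true hb _ h => exact .ite_true hb h
  | ite_false hb _ h => exact .ite_false hb h
  | while_true hb _ _ h1 h2 => exact .while_true hb h1 h2
  | while_false hb => exact .while_false hb

/-! ### The input -/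

theorem getD_append_ofFn {m : ℕ} (l r : List ℤ) (f : Fin m → ℤ) (i : Fin m) :
    (l ++ List.ofFn f ++ r).getD (l.length + i) 0 = f i := by
  rw [List.append_assoc, List.getD_append_right _ _ _ _ (Nat.le_add_right _ _), Nat.add_sub_cancel_left,
    List.getD_append _ _ _ _ (by simp), List.getD_eq_getElem _ _ (by simp)]
  simp

section Instance

variable {n k : ℕ} (G : PlaneGraph n) (Γ : OuterDrawing G) (num : G.graph.Dart ≃ Fin k)

theorem encode_length : (encode G Γ num).length = 3 + k + k + k + n + n := by
  simp [encode, List.length_append]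
  ring

/-- The contents of the nonnegative memory cells at the start. -/
noncomputable def inputWords : ℤ → ℤ := (State.init (encode G Γ num)).mem

theorem inputWords_natCast (j : ℕ) : inputWords G Γ num j = (encode G Γ num).getD j 0 := by
  simp [inputWords, State.init]

theorem abs_inputWords_le {W : ℕ} (hW : FitsIn (encode G Γ num) W) (j : ℤ) :
    |inputWords G Γ num j| ≤ W := by
  unfold inputWords State.init
  simp only
  split_ifs with h
  · by_cases hj : j.toNat < (encode G Γ num).length
    · rw [List.getD_eq_getElem _ _ hj]
      exact hW.2 _ (List.getElem_mem hj)
    · rw [List.getD_eq_default _ _ (not_lt.1 hj)]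
      simp
  · simp

theorem inputWords_eq {m : ℕ} {l r : List ℤ} {f : Fin m → ℤ}
    (h : encode G Γ num = l ++ List.ofFn f ++ r) (i : Fin m) {j : ℤ} (hj : j = l.length + (i : ℕ)) :
    inputWords G Γ num j = f i := by
  rw [hj, ← Nat.cast_add, inputWords_natCast, h, getD_append_ofFn]

theorem instanceTable_reads : (instanceTable G Γ num).Reads (inputWords G Γ num) := by
  have hix : ∀ d, (instanceTable G Γ num).ix d = (num d : ℕ) := fun _ => rfl
  refine ⟨?_, ?_, ?_, fun d => ?_, fun d => ?_, fun d => ?_, fun v => ?_, fun v => ?_⟩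
  · exact inputWords_natCast G Γ num 0
  · exact inputWords_natCast G Γ num 1
  · exact inputWords_natCast G Γ num 2
  · refine (inputWords_eq G Γ num (l := [(n : ℤ), (k : ℤ), ((num G.outer : ℕ) : ℤ)])
      (by rw [encode, List.append_assoc, List.append_assoc, List.append_assoc]) (num d) ?_).trans ?_
    · simp [hix]
    · rw [Equiv.symm_apply_apply]; rfl
  · refine (inputWords_eq G Γ num (l := [(n : ℤ), (k : ℤ), ((num G.outer : ℕ) : ℤ)] ++
      List.ofFn (fun i : Fin k => (((num.symm i).fst : ℕ) : ℤ)))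
      (by rw [encode, List.append_assoc, List.append_assoc]) (num d) ?_).trans ?_
    · simp [hix]; ring
    · rw [Equiv.symm_apply_apply]; rfl
  · refine (inputWords_eq G Γ num (l := [(n : ℤ), (k : ℤ), ((num G.outer : ℕ) : ℤ)] ++
      List.ofFn (fun i : Fin k => (((num.symm i).fst : ℕ) : ℤ)) ++
      List.ofFn (fun i : Fin k => ((num (num.symm i).symm : ℕ) : ℤ)))
      (by rw [encode, List.append_assoc]) (num d) ?_).trans ?_
    · simp [hix]; ring
    · rw [Equiv.symm_apply_apply]; rfl
  · refine (inputWords_eq G Γ num (l := [(n : ℤ), (k : ℤ), ((num G.outer : ℕ) : ℤ)] ++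
      List.ofFn (fun i : Fin k => (((num.symm i).fst : ℕ) : ℤ)) ++
      List.ofFn (fun i : Fin k => ((num (num.symm i).symm : ℕ) : ℤ)) ++
      List.ofFn (fun i : Fin k => ((num (G.rot (num.symm i)) : ℕ) : ℤ)))
      (by rw [encode]) v ?_).trans ?_
    · simp; ring
    · rfl
  · refine (inputWords_eq G Γ num (l := [(n : ℤ), (k : ℤ), ((num G.outer : ℕ) : ℤ)] ++
      List.ofFn (fun i : Fin k => (((num.symm i).fst : ℕ) : ℤ)) ++
      List.ofFn (fun i : Fin k => ((num (num.symm i).symm : ℕ) : ℤ)) ++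
      List.ofFn (fun i : Fin k => ((num (G.rot (num.symm i)) : ℕ) : ℤ)) ++
      List.ofFn (fun v : Fin n => (Γ.posD v).1)) (r := [])
      (by rw [encode, List.append_nil]) v ?_).trans ?_
    · simp; ring
    · rfl

theorem rep_init : Rep (inputWords G Γ num) ⟨fun _ => 0, fun _ _ => 0⟩
    (State.init (encode G Γ num)) := by
  refine ⟨fun _ _ => rfl, fun _ _ => rfl, fun a ha j hj => ?_⟩
  have : ¬ 0 ≤ addr a j := by unfold addr; omega
  exact if_neg this

theorem exists_fitsIn (l : List ℤ) : ∃ W, FitsIn l W := by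
  refine ⟨l.length + (l.map Int.natAbs).sum, by omega, fun z hz => ?_⟩
  have := List.single_le_sum (fun _ _ => Nat.zero_le _) _ (List.mem_map_of_mem (f := Int.natAbs) hz)
  rw [Int.abs_eq_natAbs]
  omega

open Prg in
/-- The outcome of the program. -/
theorem program_runs (hb : G.Biconnected)
    (h6 : ∀ d : G.graph.Dart, ¬ G.OnOuter d → G.faceDegree d ≤ 6) {N : ℕ}
    (hI : ∀ j, |inputWords G Γ num j| ≤ N) (hN : (k + 1) * (n + n + n + n + 1) ≤ N) :
    ∃ (t : ℕ) (s : State), t ≤ program.time (4 * n) ∧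
      Runs (program.growth * (N + 1)) program.code (State.init (encode G Γ num)) t s ∧
      (HasDrawing G Γ → s.reg 0 = 1) ∧ (¬ HasDrawing G Γ → s.reg 0 = 0) := by
  have hR := instanceTable_reads G Γ num
  have hkN : k ≤ N := by nlinarith
  have hnN : n ≤ N := by nlinarith
  have hwp : program.wp (inputWords G Γ num) N (4 * n) (fun σ =>
      (HasDrawing G Γ → σ.var 0 = 1) ∧ (¬ HasDrawing G Γ → σ.var 0 = 0)) ⟨fun _ => 0, fun _ _ => 0⟩ := by
    have e0 := hR.zero
    have e1 := hR.one
    simp only [program, Cmd.wp, Expr.Ok, Expr.eval, Cond.lhs, Cond.rhs, Cond.Holds, e0, e1,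
      HState.setVar, Nat.abs_cast, true_and, le_refl, zero_le_one, and_true]
    refine ⟨by exact_mod_cast hnN, by exact_mod_cast hkN, fun hlt => ?_, fun hlt => ?_⟩
    -- With more than 4n darts the program stops with variable `0` still zero.
    · refine ⟨fun ⟨pos, h, _⟩ => ?_, fun _ => by simp⟩
      have := card_le_of_drawing h num
      simp at hlt
      omega
    · have hk : k ≤ 4 * n := by simp at hlt; omega
      have H : (instanceTable G Γ num).Setup (inputWords G Γ num) N (4 * n) := by
        refine ⟨hR, hk, hN, fun d hd => ?_⟩
        have hd' : G.OnOuter d := instanceTable_outer.1 hd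
        have h1 := isUnitVec_posD (Γ := Γ) hd'
        have := (instanceTable_isDir (G := G) (Γ := Γ) (num := num)).2
          ⟨heading (dartVec Γ.posD d), rfl⟩
        rw [h1.unitVec_heading, ← instanceTable_given (num := num) hd'] at this
        unfold Table.IsDir at this
        tauto
      refine Cmd.wp_mono (H.main_wp ?_ ?_ ?_ ?_ ?_) ?_
      · simp
      · simp
      · simp
      · simp
      · simp
      · rintro σ ⟨vec, code, hc, h0⟩
        refine ⟨fun ⟨pos, h, hp, hΓ⟩ => ?_, fun hn => ?_⟩
        · rw [h0, if_pos (accepts_of_drawing hb h6 h hp hΓ hc)]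
        · rw [h0, if_neg fun ha => hn (hasDrawing_of_accepts hb h6 ha)]
  have hbdd : Bdd N ⟨fun _ => 0, fun _ _ => 0⟩ := ⟨fun _ => by simp, fun _ _ => by simp⟩
  obtain ⟨t, s, σ, hrun, ht, -, hrep, hQ1, hQ2⟩ := Cmd.wp_sound hI program program_WF le_rfl hbdd hwp _
    (rep_init G Γ num)
  exact ⟨t, s, ht, hrun, fun h => by rw [hrep.var 0 (by norm_num), hQ1 h],
    fun h => by rw [hrep.var 0 (by norm_num), hQ2 h]⟩

end Instance

/-- A constant factor is absorbed into the exponent, as 6a is less than the power W^(6a) of a base W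
≥ 2. -/
theorem growth_le_pow (a : ℕ) {W m : ℕ} (hW : 2 ≤ W) (hm : m ≤ 6 * W ^ 2) : a * m ≤ W ^ (6 * a + 2) := by
  have h1 : 6 * a ≤ W ^ (6 * a) := (Nat.lt_pow_self hW).le
  calc a * m ≤ a * (6 * W ^ 2) := Nat.mul_le_mul_left _ hm
    _ = 6 * a * W ^ 2 := by ring
    _ ≤ W ^ (6 * a) * W ^ 2 := Nat.mul_le_mul_right _ h1
    _ = W ^ (6 * a + 2) := (pow_add _ _ _).symm

end UnitGrid

theorem corollary2 :
    ∃ (P : UnitGrid.Prog) (c : ℕ),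
      ∀ (n : ℕ) (G : UnitGrid.PlaneGraph n) (Γ : UnitGrid.OuterDrawing G)
        (k : ℕ) (num : G.graph.Dart ≃ Fin k),
        G.Biconnected →
        (∀ d : G.graph.Dart, ¬ G.OnOuter d → G.faceDegree d ≤ 6) →
        ∃ (t : ℕ) (s : UnitGrid.State),
          t ≤ c * n ∧
          (∀ W : ℕ, UnitGrid.FitsIn (UnitGrid.encode G Γ num) W →
            UnitGrid.Runs (W ^ c) P (UnitGrid.State.init (UnitGrid.encode G Γ num)) t s) ∧
          (UnitGrid.HasDrawing G Γ → s.reg 0 = 1) ∧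
          (¬ UnitGrid.HasDrawing G Γ → s.reg 0 = 0) := by
  refine ⟨UnitGrid.Prg.program.code,
    -- One constant serves as exponent of the word bound and as factor in the time bound; the 5
    -- comes from 4n + 1 ≤ 5n.
    6 * UnitGrid.Prg.program.growth + 2 + 5 * UnitGrid.Prg.program.time 1, fun n G Γ k num hb h6 => ?_⟩
  classical
  -- The time and the final state must not depend on W. So the run is obtained for the least
  -- admissible value `W₀`, and the word bound is weakened afterwards.
  have hex := UnitGrid.exists_fitsIn (UnitGrid.encode G Γ num)
  have hfit := Nat.find_spec hex
  set W₀ := Nat.find hex with hW₀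
  have hlen : 3 + k + k + k + n + n ≤ W₀ := by rw [← UnitGrid.encode_length G Γ num]; exact hfit.1
  obtain ⟨t, s, ht, hrun, h1, h2⟩ := UnitGrid.program_runs G Γ num hb h6
    (N := W₀ + (k + 1) * (n + n + n + n + 1))
    (fun j => (UnitGrid.abs_inputWords_le G Γ num hfit j).trans (by exact_mod_cast Nat.le_add_right _ _)) (by omega)
  have h2n := UnitGrid.two_le G
  refine ⟨t, s, ?_, fun W hW => hrun.mono ?_, h1, h2⟩
  · have h3 := UnitGrid.Cmd.time_le UnitGrid.Prg.program_flat (4 * n)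
    have h4 : UnitGrid.Prg.program.time 1 * (4 * n + 1) ≤ UnitGrid.Prg.program.time 1 * (5 * n) :=
      Nat.mul_le_mul_left _ (by omega)
    nlinarith
  · have hle : W₀ ≤ W := Nat.find_min' hex hW
    -- Both k and n are at most the number of input words, so the position codes are of order W².
    have h3 : W₀ + (k + 1) * (n + n + n + n + 1) + 1 ≤ 6 * W ^ 2 := by
      have h4 : (k + 1) * (n + n + n + n + 1) ≤ W * (4 * W) := Nat.mul_le_mul (by omega) (by omega)
      nlinarith
    exact (UnitGrid.growth_le_pow _ (by omega) h3).trans (Nat.pow_le_pow_right (by omega) (by omega))
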